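/- **Theorem 5.1.** Let $k\ge 1$ be an integer and let $$I_k=\{f\in C([0,1],M_k(\mathbb C)) : f(0)\in\mathbb C\cdot \mathbf 1_k,\ f(1)\in\mathbb C\cdot\mathbf 1_k\}$$ be the dimension drop interval algebra. For $f\in I_k$ let $\underline f(0),\underline f(1)\in\mathbb C$ be the scalars with $f(0)=\underline f(0)\mathbf 1_k$, $f(1)=\underline f(1)\mathbf 1_k$, and let $\imath: C[0,1]\to I_k$, $g\mapsto g\cdot\mathbf 1_k$, be the canonical inclusion. For every finite set $F\subset I_k$ and every $\varepsilon>0$ there is an $\eta>0$ with the following property. Let $X$ be (a space homeomorphic to) a finite simplicial complex of dimension at most $2$, $n$ a non-negative integer, $P\in M_n(C(X))=C(X,M_n(\mathbb C))$ a projection, and $\phi: I_k\to PM_n(C(X))P$ a unital $*$-homomorphism. Put $\phi'=\phi\circ\imath: C[0,1]\to PM_n(C(X))P$. For $x\in X$ let $Sp\,\phi'_x$ be the set with multiplicity $\{t_1,\dots,t_m\}\subset[0,1]$ for which there are mutually orthogonal rank one projections $p_1,\dots,p_m\in M_n(\mathbb C)$ with $\sum_i p_i=P(x)$ and $\phi'(g)(x)=\sum_i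 g(t_i)p_i$ for all $g\in C[0,1]$. Suppose that for every $x\in X$, counting multiplicity, $$\sharp(Sp\,\phi'_x\cap[0,\eta/4])\ge k\quad\text{and}\quad \sharp(Sp\,\phi'_x\cap[1-\eta/4,1])\ge k.$$ Then there are mutually orthogonal projections $Q_0,Q_1,P_1\in PM_n(C(X))P$ with $Q_0+Q_1+P_1=P$ and a unital $*$-homomorphism $\psi_1: M_k(C[0,1])\to P_1M_n(C(X))P_1$ such that 1. $\|\phi(f)-(\underline f(0)Q_0+\underline f(1)Q_1+\psi_1(f))\|<\varepsilon$ for all $f\in F$, where in $\psi_1(f)$ the element $f$ is regarded as an element of $M_k(C[0,1])$ through $I_k\subset M_k(C[0,1])=C([0,1],M_k(\mathbb C))$; 2. $\operatorname{rank} Q_0(x)\le k$ and $\operatorname{rank} Q_1(x)\le k$ for every $x\in X$. -/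

import Mathlib

open scoped Matrix Matrix.Norms.L2Operator

/- The C*-algebra `M_n(ℂ)` is `Matrix (Fin n) (Fin n) ℂ` with the operator norm of `ℂⁿ` with its
Euclidean norm, and `M_n(C(X))` is identified, as usual, with `C(X, M_n(ℂ))` (sup norm). -/

/-- `X` is (homeomorphic to) a finite simplicial complex of dimension at most `d`: it is the
underlying space of a complex of finitely many simplices in some `ℝ^N`, each having at most
`d + 1` vertices. -/
def IsFiniteSimplicialOfDimLE (X : Type*) [TopologicalSpace X] (d : ℕ) : Prop :=
  ∃ (N : ℕ) (K : Geometry.SimplicialComplex ℝ (EuclideanSpace ℝ (Fin N))),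
    K.faces.Finite ∧ (∀ s ∈ K.faces, s.card ≤ d + 1) ∧ Nonempty (X ≃ₜ K.space)

/-- The dimension drop interval algebra `I_k`: the functions `f : [0,1] → M_k(ℂ)` with
`f(0)` and `f(1)` in `ℂ · 1_k`. -/
noncomputable def dimDrop (k : ℕ) : StarSubalgebra ℂ C(unitInterval, Matrix (Fin k) (Fin k) ℂ) where
  carrier := {f | (∃ c : ℂ, f 0 = c • (1 : Matrix (Fin k) (Fin k) ℂ)) ∧
    ∃ c : ℂ, f 1 = c • (1 : Matrix (Fin k) (Fin k) ℂ)}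
  mul_mem' := by
    rintro f g ⟨⟨a, ha⟩, b, hb⟩ ⟨⟨a', ha'⟩, b', hb'⟩
    exact ⟨⟨a * a', by simp [ha, ha', smul_smul, mul_comm]⟩,
      b * b', by simp [hb, hb', smul_smul, mul_comm]⟩
  add_mem' := by
    rintro f g ⟨⟨a, ha⟩, b, hb⟩ ⟨⟨a', ha'⟩, b', hb'⟩
    exact ⟨⟨a + a', by simp [ha, ha', add_smul]⟩, b + b', by simp [hb, hb', add_smul]⟩
  algebraMap_mem' c := by
    refine ⟨⟨c, ?_⟩, c, ?_⟩ <;> simp [Algebra.algebraMap_eq_smul_one]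
  star_mem' := by
    rintro f ⟨⟨a, ha⟩, b, hb⟩
    exact ⟨⟨star a, by simp [ha]⟩, star b, by simp [hb]⟩

/-- For `f ∈ I_k`, the scalar `λ` with `f(0) = λ · 1_k` (unique when `k ≥ 1`). -/
noncomputable def dimDrop.val₀ {k : ℕ} (f : dimDrop k) : ℂ := f.2.1.choose

/-- For `f ∈ I_k`, the scalar `μ` with `f(1) = μ · 1_k` (unique when `k ≥ 1`). -/
noncomputable def dimDrop.val₁ {k : ℕ} (f : dimDrop k) : ℂ := f.2.2.choose

theorem dimDrop.val₀_spec {k : ℕ} (f : dimDrop k) :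
    (f : C(unitInterval, Matrix (Fin k) (Fin k) ℂ)) 0 = dimDrop.val₀ f • 1 := f.2.1.choose_spec

theorem dimDrop.val₁_spec {k : ℕ} (f : dimDrop k) :
    (f : C(unitInterval, Matrix (Fin k) (Fin k) ℂ)) 1 = dimDrop.val₁ f • 1 := f.2.2.choose_spec

/-- The canonical inclusion `C[0,1] → I_k`, `g ↦ g · 1_k`. -/
noncomputable def dimDrop.incl (k : ℕ) : C(unitInterval, ℂ) →⋆ₙₐ[ℂ] dimDrop k where
  toFun g := ⟨⟨fun t => g t • (1 : Matrix (Fin k) (Fin k) ℂ), by fun_prop⟩,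
    ⟨g 0, rfl⟩, g 1, rfl⟩
  map_smul' c g := by
    apply Subtype.ext; ext1 t
    simp [smul_smul]
  map_zero' := by
    apply Subtype.ext; ext1 t
    simp
  map_add' f g := by
    apply Subtype.ext; ext1 t
    simp [add_smul]
  map_mul' f g := by
    apply Subtype.ext; ext1 t
    simp [smul_smul, mul_comm]
  map_star' g := by
    apply Subtype.ext; ext1 t
    simp

/-- The corner algebra `P M_n(C(X)) P` of a projection `P ∈ M_n(C(X))`; its unit is `P`. -/
noncomputable def corner {X : Type*} [TopologicalSpace X] {n : ℕ} (P : C(X, Matrix (Fin n) (Fin n) ℂ))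
    (hP : IsStarProjection P) : NonUnitalStarSubalgebra ℂ C(X, Matrix (Fin n) (Fin n) ℂ) where
  carrier := {a | P * a * P = a}
  mul_mem' := by
    intro a b (ha : P * a * P = a) (hb : P * b * P = b)
    have h1 : P * a = a := by rw [← ha]; simp only [← mul_assoc, hP.isIdempotentElem.eq]
    have h2 : b * P = b := by rw [← hb]; simp only [mul_assoc, hP.isIdempotentElem.eq]
    change P * (a * b) * P = a * b
    rw [← mul_assoc, h1, mul_assoc, h2]
  add_mem' := by
    intro a b (ha : P * a * P = a) (hb : P * b * P = b)
    change P * (a + b) * P = a + b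
    rw [mul_add, add_mul, ha, hb]
  zero_mem' := by simp
  smul_mem' := by
    intro c a (ha : P * a * P = a)
    change P * (c • a) * P = c • a
    rw [mul_smul_comm, smul_mul_assoc, ha]
  star_mem' := by
    intro a (ha : P * a * P = a)
    change P * star a * P = star a
    conv_rhs => rw [← ha]
    simp [mul_assoc, hP.isSelfAdjoint.star_eq]

/-- `S` lists, with multiplicity, the spectrum of the homomorphism `π : C[0,1] → M_n(ℂ)`: there
are mutually orthogonal rank one projections `p_i` with sum `π(1)`, and points `t_i` with
`π(g) = ∑ g(t_i) p_i` for all `g`, such that `S = {t_1, …, t_m}`. -/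
def IsSpectrumOf {n : ℕ} (π : C(unitInterval, ℂ) →⋆ₙₐ[ℂ] Matrix (Fin n) (Fin n) ℂ) (S : Multiset unitInterval) : Prop :=
  ∃ (m : ℕ) (t : Fin m → unitInterval) (p : Fin m → Matrix (Fin n) (Fin n) ℂ),
    (∀ i, IsStarProjection (p i) ∧ (p i).rank = 1) ∧ (∀ i j, i ≠ j → p i * p j = 0) ∧
    ∑ i, p i = π 1 ∧ (∀ g, π g = ∑ i, g (t i) • p i) ∧ S = Finset.univ.val.map t

open Classical in
theorem diagonal_of_diagonal {n : ℕ} (ρ : C(unitInterval, ℂ) →⋆ₙₐ[ℂ] Matrix (Fin n) (Fin n) ℂ)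
    (d : Fin n → ℝ) (e : C(unitInterval, ℂ)) (he : ∀ s, e s = ((s : ℝ) : ℂ))
    (hd : ρ (1 + e) = Matrix.diagonal (fun i => (d i : ℂ))) :
    ∃ t : Fin n → unitInterval, ∀ f, ρ f = Matrix.diagonal (fun i => if d i = 0 then 0 else f (t i)) := by
  have hpos : ∀ h : C(unitInterval, ℂ), ∀ j, 0 ≤ (ρ (star h * h) j j).re := by
    intro h j
    rw [map_mul, map_star, Matrix.mul_apply, Complex.re_sum]
    refine Finset.sum_nonneg fun i _ => ?_
    simp only [Matrix.star_apply, RCLike.star_def, Complex.mul_re, Complex.conj_re, Complex.conj_im]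
    nlinarith [sq_nonneg (ρ h i j).re, sq_nonneg (ρ h i j).im]
  have h1e : star (⟨fun s : unitInterval => ((Real.sqrt s : ℝ) : ℂ), by fun_prop⟩ : C(unitInterval, ℂ)) *
      ⟨fun s : unitInterval => ((Real.sqrt s : ℝ) : ℂ), by fun_prop⟩ = e := by
    ext1 s
    simp only [ContinuousMap.mul_apply, ContinuousMap.star_apply, ContinuousMap.coe_mk,
      RCLike.star_def, Complex.conj_ofReal, he]
    rw [← Complex.ofReal_mul, Real.mul_self_sqrt s.2.1]
  have h2e : star (⟨fun s : unitInterval => ((Real.sqrt (1 - s) : ℝ) : ℂ), by fun_prop⟩ : C(unitInterval, ℂ)) *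
      ⟨fun s : unitInterval => ((Real.sqrt (1 - s) : ℝ) : ℂ), by fun_prop⟩ = 1 - e := by
    ext1 s
    simp only [ContinuousMap.mul_apply, ContinuousMap.star_apply, ContinuousMap.coe_mk,
      RCLike.star_def, Complex.conj_ofReal, he, ContinuousMap.sub_apply, ContinuousMap.one_apply]
    rw [← Complex.ofReal_mul, Real.mul_self_sqrt (sub_nonneg.2 s.2.2)]
    simp
  have he0 : ∀ j, 0 ≤ (ρ e j j).re := fun j => h1e ▸ hpos _ j
  have he1 : ∀ j, 0 ≤ (ρ (1 - e) j j).re := fun j => h2e ▸ hpos _ j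
  have hsum : ∀ j, (ρ 1 j j).re + (ρ e j j).re = d j := by
    intro j
    have := congrArg (fun A => (A j j).re) hd
    simpa [map_add] using this
  have hle : ∀ j, (ρ e j j).re ≤ (ρ 1 j j).re := by
    intro j
    have := he1 j
    rw [map_sub] at this
    simpa using this
  -- the unit
  have hcol : ∀ j, d j ≠ 0 → ∀ i, ρ 1 i j = if i = j then 1 else 0 := by
    intro j hj i
    have h : ρ 1 * ρ (1 + e) = ρ (1 + e) := by rw [← map_mul, one_mul]
    rw [hd] at h
    have h := congrFun (congrFun h i) j
    rw [Matrix.mul_diagonal] at h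
    have hj' : (d j : ℂ) ≠ 0 := by exact_mod_cast hj
    by_cases hij : i = j
    · subst hij
      rw [Matrix.diagonal_apply_eq] at h
      simpa [hj'] using h
    · rw [Matrix.diagonal_apply_ne _ hij] at h
      simpa [hj', hij] using h
  have hcol0 : ∀ j, d j = 0 → ∀ i, ρ 1 i j = 0 := by
    intro j hj i
    have hs : (ρ 1 j j).re ≤ 0 := by linarith [hsum j, he0 j]
    have h : ρ 1 = star (ρ 1) * ρ 1 := by
      rw [← map_star, ← map_mul]; simp
    rw [h, Matrix.mul_apply, Complex.re_sum] at hs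
    have hnn : ∀ i ∈ Finset.univ, 0 ≤ (star (ρ 1) j i * ρ 1 i j).re := by
      intro i _
      simp only [Matrix.star_apply, RCLike.star_def, Complex.mul_re, Complex.conj_re,
        Complex.conj_im]
      nlinarith [sq_nonneg (ρ 1 i j).re, sq_nonneg (ρ 1 i j).im]
    have h0 := (Finset.sum_eq_zero_iff_of_nonneg hnn).1 (le_antisymm hs (Finset.sum_nonneg hnn)) i
      (Finset.mem_univ _)
    simp only [Matrix.star_apply, RCLike.star_def, Complex.mul_re, Complex.conj_re,
      Complex.conj_im] at h0
    apply Complex.ext <;> simp <;>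
      nlinarith [sq_nonneg (ρ 1 i j).re, sq_nonneg (ρ 1 i j).im]
  have hone : ρ 1 = Matrix.diagonal (fun i => if d i = 0 then 0 else 1) := by
    ext i j
    by_cases hj : d j = 0
    · rw [hcol0 j hj]
      by_cases hij : i = j
      · subst hij; simp [hj]
      · simp [hij]
    · rw [hcol j hj]
      by_cases hij : i = j
      · subst hij; simp [hj]
      · simp [hij]
  have hrange : ∀ j, d j ≠ 0 → d j - 1 ∈ unitInterval := by
    intro j hj
    have h1 : (ρ 1 j j).re = 1 := by rw [hcol j hj]; simp
    constructor <;> linarith [hsum j, he0 j, hle j]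
  let t : Fin n → unitInterval := fun j => if hj : d j = 0 then 0 else ⟨d j - 1, hrange j hj⟩
  have hρe : ρ e = Matrix.diagonal (fun i => if d i = 0 then 0 else e (t i)) := by
    have h : ρ e = ρ (1 + e) - ρ 1 := by rw [map_add]; abel
    rw [h, hd, hone]
    ext i j
    by_cases hij : i = j
    · subst hij
      by_cases hi : d i = 0
      · simp [hi]
      · simp [hi, he, t]
    · simp [hij]
  refine ⟨t, ?_⟩
  have hρc : Continuous ρ := by
    exact AddMonoidHomClass.continuous_of_bound ρ 1
      (fun x => by simpa using NonUnitalStarAlgHom.norm_apply_le ρ x)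
  let S : StarSubalgebra ℂ C(unitInterval, ℂ) :=
    { carrier := {f | ρ f = Matrix.diagonal (fun i => if d i = 0 then 0 else f (t i))}
      mul_mem' := by
        intro f g hf hg
        simp only [Set.mem_ofPred_eq] at hf hg ⊢
        rw [map_mul, hf, hg, Matrix.diagonal_mul_diagonal]
        congr 1; ext i; split_ifs <;> simp
      add_mem' := by
        intro f g hf hg
        simp only [Set.mem_ofPred_eq] at hf hg ⊢
        rw [map_add, hf, hg, Matrix.diagonal_add]
        congr 1; ext i; split_ifs <;> simp
      algebraMap_mem' := by
        intro c
        simp only [Set.mem_ofPred_eq]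
        rw [Algebra.algebraMap_eq_smul_one, map_smul, hone, ← Matrix.diagonal_smul]
        congr 1; ext i; simp
      star_mem' := by
        intro f hf
        simp only [Set.mem_ofPred_eq] at hf ⊢
        rw [map_star, hf, Matrix.star_eq_conjTranspose, Matrix.diagonal_conjTranspose]
        congr 1; ext i; simp only [Pi.star_apply]; split_ifs <;> simp }
  have hSc : IsClosed (S : Set C(unitInterval, ℂ)) := by
    refine isClosed_eq hρc ?_
    refine Continuous.matrix_diagonal (continuous_pi fun i => ?_)
    split_ifs
    · exact continuous_const
    · exact continuous_eval_const (t i)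
  have hsep : S.SeparatesPoints := by
    intro a b hab
    refine ⟨e, ⟨e, hρe, rfl⟩, ?_⟩
    rw [he, he]
    intro h
    exact hab (Subtype.ext (by exact_mod_cast h))
  have htop := ContinuousMap.starSubalgebra_topologicalClosure_eq_top_of_separatesPoints S hsep
  intro f
  have hf : f ∈ S.topologicalClosure := htop ▸ StarSubalgebra.mem_top
  exact hSc.closure_subset_iff.2 le_rfl hf

open Classical in
theorem diagonal_eq_sum {n : ℕ} (d : Fin n → ℝ) (c : Fin n → ℂ) :
    Matrix.diagonal (fun i => if d i = 0 then 0 else c i) =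
      ∑ j : {i // d i ≠ 0}, c j • Matrix.single (j : Fin n) (j : Fin n) (1 : ℂ) := by
  have h2 := Finset.sum_subtype (F := inferInstance) (p := fun i => d i ≠ 0)
    (Finset.univ.filter fun i => d i ≠ 0) (fun x => by simp)
    (fun i => c i • Matrix.single i i (1 : ℂ))
  rw [← h2, Finset.sum_filter]
  ext a b
  rw [Matrix.sum_apply, Finset.sum_eq_single a]
  · by_cases hab : a = b
    · subst hab
      by_cases ha : d a = 0 <;> simp [ha]
    · by_cases ha : d a = 0 <;> simp [ha, hab]
  · intro k _ hc
    by_cases hc' : d k = 0 <;> simp [hc', hc]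
  · simp

/-- The spectral decomposition exists (finite-dimensional spectral theorem). -/
theorem exists_isSpectrumOf {n : ℕ} (π : C(unitInterval, ℂ) →⋆ₙₐ[ℂ] Matrix (Fin n) (Fin n) ℂ) :
    ∃ S, IsSpectrumOf π S := by
  classical
  let e : C(unitInterval, ℂ) := ⟨fun s => ((s : ℝ) : ℂ), by fun_prop⟩
  have hH : (π (1 + e)).IsHermitian := by
    change star (π (1 + e)) = _
    rw [← map_star]
    congr 1
    ext1 s
    simp [e]
  let Φ := Unitary.conjStarAlgAut ℂ (Matrix (Fin n) (Fin n) ℂ) hH.eigenvectorUnitary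
  let ρ : C(unitInterval, ℂ) →⋆ₙₐ[ℂ] Matrix (Fin n) (Fin n) ℂ :=
    (Φ.symm : Matrix (Fin n) (Fin n) ℂ →⋆ₙₐ[ℂ] Matrix (Fin n) (Fin n) ℂ).comp π
  have hρ : ∀ f, π f = Φ (ρ f) := fun f => (Φ.apply_symm_apply (π f)).symm
  obtain ⟨t, ht⟩ := diagonal_of_diagonal ρ hH.eigenvalues e (fun s => rfl) (by
    change Φ.symm (π (1 + e)) = _
    conv_lhs => rw [hH.spectral_theorem]
    exact Φ.symm_apply_apply _)
  let J := {i // hH.eigenvalues i ≠ 0}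
  let ι : Fin (Fintype.card J) ≃ J := (Fintype.equivFin J).symm
  let q : Fin n → Matrix (Fin n) (Fin n) ℂ := fun i => Φ (Matrix.single i i 1)
  have key : ∀ g, π g = ∑ a, g (t (ι a)) • q (ι a) := by
    intro g
    rw [ι.sum_comp (fun j : J => g (t j) • q j), hρ, ht]
    have h : Matrix.diagonal (fun i => if hH.eigenvalues i = 0 then 0 else g (t i)) =
        ∑ j : J, g (t j) • Matrix.single (j : Fin n) (j : Fin n) (1 : ℂ) :=
      diagonal_eq_sum _ _
    rw [h, map_sum]
    simp only [map_smul, q]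
  refine ⟨_, _, fun a => t (ι a), fun a => q (ι a), ?_, ?_, ?_, key, rfl⟩
  · intro a
    refine ⟨⟨?_, ?_⟩, ?_⟩
    · change q _ * q _ = q _
      simp only [q]; rw [← map_mul]; simp
    · change star (q _) = q _
      simp only [q]; rw [← map_star, Matrix.star_eq_conjTranspose]; simp
    · change (q _).rank = 1
      simp only [q, Φ, Unitary.conjStarAlgAut_apply]
      have hU : IsUnit ((hH.eigenvectorUnitary : Matrix (Fin n) (Fin n) ℂ)).det :=
        (Matrix.isUnit_iff_isUnit_det _).1 (Unitary.isUnit_coe)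
      have hU' : IsUnit (star (hH.eigenvectorUnitary : Matrix (Fin n) (Fin n) ℂ)).det :=
        (Matrix.isUnit_iff_isUnit_det _).1 (Unitary.isUnit_coe (U := star hH.eigenvectorUnitary))
      rw [Matrix.rank_mul_eq_left_of_isUnit_det _ _ hU',
        Matrix.rank_mul_eq_right_of_isUnit_det _ _ hU,
        ← Matrix.diagonal_single, Matrix.rank_diagonal]
      simp [Pi.single_apply]
  · intro a b hab
    have hab' : ((ι a : J) : Fin n) ≠ (ι b : J) := fun h => hab (ι.injective (Subtype.ext h))
    simp only [q]; rw [← map_mul, Matrix.single_mul_single_of_ne _ _ _ _ hab', map_zero]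
  · rw [key 1]; simp

/-- The spectrum, with multiplicity, of a homomorphism `C[0,1] → M_n(ℂ)`. -/
noncomputable def homSpectrum {n : ℕ} (π : C(unitInterval, ℂ) →⋆ₙₐ[ℂ] Matrix (Fin n) (Fin n) ℂ) : Multiset unitInterval :=
  (exists_isSpectrumOf π).choose

theorem isSpectrumOf_homSpectrum {n : ℕ} (π : C(unitInterval, ℂ) →⋆ₙₐ[ℂ] Matrix (Fin n) (Fin n) ℂ) :
    IsSpectrumOf π (homSpectrum π) := (exists_isSpectrumOf π).choose_spec

/-- Evaluation `M_n(C(X)) → M_n(ℂ)` at the point `x`. -/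
noncomputable def evalAt {X : Type*} [TopologicalSpace X] (n : ℕ) (x : X) :
    C(X, Matrix (Fin n) (Fin n) ℂ) →⋆ₙₐ[ℂ] Matrix (Fin n) (Fin n) ℂ where
  toFun a := a x
  map_smul' _ _ := rfl
  map_zero' := rfl
  map_add' _ _ := rfl
  map_mul' _ _ := rfl
  map_star' _ := rfl

/-- For `φ : I_k → P M_n(C(X)) P`, the composite `φ' : C[0,1] → I_k → P M_n(C(X)) P` followed by
evaluation at `x`. -/
noncomputable def centralAt {X : Type*} [TopologicalSpace X] {k n : ℕ}
    {P : C(X, Matrix (Fin n) (Fin n) ℂ)} {hP : IsStarProjection P}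
    (φ : dimDrop k →⋆ₙₐ[ℂ] corner P hP) (x : X) :
    C(unitInterval, ℂ) →⋆ₙₐ[ℂ] Matrix (Fin n) (Fin n) ℂ :=
  ((evalAt n x).comp (NonUnitalStarSubalgebraClass.subtype (corner P hP))).comp
    (φ.comp (dimDrop.incl k))

/-! Let `h` be the map of `[0,1]` that collapses `[0,η]` to `0` and `[1-η,1]` to `1`. It moves
points by at most `η`, so if `η` comes from the uniform continuity of the functions in `F`, then
`φ(f ∘ h)` is within `ε/2` of `φ(f)`. It remains to decompose `f ↦ φ(f ∘ h)` exactly.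

Let `l` be a cutoff that is `1` near `0` and vanishes beyond `η`. Where `φ_x(l · 1)` is a projection
`p`, the matrix `φ_x(f ∘ h)` acts on `p` as the scalar `f(0)`. If `e_ab` are `k × k` matrix units
under `p`, this part splits as `f(0)(p - ∑ e_aa) + ∑ f(0)_ab e_ab`. The first term is the point
evaluation carried by `Q₀`; the second makes sense for any `F` in `M_k(C[0,1])`. The other end is
treated alike, and the middle part is `φ(c · (F ∘ h))` with `c` vanishing at `0` and `1`, so it too
is defined for every `F` (`dimDrop.exists_starAlgHom_of_units`, `dimDrop.exists_decomposition`).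
What is needed is a continuous choice of matrix units whose complement has rank at most `k`.

One cutoff need not become a projection at every `x`. There are at most `n` spectral points at `x`,
so among `n + 1` cutoffs `l_j` whose transition intervals do not overlap, one does. The closed sets
`K_j` where `p_j = φ(l_j · 1)` is a projection therefore cover `X`. On `K_i ∩ K_j` with `i < j`, the
difference `p_j - p_i` carries the canonical matrix units `φ((l_j - l_i) e_ab)`, so units under
`p_i` enlarge to units under `p_j` with the same complement. Hence the choices can be glued
(`HasPlaneCover.exists_end_units`, `exists_selection`), provided that matrix units extend from
closed subsets of each `K_j`.

The extension uses `dim X ≤ 2`. Matrix units amount to a projection `q` and an isometry of `q ⊗ ℂ^k`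
into `p`. Keeping the rank of the complement between `1` and `k` forces `rank q = ⌊(rank p - 1)/k⌋`
and leaves `k · rank q < rank p`; this requires `p ≠ 0`, which the spectral points near the end
provide. Hermitian matrices with a repeated eigenvalue have real codimension `3`, and non-injective
matrices with more rows than columns have real codimension at least `4`. A map from a
two-dimensional space can be pushed off both (`HasPlaneCover.exists_extension_mapsTo`), which
extends first `q` and then the isometry. -/

/-! ### Finite complexes of dimension at most two. -/

/-- A space that embeds in some `ℝ^N` with image covered by finitely many `C¹` images of the
plane. -/
def HasPlaneCover (X : Type*) [TopologicalSpace X] : Prop :=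
  ∃ (N : ℕ) (e : X → EuclideanSpace ℝ (Fin N)), Topology.IsClosedEmbedding e ∧
    ∃ (ι : Type) (_ : Finite ι) (α : ι → (Fin 2 → ℝ) → EuclideanSpace ℝ (Fin N)),
      (∀ i, ContDiff ℝ 1 (α i)) ∧ ∀ x, ∃ i, e x ∈ Set.range (α i)

theorem convexHull_subset_range_plane {E : Type*} [AddCommGroup E] [Module ℝ E] (s : Finset E)
    (h0 : s.Nonempty) (hs : s.card ≤ 3) :
    ∃ a b c : E, convexHull ℝ (s : Set E) ⊆
      Set.range fun y : Fin 2 → ℝ => a + (y 0 • (b - a) + y 1 • (c - a)) := by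
  classical
  obtain ⟨a, b, c, habc⟩ : ∃ a b c : E, (s : Set E) ⊆ {a, b, c} := by
    have : s.card = 0 ∨ s.card = 1 ∨ s.card = 2 ∨ s.card = 3 := by omega
    rcases this with h | h | h | h
    · exact absurd h (Finset.card_pos.2 h0).ne'
    · obtain ⟨a, rfl⟩ := Finset.card_eq_one.1 h
      exact ⟨a, a, a, by simp⟩
    · obtain ⟨a, b, -, rfl⟩ := Finset.card_eq_two.1 h
      exact ⟨a, b, b, by simp⟩
    · obtain ⟨a, b, c, -, -, -, rfl⟩ := Finset.card_eq_three.1 h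
      exact ⟨a, b, c, by simp⟩
  refine ⟨a, b, c, convexHull_min (habc.trans ?_) ?_⟩
  · rintro x (rfl | rfl | rfl)
    · exact ⟨![0, 0], by simp⟩
    · exact ⟨![1, 0], by simp⟩
    · exact ⟨![0, 1], by simp⟩
  · rintro _ ⟨y, rfl⟩ _ ⟨z, rfl⟩ p q hp hq hpq
    refine ⟨p • y + q • z, ?_⟩
    obtain rfl : p = 1 - q := by linarith
    simp only [Pi.add_apply, Pi.smul_apply, smul_eq_mul]
    module

theorem IsFiniteSimplicialOfDimLE.hasPlaneCover {X : Type*} [TopologicalSpace X] [CompactSpace X]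
    (h : IsFiniteSimplicialOfDimLE X 2) : HasPlaneCover X := by
  obtain ⟨N, K, hK, hd, ⟨φ⟩⟩ := h
  refine ⟨N, fun x => (φ x : EuclideanSpace ℝ (Fin N)), ?_, K.faces, hK, ?_⟩
  · exact Continuous.isClosedEmbedding (by fun_prop) (Subtype.val_injective.comp φ.injective)
  · choose a b c habc using fun s : K.faces => convexHull_subset_range_plane (s : Finset _)
      (K.nonempty_of_mem_faces s.2) (hd s s.2)
    refine ⟨fun s y => a s + (y 0 • (b s - a s) + y 1 • (c s - a s)), fun s => by fun_prop, ?_⟩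
    intro x
    obtain ⟨s, hs, hx⟩ := Geometry.SimplicialComplex.mem_space_iff.1 (φ x).2
    exact ⟨⟨s, hs⟩, habc ⟨s, hs⟩ hx⟩

/-! ### General position by Hausdorff dimension. -/

/-- A set avoided by a generic translate of any `C¹` image of the plane. -/
def IsThin {E : Type*} [NormedAddCommGroup E] [NormedSpace ℝ E] (Z : Set E) : Prop :=
  ∀ f : (Fin 2 → ℝ) → E, ContDiff ℝ 1 f →
    dimH (Set.image2 (fun a b => a - b) (Set.range f) Z) < Module.finrank ℝ E

section Thin
variable {E : Type*} [NormedAddCommGroup E] [NormedSpace ℝ E]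

theorem IsThin.mono {Z Z' : Set E} (h : IsThin Z') (hZ : Z ⊆ Z') : IsThin Z := fun f hf =>
  (dimH_mono (Set.image2_subset_left hZ)).trans_lt (h f hf)

theorem IsThin.iUnion {ι : Type*} [Finite ι] [Nonempty ι] {Z : ι → Set E} (h : ∀ i, IsThin (Z i)) :
    IsThin (⋃ i, Z i) := by
  intro f hf
  rw [Set.image2_iUnion_right, dimH_iUnion]
  obtain ⟨i, hi⟩ := exists_eq_ciSup_of_finite
    (f := fun i => dimH (Set.image2 (fun a b => a - b) (Set.range f) (Z i)))
  rw [← hi]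
  exact h i f hf

/-- The differences `f y - ζ w` form the image of a `C¹` map on `ℝ² × G`, and such a map does not
raise Hausdorff dimension. Thus a smoothly parametrized set of codimension greater than `2` is thin.
-/
theorem IsThin.range {G : Type*} [NormedAddCommGroup G] [NormedSpace ℝ G] [FiniteDimensional ℝ G]
    {ζ : G → E} (hζ : ContDiff ℝ 1 ζ) (hd : Module.finrank ℝ G + 2 < Module.finrank ℝ E) :
    IsThin (Set.range ζ) := by
  intro f hf
  have : Set.image2 (fun a b => a - b) (Set.range f) (Set.range ζ) =
      Set.range fun p : (Fin 2 → ℝ) × G => f p.1 - ζ p.2 := by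
    ext z
    constructor
    · rintro ⟨_, ⟨y, rfl⟩, _, ⟨w, rfl⟩, h⟩
      exact ⟨(y, w), h⟩
    · rintro ⟨⟨y, w⟩, h⟩
      exact ⟨_, ⟨y, rfl⟩, _, ⟨w, rfl⟩, h⟩
  rw [this]
  have h : ContDiff ℝ 1 fun p : (Fin 2 → ℝ) × G => f p.1 - ζ p.2 := by fun_prop
  refine h.dimH_range_le.trans_lt ?_
  rw [Module.finrank_prod, Module.finrank_fin_fun]
  exact_mod_cast (by omega)

/-- After a Tietze extension to `ℝ^N` and a smooth approximation `G`, the translate `G - v` meets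
`Z` on `X` only if `v` is a difference of a point of some `G (α i y)` and a point of `Z`. These `v`
have Hausdorff dimension below `dim E`, so arbitrarily small `v` avoid them. -/
theorem HasPlaneCover.exists_avoiding [FiniteDimensional ℝ E] {X : Type*} [TopologicalSpace X]
    [CompactSpace X] (hX : HasPlaneCover X) {Z : Set E} (hZ : IsThin Z) {F : X → E}
    (hF : Continuous F) {δ : ℝ} (hδ : 0 < δ) :
    ∃ F' : X → E, Continuous F' ∧ (∀ x, dist (F' x) (F x) < δ) ∧ ∀ x, F' x ∉ Z := by
  obtain ⟨N, e, he, ι, hι, α, hα, hcov⟩ := hX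
  have : TietzeExtension E := TietzeExtension.of_tvs ℝ
  obtain ⟨g, hg⟩ := ContinuousMap.exists_extension he ⟨F, hF⟩
  obtain ⟨G, hG, hGc⟩ : ∃ G : C(EuclideanSpace ℝ (Fin N), E), (∀ x, dist (g (e x)) (G (e x)) < δ / 2) ∧
      ContDiff ℝ 1 G := by
    have hd := ContinuousMap.dense_setOfPred_contDiff (E := EuclideanSpace ℝ (Fin N)) (F := E) g
    rw [mem_closure_iff_nhds_basis (nhds_basis_uniformity
      Metric.uniformity_basis_dist.compactConvergenceUniformity)] at hd
    obtain ⟨G, hG, hG'⟩ := hd (Set.range e, δ / 2) ⟨isCompact_range he.continuous, half_pos hδ⟩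
    exact ⟨G, fun x => by rw [dist_comm]; exact hG' _ ⟨x, rfl⟩, ContDiff.of_le (Set.mem_ofPred_eq ▸ hG : ContDiff ℝ _ G) (by exact_mod_cast le_top)⟩
  have hbad : dimH (⋃ i, Set.image2 (fun a b => a - b) (Set.range fun y => G (α i y)) Z) ≤
      ⨆ i, dimH (Set.image2 (fun a b => a - b) (Set.range fun y => G (α i y)) Z) :=
    (dimH_iUnion _).le
  have hlt : dimH (⋃ i, Set.image2 (fun a b => a - b) (Set.range fun y => G (α i y)) Z) <
      Module.finrank ℝ E := by
    -- Without charts the union is empty; thinness tested on a constant map still gives `0 < dim E`.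
    rcases isEmpty_or_nonempty ι with h | h
    · have h0 := hZ (fun _ => 0) contDiff_const
      refine lt_of_le_of_lt ?_ h0
      simp
    · refine hbad.trans_lt ?_
      obtain ⟨i, hi⟩ := exists_eq_ciSup_of_finite
        (f := fun i => dimH (Set.image2 (fun a b => a - b) (Set.range fun y => G (α i y)) Z))
      rw [← hi]
      exact hZ _ (hGc.comp (hα i))
  obtain ⟨v, hv, hv0⟩ := (dense_compl_of_dimH_lt_finrank hlt).exists_mem_open
    Metric.isOpen_ball ⟨0, Metric.mem_ball_self (half_pos hδ)⟩
  refine ⟨fun x => G (e x) - v, by fun_prop (disch := exact he.continuous), ?_, ?_⟩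
  · intro x
    have h1 : F x = g (e x) := (DFunLike.congr_fun hg x).symm
    rw [h1, dist_comm]
    refine (dist_triangle _ (G (e x)) _).trans_lt ?_
    have h2 : dist (G (e x)) (G (e x) - v) < δ / 2 := by simpa [dist_eq_norm] using hv0
    linarith [hG x]
  · intro x hx
    obtain ⟨i, y, hy⟩ := hcov x
    refine hv (Set.mem_iUnion.2 ⟨i, G (e x), ⟨y, congrArg G hy⟩, _, hx, sub_sub_cancel _ _⟩)

/-- If the complement of the open set `G` is thin, maps into `G` extend from closed subsets. -/
theorem HasPlaneCover.exists_extension_mapsTo [FiniteDimensional ℝ E] {X : Type*}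
    [TopologicalSpace X] [CompactSpace X] [T2Space X] (hX : HasPlaneCover X) {G : Set E}
    (hG : IsOpen G) (hZ : IsThin Gᶜ) {A : Set X} (hA : IsClosed A) {F : X → E}
    (hF : ContinuousOn F A) (hFG : Set.MapsTo F A G) :
    ∃ F' : X → E, Continuous F' ∧ Set.EqOn F' F A ∧ ∀ x, F' x ∈ G := by
  have : TietzeExtension E := TietzeExtension.of_tvs ℝ
  obtain ⟨g, hg⟩ := ContinuousMap.exists_restrict_eq hA ⟨A.domRestrict F, hF.domRestrict⟩
  have hgF : Set.EqOn g F A := fun x hx => DFunLike.congr_fun hg ⟨x, hx⟩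
  have hK : IsCompact (g '' A) := hA.isCompact.image g.continuous
  have hKG : g '' A ⊆ G := by
    rintro _ ⟨x, hx, rfl⟩
    rw [hgF hx]; exact hFG hx
  obtain ⟨δ, hδ, hδG⟩ := hK.exists_thickening_subset_open hG hKG
  obtain ⟨F₁, hF₁, hF₁d, hF₁Z⟩ := hX.exists_avoiding hZ g.continuous (half_pos hδ)
  let U := g ⁻¹' Metric.thickening (δ / 2) (g '' A)
  have hU : IsOpen U := Metric.isOpen_thickening.preimage g.continuous
  have hAU : A ⊆ U := fun x hx =>
    Metric.self_subset_thickening (half_pos hδ) _ ⟨x, hx, rfl⟩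
  obtain ⟨χ, hχ0, hχ1, hχ⟩ := exists_continuous_zero_one_of_isClosed hU.isClosed_compl hA
    (Set.disjoint_left.2 fun x hx hx' => hx (hAU hx'))
  -- The blend is `g` on `A`. On `U` it lies within `δ/2` of `g`, hence within `δ` of `g '' A` and
  -- inside `G`; off `U` it is `F₁`, which avoids the complement of `G`.
  refine ⟨fun x => F₁ x + χ x • (g x - F₁ x), by fun_prop, ?_, ?_⟩
  · intro x hx
    simp [hχ1 hx, hgF hx]
  · intro x
    by_cases hx : x ∈ U
    · refine hδG ?_
      obtain ⟨z, hz, hzx⟩ := Metric.mem_thickening_iff.1 hx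
      refine Metric.mem_thickening_iff.2 ⟨z, hz, ?_⟩
      refine (dist_triangle _ (g x) _).trans_lt ?_
      have h1 : dist (F₁ x + χ x • (g x - F₁ x)) (g x) < δ / 2 := by
        rw [dist_eq_norm, show F₁ x + χ x • (g x - F₁ x) - g x = (1 - χ x) • (F₁ x - g x) by module,
          norm_smul, ← dist_eq_norm (F₁ x), Real.norm_eq_abs, abs_of_nonneg (by linarith [(hχ x).2])]
        refine lt_of_le_of_lt ?_ (hF₁d x)
        exact mul_le_of_le_one_left dist_nonneg (by linarith [(hχ x).1])
      linarith
    · simp only [hχ0 (show x ∈ Uᶜ from hx), Pi.zero_apply, zero_smul, add_zero]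
      exact not_not.1 (hF₁Z x)

end Thin

section
open scoped ComplexOrder

/-! ### Injective matrices. -/

/-- A kernel vector with nonzero `j`-th entry can be scaled to have `j`-th entry `1`, and then
column `j` is determined by the other columns and the other entries of the vector. Counting
parameters gives real codimension `2(|ι| - |κ| + 1) ≥ 4`. -/
theorem isThin_setOf_not_injective {ι κ : Type*} [Fintype ι] [Fintype κ] [Nonempty κ]
    (h : Fintype.card κ < Fintype.card ι) :
    IsThin {C : ι → κ → ℂ | ∃ v : κ → ℂ, v ≠ 0 ∧ (Matrix.of C) *ᵥ v = 0} := by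
  classical
  let ζ : ∀ j : κ, ({l // l ≠ j} → ℂ) × (ι → {l // l ≠ j} → ℂ) → (ι → κ → ℂ) := fun j p i l =>
    if h : l ≠ j then p.2 i ⟨l, h⟩ else -∑ s, p.1 s * p.2 i s
  have hζ : ∀ j, ContDiff ℝ 1 (ζ j) := by
    intro j
    refine contDiff_pi.2 fun i => contDiff_pi.2 fun l => ?_
    by_cases h : l ≠ j
    · simp only [ζ, dif_pos h]; fun_prop
    · simp only [ζ, dif_neg h]; fun_prop
  refine IsThin.mono (IsThin.iUnion fun j => IsThin.range (hζ j) ?_) ?_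
  · have hc : Fintype.card {l // l ≠ j} + 1 = Fintype.card κ := by
      simp only [ne_eq, Fintype.card_subtype_compl, Fintype.card_unique]
      have : 0 < Fintype.card κ := Fintype.card_pos
      omega
    simp only [Module.finrank_prod, Module.finrank_pi_fintype, Complex.finrank_real_complex,
      Finset.sum_const, Finset.card_univ, smul_eq_mul]
    rw [← hc]
    rw [← hc] at h
    nlinarith
  · rintro C ⟨v, hv, hCv⟩
    obtain ⟨j, hj⟩ := Function.ne_iff.1 hv
    refine Set.mem_iUnion.2 ⟨j, (fun l => v l / v j, fun i l => C i l), ?_⟩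
    ext i l
    by_cases h : l ≠ j
    · simp [ζ, h]
    · obtain rfl : l = j := not_not.1 h
      have h1 := congrFun hCv i
      simp only [Matrix.mulVec, dotProduct, Matrix.of_apply, Pi.zero_apply] at h1
      rw [Fintype.sum_eq_add_sum_subtype_ne _ l] at h1
      have hj' : v l ≠ 0 := hj
      simp only [ζ, ne_eq, not_true_eq_false, dite_false]
      have h2 : ∑ s : {s // s ≠ l}, v s / v l * C i s = (∑ s : {s // s ≠ l}, C i s * v s) / v l := by
        rw [Finset.sum_div]
        exact Finset.sum_congr rfl fun s _ => by ring
      rw [h2]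
      field_simp
      linear_combination -h1

theorem Matrix.exists_mul_eq_one_iff {ι κ : Type*} [Fintype ι] [Fintype κ] [DecidableEq κ]
    (C : Matrix ι κ ℂ) :
    (∃ L : Matrix κ ι ℂ, L * C = 1) ↔ ¬ ∃ v : κ → ℂ, v ≠ 0 ∧ C *ᵥ v = 0 := by
  constructor
  · rintro ⟨L, hL⟩ ⟨v, hv, hCv⟩
    apply hv
    rw [← Matrix.one_mulVec v, ← hL, ← Matrix.mulVec_mulVec, hCv, Matrix.mulVec_zero]
  · intro h
    have hd : (Cᴴ * C).det ≠ 0 := by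
      intro h0
      obtain ⟨v, hv, h1⟩ := Matrix.exists_mulVec_eq_zero_iff.2 h0
      exact h ⟨v, hv, (Matrix.conjTranspose_mul_self_mulVec_eq_zero C v).1 h1⟩
    refine ⟨(Cᴴ * C)⁻¹ * Cᴴ, ?_⟩
    rw [Matrix.mul_assoc, Matrix.nonsing_inv_mul _ (isUnit_iff_ne_zero.2 hd)]

theorem Matrix.isOpen_setOf_injective {ι κ : Type*} [Fintype ι] [Fintype κ] :
    IsOpen {C : Matrix ι κ ℂ | ¬ ∃ v : κ → ℂ, v ≠ 0 ∧ C *ᵥ v = 0} := by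
  classical
  have : {C : Matrix ι κ ℂ | ¬ ∃ v : κ → ℂ, v ≠ 0 ∧ C *ᵥ v = 0} = {C | (Cᴴ * C).det ≠ 0} := by
    ext C
    rw [Set.mem_ofPred_eq, Set.mem_ofPred_eq, ne_eq, ← Matrix.exists_mulVec_eq_zero_iff]
    simp only [Matrix.conjTranspose_mul_self_mulVec_eq_zero]
  rw [this]
  exact isOpen_ne_fun (by fun_prop) continuous_const

theorem HasPlaneCover.exists_injective_extension {X : Type*} [TopologicalSpace X] [CompactSpace X]
    [T2Space X] (hX : HasPlaneCover X) {ι κ : Type*} [Fintype ι] [Fintype κ] [DecidableEq κ]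
    (h : Fintype.card κ < Fintype.card ι) {A : Set X} (hA : IsClosed A) {C : X → Matrix ι κ ℂ}
    (hC : ContinuousOn C A) (hinj : ∀ x ∈ A, ∃ L : Matrix κ ι ℂ, L * C x = 1) :
    ∃ C' : X → Matrix ι κ ℂ, Continuous C' ∧ Set.EqOn C' C A ∧
      ∀ x, ∃ L : Matrix κ ι ℂ, L * C' x = 1 := by
  rcases isEmpty_or_nonempty κ with hκ | hκ
  · exact ⟨fun _ => 0, continuous_const, fun _ _ => Subsingleton.elim _ _,
      fun _ => ⟨0, Subsingleton.elim _ _⟩⟩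
  · simp only [Matrix.exists_mul_eq_one_iff] at hinj ⊢
    refine hX.exists_extension_mapsTo (E := ι → κ → ℂ) (F := C) Matrix.isOpen_setOf_injective
      ?_ hA hC hinj
    convert isThin_setOf_not_injective h using 1
    ext C
    exact not_not

/-! ### Hermitian matrices with a repeated eigenvalue. -/

/-- Real coordinates on the space of Hermitian matrices. -/
noncomputable def hermOf {ι : Type*} (r : ι → ι → ℝ) : Matrix ι ι ℂ :=
  Matrix.of fun i j => ((r i j + r j i : ℝ) : ℂ) + ((r i j - r j i : ℝ) : ℂ) * Complex.I

/-- The inverse of `hermOf`. -/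
noncomputable def hermCoord {ι : Type*} (M : Matrix ι ι ℂ) : ι → ι → ℝ := fun i j =>
  ((M i j).re + (M i j).im) / 2

theorem isHermitian_hermOf {ι : Type*} (r : ι → ι → ℝ) : (hermOf r).IsHermitian := by
  ext i j
  simp [hermOf, Matrix.conjTranspose_apply, Complex.ext_iff, add_comm]

theorem hermCoord_hermOf {ι : Type*} (r : ι → ι → ℝ) : hermCoord (hermOf r) = r := by
  ext i j
  simp [hermOf, hermCoord]

theorem hermOf_hermCoord {ι : Type*} {M : Matrix ι ι ℂ} (hM : M.IsHermitian) :
    hermOf (hermCoord M) = M := by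
  ext i j
  have h := hM.apply i j
  simp only [Complex.ext_iff, RCLike.star_def, Complex.conj_re, Complex.conj_im] at h
  simp only [hermOf, hermCoord, Matrix.of_apply, Complex.ext_iff]
  constructor <;> simp <;> linarith [h.1, h.2]

theorem continuous_hermOf {ι : Type*} : Continuous (hermOf : (ι → ι → ℝ) → Matrix ι ι ℂ) := by
  unfold hermOf
  refine continuous_matrix fun i j => ?_
  simp only [Matrix.of_apply]
  fun_prop

theorem continuous_hermCoord {ι : Type*} : Continuous (hermCoord : Matrix ι ι ℂ → ι → ι → ℝ) := by
  unfold hermCoord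
  fun_prop

theorem Fintype.sum_eq_add_add_sum_subtype {ι M : Type*} [Fintype ι] [DecidableEq ι]
    [AddCommMonoid M] {p q : ι} (hpq : p ≠ q) (f : ι → M) :
    ∑ j, f j = f p + (f q + ∑ t : {l // l ≠ p ∧ l ≠ q}, f t) := by
  rw [← Finset.sum_erase_add _ _ (Finset.mem_univ p), add_comm,
    ← Finset.sum_erase_add _ _ (Finset.mem_erase.2 ⟨hpq.symm, Finset.mem_univ q⟩), add_comm _ (f q)]
  congr 2
  exact Finset.sum_subtype _ (fun x => by simp [and_comm]) f

/-- Independent vectors have a nonzero `2 × 2` minor, at rows `p` and `q`; the coefficients are the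
entries of the inverse of that minor. -/
theorem exists_reduced_pair {ι : Type*} {v w : ι → ℂ} (hvw : LinearIndependent ℂ ![v, w]) :
    ∃ p q, p ≠ q ∧ ∃ a b c d : ℂ, (a • v + b • w) p = 1 ∧ (a • v + b • w) q = 0 ∧
      (c • v + d • w) p = 0 ∧ (c • v + d • w) q = 1 := by
  rw [LinearIndependent.pair_iff] at hvw
  obtain ⟨p, hp⟩ : ∃ p, v p ≠ 0 := by
    by_contra! h
    have := (hvw 1 0 (by ext i; simp [h i])).1
    simp at this
  obtain ⟨q, hq⟩ : ∃ q, v p * w q - w p * v q ≠ 0 := by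
    by_contra! h
    have := (hvw (-w p) (v p) (by ext i; have := h i; simp; linear_combination this)).2
    exact hp this
  have hpq : p ≠ q := by rintro rfl; exact hq (by ring)
  refine ⟨p, q, hpq, w q / (v p * w q - w p * v q), -v q / (v p * w q - w p * v q),
    -w p / (v p * w q - w p * v q), v p / (v p * w q - w p * v q), ?_, ?_, ?_, ?_⟩ <;>
  · simp only [Pi.add_apply, Pi.smul_apply, smul_eq_mul, div_eq_mul_inv]
    first
    | ring1
    | linear_combination mul_inv_cancel₀ hq

/-- With `m = |ι|`, subtracting the double eigenvalue `c` leaves a Hermitian matrix with a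
two-dimensional space in its kernel. It is determined by its block off two indices `p, q` and by a
kernel basis that is the identity on those rows. The parameters number `1 + (m - 2)² + 4(m - 2) = m²
- 3`, so the codimension is `3`. -/
theorem isThin_setOf_repeated_eigenvalue {ι : Type*} [Fintype ι] [Nontrivial ι] :
    IsThin {r : ι → ι → ℝ | ∃ (c : ℝ) (v w : ι → ℂ), LinearIndependent ℂ ![v, w] ∧
      hermOf r *ᵥ v = (c : ℂ) • v ∧ hermOf r *ᵥ w = (c : ℂ) • w} := by
  classical
  let P := {pq : ι × ι // pq.1 ≠ pq.2}
  have : Nonempty P := by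
    obtain ⟨p, q, h⟩ := exists_pair_ne ι
    exact ⟨⟨(p, q), h⟩⟩
  let T : P → Type _ := fun pq => {l // l ≠ pq.1.1 ∧ l ≠ pq.1.2}
  -- Row `t` of `cm` is a coefficient vector: column `j` of a matrix killing the reduced pair `v, w`
  -- is the combination, with weights `cm t j`, of the columns `t` other than `p, q`.
  let cm : ∀ pq : P, (T pq → ℂ) → (T pq → ℂ) → T pq → ι → ℂ := fun pq v w t j =>
    if j = pq.1.1 then -v t else if j = pq.1.2 then -w t else if (t : ι) = j then 1 else 0
  let ζ : ∀ pq : P, ℝ × (T pq → T pq → ℝ) × (T pq → ℂ) × (T pq → ℂ) → (ι → ι → ℝ) :=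
    fun pq x => hermCoord (Matrix.of fun i j => (if i = j then (x.1 : ℂ) else 0) +
      ∑ s, ∑ t, (starRingEnd ℂ) (cm pq x.2.2.1 x.2.2.2 s i) * hermOf x.2.1 s t *
        cm pq x.2.2.1 x.2.2.2 t j)
  have hcm : ∀ (pq : P) (t j), ContDiff ℝ 1
      fun x : ℝ × (T pq → T pq → ℝ) × (T pq → ℂ) × (T pq → ℂ) =>
        cm pq x.2.2.1 x.2.2.2 t j := by
    intro pq t j
    simp only [cm]
    split_ifs <;> fun_prop
  have hre : ContDiff ℝ 1 Complex.re := Complex.reCLM.contDiff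
  have him : ContDiff ℝ 1 Complex.im := Complex.imCLM.contDiff
  have hof : ContDiff ℝ 1 (fun a : ℝ => (a : ℂ)) := Complex.ofRealCLM.contDiff
  have hconj : ContDiff ℝ 1 (starRingEnd ℂ) := Complex.conjCLE.contDiff
  have hζ : ∀ pq, ContDiff ℝ 1 (ζ pq) := by
    intro pq
    refine contDiff_pi.2 fun i => contDiff_pi.2 fun j => ?_
    simp only [ζ, hermCoord, Matrix.of_apply]
    have hE : ContDiff ℝ 1 fun x : ℝ × (T pq → T pq → ℝ) × (T pq → ℂ) × (T pq → ℂ) =>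
        (if i = j then (x.1 : ℂ) else 0) +
      ∑ s, ∑ t, (starRingEnd ℂ) (cm pq x.2.2.1 x.2.2.2 s i) * hermOf x.2.1 s t *
        cm pq x.2.2.1 x.2.2.2 t j := by
      refine ContDiff.add ?_ (ContDiff.sum fun s _ => ContDiff.sum fun t _ => ?_)
      · split_ifs
        · exact hof.comp contDiff_fst
        · exact contDiff_const
      · refine ((hconj.comp (hcm pq s i)).mul ?_).mul (hcm pq t j)
        simp only [hermOf, Matrix.of_apply]
        exact (hof.comp (by fun_prop)).add ((hof.comp (by fun_prop)).mul contDiff_const)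
    exact ((hre.comp hE).add (him.comp hE)).div_const 2
  refine IsThin.mono (IsThin.iUnion fun pq => IsThin.range (hζ pq) ?_) ?_
  · have hc : Fintype.card (T pq) + 2 = Fintype.card ι := by
      have h := Fintype.sum_eq_add_add_sum_subtype pq.2 fun _ => 1
      simp only [Finset.sum_const, Finset.card_univ, smul_eq_mul, mul_one] at h
      rw [h]
      simp only [T]
      ring
    simp only [Module.finrank_prod, Module.finrank_pi_fintype, Complex.finrank_real_complex,
      Finset.sum_const, Finset.card_univ, smul_eq_mul, Module.finrank_self]
    rw [← hc]
    nlinarith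
  · rintro r ⟨c, v₀, w₀, hvw, hv₀, hw₀⟩
    obtain ⟨p, q, hpq, a, b, a', b', hvp, hvq, hwp, hwq⟩ := exists_reduced_pair hvw
    have hv : hermOf r *ᵥ (a • v₀ + b • w₀) = (c : ℂ) • (a • v₀ + b • w₀) := by
      rw [Matrix.mulVec_add, Matrix.mulVec_smul, Matrix.mulVec_smul, hv₀, hw₀]; module
    have hw : hermOf r *ᵥ (a' • v₀ + b' • w₀) = (c : ℂ) • (a' • v₀ + b' • w₀) := by
      rw [Matrix.mulVec_add, Matrix.mulVec_smul, Matrix.mulVec_smul, hv₀, hw₀]; module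
    generalize a • v₀ + b • w₀ = v at *
    generalize a' • v₀ + b' • w₀ = w at *
    obtain ⟨pq, hpq'⟩ : ∃ pq : P, pq = ⟨(p, q), hpq⟩ := ⟨_, rfl⟩
    obtain rfl : pq.1.1 = p := by rw [hpq']
    obtain rfl : pq.1.2 = q := by rw [hpq']
    let M : ι → ι → ℂ := fun i j => hermOf r i j - if i = j then (c : ℂ) else 0
    have hker : ∀ u : ι → ℂ, hermOf r *ᵥ u = (c : ℂ) • u → ∀ i, ∑ j, M i j * u j = 0 := by
      intro u hu i
      have h1 := congrFun hu i
      simp only [Matrix.mulVec, dotProduct, Pi.smul_apply, smul_eq_mul] at h1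
      simp [M, sub_mul, Finset.sum_sub_distrib, h1]
    have hMv := hker v hv
    have hMw := hker w hw
    simp only [Fintype.sum_eq_add_add_sum_subtype hpq, hvp, hvq, hwp, hwq, mul_one, mul_zero,
      zero_add] at hMv hMw
    have hcol : ∀ i j, M i j = ∑ t : T pq, M i t * cm pq (fun t => v t) (fun t => w t) t j := by
      intro i j
      by_cases hjp : j = pq.1.1
      · subst hjp
        simp only [cm, if_true, mul_neg, Finset.sum_neg_distrib]
        linear_combination hMv i
      by_cases hjq : j = pq.1.2
      · subst hjq
        simp only [cm, if_neg hjp, if_true, mul_neg, Finset.sum_neg_distrib]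
        linear_combination hMw i
      · simp only [cm, if_neg hjp, if_neg hjq]
        rw [Finset.sum_eq_single (⟨j, hjp, hjq⟩ : T pq)]
        · simp
        · intro t _ ht
          rw [if_neg (fun h => ht (Subtype.ext h)), mul_zero]
        · simp
    have hherm : ∀ i j, M i j = starRingEnd ℂ (M j i) := by
      intro i j
      have h1 := (isHermitian_hermOf r).apply i j
      simp only [M, map_sub, eq_comm (a := j)]
      rw [← h1]
      split_ifs <;> simp
    -- The diagonal of `hermOf r` is `2 r i i`, so subtracting `c` from the matrix subtracts `c / 2`
    -- from the coordinates.
    refine Set.mem_iUnion.2 ⟨pq, (c, fun s t => r s t - if s = t then c / 2 else 0,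
      fun t => v t, fun t => w t), ?_⟩
    conv_rhs => rw [← hermCoord_hermOf r]
    simp only [ζ]
    congr 1
    ext i j
    have hsub : ∀ s t : T pq, hermOf (fun s t : T pq => r s t - if s = t then c / 2 else 0) s t =
        M s t := by
      intro s t
      simp only [hermOf, Matrix.of_apply, M]
      by_cases hst : s = t
      · subst hst; simp; ring
      · simp [hst, Ne.symm hst, Subtype.val_injective.ne hst]
    simp only [hsub, Matrix.of_apply]
    -- Self-adjointness turns the reduction of columns into one of rows; applying both recovers `M`
    -- from its block.
    have h2 : M i j = ∑ s : T pq, ∑ t : T pq,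
        starRingEnd ℂ (cm pq (fun t => v t) (fun t => w t) s i) * M s t *
          cm pq (fun t => v t) (fun t => w t) t j := by
      rw [hcol i j, Finset.sum_comm]
      refine Finset.sum_congr rfl fun t _ => ?_
      rw [← Finset.sum_mul, hherm i t, hcol t i, map_sum]
      congr 1
      refine Finset.sum_congr rfl fun s _ => ?_
      rw [map_mul, ← hherm, mul_comm]
    rw [← h2]
    simp only [M]
    ring

theorem IsStarProjection.eq_zero_of_trace {ι : Type*} [Fintype ι] {p : Matrix ι ι ℂ} (hp : IsStarProjection p)
    (h : p.trace = 0) : p = 0 := by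
  have h1 : (pᴴ * p).trace = 0 := by
    rw [← Matrix.star_eq_conjTranspose, hp.isSelfAdjoint.star_eq, hp.isIdempotentElem.eq, h]
  exact Matrix.trace_conjTranspose_mul_self_eq_zero_iff.1 h1

/-! ### Spectral projections and extension of projections. -/

section UpperProjection
variable {ι : Type*} [Fintype ι] [DecidableEq ι]

open Classical in
/-- The spectral projection of a Hermitian matrix for the half-line `(c, ∞)`. -/
noncomputable def upperProj (c : ℝ) (M : Matrix ι ι ℂ) : Matrix ι ι ℂ :=
  cfc (fun t : ℝ => if c < t then (1 : ℝ) else 0) M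

theorem Matrix.continuousOn_spectrum (M : Matrix ι ι ℂ) (f : ℝ → ℝ) : ContinuousOn f (spectrum ℝ M) :=
  (Matrix.finite_real_spectrum (A := M)).continuousOn f

theorem Matrix.isStarProjection_cfc (M : Matrix ι ι ℂ)
    {f : ℝ → ℝ} (hf : ∀ t, f t * f t = f t) : IsStarProjection (cfc f M) := by
  refine ⟨?_, cfc_predicate f M⟩
  change _ * _ = _
  rw [← cfc_mul f f M (M.continuousOn_spectrum f) (M.continuousOn_spectrum f)]
  simp only [hf]

theorem isStarProjection_upperProj (M : Matrix ι ι ℂ) (c : ℝ) :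
    IsStarProjection (upperProj c M) :=
  M.isStarProjection_cfc fun t => by split_ifs <;> simp

theorem Matrix.trace_eq_rank {p : Matrix ι ι ℂ} (hp : IsIdempotentElem p) :
    p.trace = (p.rank : ℂ) := by
  have hp' : IsIdempotentElem p.toLin' := by
    change _ * _ = _
    rw [Module.End.mul_eq_comp, ← Matrix.toLin'_mul, hp.eq]
  have h := LinearMap.IsProj.trace ((LinearMap.isProj_range_iff_isIdempotentElem _).2 hp')
  rw [Matrix.trace_toLin'_eq] at h
  rw [h]
  rfl

/-- The two projections are nested, so their difference is a projection of trace zero. Consequently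
the projection depends only on the number of eigenvalues above the cut, and the cut need not vary
continuously. -/
theorem upperProj_eq_of_trace_eq {M : Matrix ι ι ℂ} {c c' : ℝ}
    (h : (upperProj c M).trace = (upperProj c' M).trace) : upperProj c M = upperProj c' M := by
  wlog hcc : c ≤ c' generalizing c c'
  · exact (this h.symm (le_of_not_ge hcc)).symm
  have h1 : upperProj c M - upperProj c' M =
      cfc (fun t : ℝ => (if c < t then (1 : ℝ) else 0) - (if c' < t then (1 : ℝ) else 0)) M := by
    rw [cfc_sub _ _ M (M.continuousOn_spectrum _) (M.continuousOn_spectrum _)]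
    rfl
  refine sub_eq_zero.1 (IsStarProjection.eq_zero_of_trace ?_ ?_)
  · rw [h1]
    refine M.isStarProjection_cfc fun t => ?_
    split_ifs <;> first | (exfalso; linarith) | norm_num
  · rw [Matrix.trace_sub, h, sub_self]

theorem Matrix.IsHermitian.trace_cfc {M : Matrix ι ι ℂ} (hM : M.IsHermitian) (f : ℝ → ℝ) :
    (cfc f M).trace = ∑ i, (f (hM.eigenvalues i) : ℂ) := by
  rw [hM.cfc_eq, Matrix.IsHermitian.cfc, Unitary.conjStarAlgAut_apply, Matrix.trace_mul_cycle,
    Unitary.coe_star_mul_self, one_mul, Matrix.trace_diagonal]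
  rfl

/-- The step function is continuous away from `c`, and by upper hemicontinuity the spectra of nearby
matrices stay in a compact set that misses `c`. -/
theorem upperProj_continuousAt {X : Type*} [TopologicalSpace X] {M : X → Matrix ι ι ℂ}
    (hM : ∀ x, (M x).IsHermitian) (hMc : Continuous M) {x₀ : X} {c : ℝ}
    (hc : c ∉ spectrum ℝ (M x₀)) :
    ContinuousAt (fun x => upperProj c (M x)) x₀ ∧ ∀ᶠ x in nhds x₀, c ∉ spectrum ℝ (M x) := by
  have hs : {c}ᶜ ∈ nhdsSet (spectrum ℝ (M x₀)) :=
    isOpen_compl_singleton.mem_nhdsSet.2 fun t ht => by rintro rfl; exact hc ht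
  obtain ⟨S, ⟨hS₁, hS₂⟩, hS₃⟩ :=
    (spectrum.isCompact (𝕜 := ℝ) (M x₀)).nhdsSet_basis_isCompact.mem_iff.mp hs
  have hev : ∀ᶠ x in nhds x₀, spectrum ℝ (M x) ⊆ S := by
    have := (upperHemicontinuous_spectrum ℝ (Matrix ι ι ℂ)).upperHemicontinuousAt (M x₀) _ hS₁
    exact hMc.continuousAt.eventually (this.mono fun _ => subset_of_mem_nhdsSet)
  refine ⟨?_, hev.mono fun x hx hcx => hS₃ (hx hcx) rfl⟩
  refine ContinuousAt.cfc hS₂ _ hMc.continuousAt hev (Filter.Eventually.of_forall hM) ?_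
  intro t ht
  have htc : t ≠ c := hS₃ ht
  refine ContinuousAt.continuousWithinAt ?_
  rcases lt_or_gt_of_ne htc with h | h
  · refine continuousAt_const (y := (0 : ℝ)) |>.congr ?_
    filter_upwards [eventually_lt_nhds h] with s hs
    rw [if_neg hs.le.not_gt]
  · refine continuousAt_const (y := (1 : ℝ)) |>.congr ?_
    filter_upwards [eventually_gt_nhds h] with s hs
    rw [if_pos hs]

/-- If `c` is not in the spectrum, the number of eigenvalues above `c` is locally constant. -/
theorem eventually_trace_upperProj_eq {X : Type*} [TopologicalSpace X] {M : X → Matrix ι ι ℂ}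
    (hM : ∀ x, (M x).IsHermitian) (hMc : Continuous M) {x₀ : X} {c : ℝ}
    (hc : c ∉ spectrum ℝ (M x₀)) :
    ∀ᶠ x in nhds x₀, (upperProj c (M x)).trace = (upperProj c (M x₀)).trace := by
  have h1 : ContinuousAt (fun x => (upperProj c (M x)).trace) x₀ :=
    (Continuous.matrix_trace continuous_id).continuousAt.comp (upperProj_continuousAt hM hMc hc).1
  have h2 := Metric.continuousAt_iff'.1 h1 1 one_pos
  filter_upwards [h2] with x hx
  rw [Matrix.trace_eq_rank (isStarProjection_upperProj (M x) c).isIdempotentElem,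
    Matrix.trace_eq_rank (isStarProjection_upperProj (M x₀) c).isIdempotentElem] at hx ⊢
  rw [dist_eq_norm, ← Int.cast_natCast, ← Int.cast_natCast (R := ℂ) (upperProj c (M x₀)).rank,
      ← Int.cast_sub, Complex.norm_intCast] at hx
  have h3 : |((upperProj c (M x)).rank : ℤ) - (upperProj c (M x₀)).rank| < 1 := by
    exact_mod_cast hx
  rw [Int.abs_lt_one_iff] at h3
  have : (upperProj c (M x)).rank = (upperProj c (M x₀)).rank := by omega
  rw [this]

theorem Finset.exists_card_filter_lt_eq (S : Finset ℝ) (J : ℕ) (hJ : J ≤ S.card) :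
    ∃ c, c ∉ S ∧ (S.filter (c < ·)).card = J := by
  classical
  induction S using Finset.induction_on_max generalizing J with
  | empty => exact ⟨0, by simp, by simpa [eq_comm] using hJ⟩
  | insert a s ha ih =>
    have has : a ∉ s := fun h => lt_irrefl _ (ha a h)
    rw [Finset.card_insert_of_notMem has] at hJ
    have key : ∀ c, c < a → c ∉ s → (insert a s).filter (c < ·) = insert a (s.filter (c < ·)) := by
      intro c hc _
      rw [Finset.filter_insert, if_pos hc]
    rcases J with _ | _ | J
    · refine ⟨a + 1, ?_, ?_⟩
      · intro h
        rcases Finset.mem_insert.1 h with h | h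
        · linarith
        · linarith [ha _ h]
      · rw [Finset.card_eq_zero, Finset.filter_eq_empty_iff]
        intro x hx
        rcases Finset.mem_insert.1 hx with rfl | h
        · linarith
        · linarith [ha _ h]
    · obtain ⟨c, hc, hca⟩ : ∃ c, (∀ x ∈ s, x < c) ∧ c < a := by
        have h1 : ∀ᶠ c in nhdsWithin a (Set.Iio a), ∀ x ∈ s, x < c :=
          (Finset.eventually_all s).2 fun x hx =>
            Filter.Eventually.filter_mono nhdsWithin_le_nhds (eventually_gt_nhds (ha x hx))
        exact (h1.and self_mem_nhdsWithin).exists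
      have hcs : c ∉ s := fun h => lt_irrefl _ (hc c h)
      refine ⟨c, by simp [hca.ne, hcs], ?_⟩
      rw [key c hca hcs, Finset.card_insert_of_notMem (by simp [has]), zero_add,
        Nat.add_eq_right, Finset.card_eq_zero, Finset.filter_eq_empty_iff]
      exact fun x hx => (hc x hx).le.not_gt
    · obtain ⟨c, hc, hcJ⟩ := ih (J + 1) (by omega)
      obtain ⟨x, hx⟩ := Finset.card_pos.1 (by rw [hcJ]; omega : 0 < (s.filter (c < ·)).card)
      rw [Finset.mem_filter] at hx
      have hca := hx.2.trans (ha x hx.1)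
      refine ⟨c, by simp [hca.ne, hc], ?_⟩
      rw [key c hca hc, Finset.card_insert_of_notMem (by simp [has]), hcJ]

/-- Hermitian matrices with a spectral gap below the `J` largest eigenvalues, in the real
coordinates `hermOf`. -/
def gapSet (ι : Type*) [Fintype ι] [DecidableEq ι] (J : ℕ) : Set (ι → ι → ℝ) :=
  {r | ∃ c : ℝ, c ∉ spectrum ℝ (hermOf r) ∧ (upperProj c (hermOf r)).trace = J}

theorem isOpen_gapSet (J : ℕ) : IsOpen (gapSet ι J) := by
  rw [isOpen_iff_mem_nhds]
  rintro r ⟨c, hc, hJ⟩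
  filter_upwards [(upperProj_continuousAt isHermitian_hermOf continuous_hermOf hc).2,
    eventually_trace_upperProj_eq isHermitian_hermOf continuous_hermOf hc] with s h1 h2
  exact ⟨c, h1, h2.trans hJ⟩

/-- If the eigenvalues are distinct, some cut lies just below the `J` largest. Hence a matrix
outside the gap set has a repeated eigenvalue. -/
theorem isThin_compl_gapSet [Nontrivial ι] {J : ℕ} (hJ : J ≤ Fintype.card ι) :
    IsThin (gapSet ι J)ᶜ := by
  refine isThin_setOf_repeated_eigenvalue.mono fun r hr => ?_
  have hH := isHermitian_hermOf r
  have hinj : ¬ Function.Injective hH.eigenvalues := by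
    intro hinj
    obtain ⟨c, hc, hcJ⟩ := Finset.exists_card_filter_lt_eq (Finset.univ.image hH.eigenvalues) J
      (by rw [Finset.card_image_of_injective _ hinj]; exact hJ)
    refine hr ⟨c, ?_, ?_⟩
    · rw [hH.spectrum_real_eq_range_eigenvalues]
      simpa using hc
    · rw [upperProj, hH.trace_cfc, ← hcJ, Finset.filter_image, Finset.card_image_of_injective _ hinj,
        Finset.card_filter]
      push_cast
      exact Finset.sum_congr rfl fun i _ => by split_ifs <;> simp
  simp only [Function.Injective, not_forall] at hinj
  obtain ⟨i, j, hij, hne⟩ := hinj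
  refine ⟨hH.eigenvalues i, hH.eigenvectorBasis i, hH.eigenvectorBasis j, ?_, ?_, ?_⟩
  · have h1 := hH.eigenvectorBasis.orthonormal.linearIndependent
    have h2 := (h1.comp ![i, j] (by
      intro a b; fin_cases a <;> fin_cases b <;> simp [hne, Ne.symm hne])).map'
        (WithLp.linearEquiv 2 ℂ (ι → ℂ)).toLinearMap (LinearEquiv.ker _)
    rw [LinearIndependent.pair_iff]
    intro s t hst
    have h3 := Fintype.linearIndependent_iff.1 h2 ![s, t] (by simpa [Fin.sum_univ_two] using hst)
    exact ⟨h3 0, h3 1⟩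
  · exact hH.mulVec_eigenvectorBasis i
  · rw [hij]; exact hH.mulVec_eigenvectorBasis j

theorem IsStarProjection.spectrum_subset {p : Matrix ι ι ℂ} (hp : IsStarProjection p) :
    spectrum ℝ p ⊆ {0, 1} := by
  exact hp.isIdempotentElem.spectrum_subset ℝ

theorem upperProj_half {p : Matrix ι ι ℂ} (hp : IsStarProjection p) : upperProj (1 / 2) p = p := by
  have h : upperProj (1 / 2) p = cfc (fun t : ℝ => t) p := by
    refine cfc_congr fun t ht => ?_
    rcases hp.spectrum_subset ht with rfl | rfl <;> norm_num
  rw [h, cfc_id' ℝ p hp.isSelfAdjoint]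

/-- Projections of constant rank extend from closed subsets of a two-dimensional space. -/
theorem HasPlaneCover.exists_projection_extension {X : Type*} [TopologicalSpace X] [CompactSpace X]
    [T2Space X] (hX : HasPlaneCover X) {J : ℕ} (hJ : J ≤ Fintype.card ι) {A : Set X}
    (hA : IsClosed A) {q : X → Matrix ι ι ℂ} (hq : ContinuousOn q A)
    (hqp : ∀ x ∈ A, IsStarProjection (q x)) (hqJ : ∀ x ∈ A, (q x).trace = J) :
    ∃ q' : X → Matrix ι ι ℂ, Continuous q' ∧ Set.EqOn q' q A ∧
      ∀ x, IsStarProjection (q' x) ∧ (q' x).trace = J := by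
  -- The extreme ranks allow only the constant projections `0` and `1`; for the others `ι` has at
  -- least two elements.
  by_cases hJ0 : J = 0
  · subst hJ0
    refine ⟨fun _ => 0, continuous_const, fun x hx => ?_, fun x => ⟨IsStarProjection.zero _, by simp⟩⟩
    exact ((hqp x hx).eq_zero_of_trace (by simpa using hqJ x hx)).symm
  by_cases hJ1 : J = Fintype.card ι
  · refine ⟨fun _ => 1, continuous_const, fun x hx => ?_, fun x => ⟨IsStarProjection.one _, by simp [hJ1]⟩⟩
    refine (sub_eq_zero.1 ((hqp x hx).one_sub.eq_zero_of_trace ?_))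
    rw [Matrix.trace_sub, hqJ x hx, hJ1]
    simp
  have : Nontrivial ι := Fintype.one_lt_card_iff_nontrivial.1 (by omega)
  obtain ⟨r, hr, hrq, hrG⟩ := hX.exists_extension_mapsTo (isOpen_gapSet J) (isThin_compl_gapSet hJ)
    hA (continuous_hermCoord.comp_continuousOn hq) (by
      intro x hx
      have h1 : hermOf (hermCoord (q x)) = q x := hermOf_hermCoord (hqp x hx).isSelfAdjoint
      refine ⟨1 / 2, ?_, ?_⟩
      · simp only [Function.comp_apply, h1]
        intro h
        rcases (hqp x hx).spectrum_subset h with h | h <;> norm_num at h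
      · simp only [Function.comp_apply, h1, upperProj_half (hqp x hx), hqJ x hx])
  choose c hc hcJ using hrG
  have hM : ∀ x, (hermOf (r x)).IsHermitian := fun x => isHermitian_hermOf _
  have hMc : Continuous fun x => hermOf (r x) := continuous_hermOf.comp hr
  refine ⟨fun x => upperProj (c x) (hermOf (r x)), ?_, ?_, fun x =>
    ⟨isStarProjection_upperProj _ _, hcJ x⟩⟩
  · rw [continuous_iff_continuousAt]
    intro x₀
    -- The cuts `c x` are chosen arbitrarily, but near `x₀` the fixed cut `c x₀` also has `J`
    -- eigenvalues above it and so yields the same projection.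
    refine (upperProj_continuousAt hM hMc (hc x₀)).1.congr ?_
    filter_upwards [eventually_trace_upperProj_eq hM hMc (hc x₀)] with x hx
    exact upperProj_eq_of_trace_eq (by rw [hx, hcJ, hcJ])
  · intro x hx
    have h1 : hermOf (r x) = q x := by
      rw [hrq hx]; exact hermOf_hermCoord (hqp x hx).isSelfAdjoint
    have h2 : upperProj (c x) (hermOf (r x)) = upperProj (1 / 2) (hermOf (r x)) := by
      refine upperProj_eq_of_trace_eq ?_
      rw [hcJ, h1, upperProj_half (hqp x hx), hqJ x hx]
    exact h2.trans (by rw [h1, upperProj_half (hqp x hx)])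

end UpperProjection

/-! ### Gluing continuous selections. -/

open Classical in
/-- Continuous selections of increasing families of fibres, glued along a closed cover. -/
theorem exists_selection {X Y : Type*} [TopologicalSpace X] [TopologicalSpace Y] [Nonempty Y]
    (N : ℕ) {K : ℕ → Set X} (hK : ∀ i, IsClosed (K i)) {S : ℕ → X → Set Y}
    (hS : ∀ i j, i < j → j < N → ∀ x ∈ K i ∩ K j, S i x ⊆ S j x)
    (hext : ∀ i < N, ∀ A ⊆ K i, IsClosed A → ∀ f : X → Y, ContinuousOn f A →
      (∀ x ∈ A, f x ∈ S i x) →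
      ∃ g : X → Y, ContinuousOn g (K i) ∧ Set.EqOn g f A ∧ ∀ x ∈ K i, g x ∈ S i x) :
    ∃ f : X → Y, ContinuousOn f (⋃ i < N, K i) ∧
      ∀ x ∈ ⋃ i < N, K i, ∃ j < N, x ∈ K j ∧ (∀ i < j, x ∉ K i) ∧ f x ∈ S j x := by
  induction N with
  | zero => exact ⟨fun _ => Classical.arbitrary Y, by simp, by simp⟩
  | succ m ih =>
    obtain ⟨f, hf, hfS⟩ := ih (fun i j hij hj => hS i j hij (by omega))
      (fun i hi => hext i (by omega))
    have hY : IsClosed (⋃ i < m, K i) :=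
      (Set.finite_lt_nat m).isClosed_biUnion fun i _ => hK i
    -- On the overlap `f` takes values in some earlier fibre, which is contained in `S m x`, so it
    -- is admissible data for the next extension.
    obtain ⟨g, hg, hgf, hgS⟩ := hext m (by omega) ((⋃ i < m, K i) ∩ K m) Set.inter_subset_right
      (hY.inter (hK m)) f (hf.mono Set.inter_subset_left) (by
        rintro x ⟨hx, hxm⟩
        obtain ⟨j, hj, hxj, -, h⟩ := hfS x hx
        exact hS j m hj (by omega) x ⟨hxj, hxm⟩ h)
    have hU : (⋃ i < m + 1, K i) = (⋃ i < m, K i) ∪ K m := Set.biUnion_lt_succ K m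
    have hfe : Set.EqOn (fun x => if x ∈ ⋃ i < m, K i then f x else g x) f (⋃ i < m, K i) :=
      fun x hx => if_pos hx
    have hge : Set.EqOn (fun x => if x ∈ ⋃ i < m, K i then f x else g x) g (K m) := by
      intro x hx
      by_cases h : x ∈ ⋃ i < m, K i
      · exact (if_pos h).trans (hgf ⟨h, hx⟩).symm
      · exact if_neg h
    refine ⟨fun x => if x ∈ ⋃ i < m, K i then f x else g x, ?_, ?_⟩
    · rw [hU]
      exact (hf.congr hfe).union_of_isClosed (hg.congr hge) hY (hK m)
    · rw [hU]
      intro x hx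
      by_cases h : x ∈ ⋃ i < m, K i
      · obtain ⟨j, hj, h1, h2, h3⟩ := hfS x h
        exact ⟨j, by omega, h1, h2, by rw [show _ = f x from hfe h]; exact h3⟩
      · have hxm : x ∈ K m := hx.resolve_left h
        refine ⟨m, by omega, hxm, fun i hi hxi => h (Set.mem_biUnion hi hxi), ?_⟩
        rw [show _ = g x from hge hxm]
        exact hgS x hxm

/-- The relative extension property for continuous selections is local. -/
theorem exists_selection_of_locally {X Y : Type*} [TopologicalSpace X] [CompactSpace X]
    [TopologicalSpace Y] [Nonempty Y] {K : Set X} (hK : IsClosed K) {S : X → Set Y}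
    (hloc : ∀ x ∈ K, ∃ N ∈ nhds x, IsClosed N ∧ ∀ A ⊆ K ∩ N, IsClosed A →
      ∀ f : X → Y, ContinuousOn f A → (∀ x ∈ A, f x ∈ S x) →
      ∃ g : X → Y, ContinuousOn g (K ∩ N) ∧ Set.EqOn g f A ∧ ∀ x ∈ K ∩ N, g x ∈ S x)
    {A : Set X} (hA : IsClosed A) (hAK : A ⊆ K) {f : X → Y} (hf : ContinuousOn f A)
    (hfS : ∀ x ∈ A, f x ∈ S x) :
    ∃ g : X → Y, ContinuousOn g K ∧ Set.EqOn g f A ∧ ∀ x ∈ K, g x ∈ S x := by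
  choose! N hN hNc hext using hloc
  obtain ⟨t, htK, ht⟩ := hK.isCompact.elim_nhds_subcover N hN
  let e := t.equivFin
  -- The prescribed set `A` becomes piece `0`, with fibre the single value `f x`. A point of `A` has
  -- least index `0`, so the glued selection agrees with `f` there.
  let C : ℕ → Set X := fun i => match i with
    | 0 => A
    | i + 1 => if h : i < t.card then K ∩ N (e.symm ⟨i, h⟩) else ∅
  let S' : ℕ → X → Set Y := fun i x => match i with
    | 0 => {f x}
    | _ + 1 => S x
  have hCs : ∀ i (h : i < t.card), C (i + 1) = K ∩ N (e.symm ⟨i, h⟩) := fun i h => dif_pos h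
  have hCU : (⋃ i < t.card + 1, C i) = K := by
    ext x
    simp only [Set.mem_iUnion, exists_prop]
    constructor
    · rintro ⟨_ | i, hi, hx⟩
      · exact hAK hx
      · rw [hCs i (by omega)] at hx
        exact hx.1
    · intro hx
      obtain ⟨y, hy, hxy⟩ := Set.mem_iUnion₂.1 (ht hx)
      refine ⟨e ⟨y, hy⟩ + 1, by omega, ?_⟩
      rw [hCs _ (e ⟨y, hy⟩).2]
      exact ⟨hx, by simpa using hxy⟩
  obtain ⟨g, hg, hgS⟩ := exists_selection (t.card + 1) (K := C) (S := S') (by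
      rintro (_ | i)
      · exact hA
      · by_cases h : i < t.card
        · rw [hCs i h]
          exact hK.inter (hNc _ (htK _ (e.symm ⟨i, h⟩).2))
        · simp only [C, dif_neg h]; exact isClosed_empty) (by
      rintro (_ | i) (_ | j) hij hj x ⟨hx, -⟩
      · omega
      · rintro _ rfl; exact hfS x hx
      · omega
      · exact subset_rfl) (by
      rintro (_ | i) hi B hB hBc f' hf' hfB
      · exact ⟨f, hf, fun x hx => (hfB x hx).symm, fun x _ => rfl⟩
      · have h : i < t.card := by omega
        rw [hCs i h] at hB ⊢
        exact hext _ (htK _ (e.symm ⟨i, h⟩).2) B hB hBc f' hf' hfB)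
  rw [hCU] at hg hgS
  refine ⟨g, hg, fun x hx => ?_, fun x hx => ?_⟩
  · obtain ⟨_ | j, hj, -, h1, h2⟩ := hgS x (hAK hx)
    · exact h2
    · exact absurd hx (h1 0 (by omega))
  · obtain ⟨_ | j, hj, h0, -, h2⟩ := hgS x hx
    · rw [show g x = f x from h2]; exact hfS x h0
    · exact h2

/-! ### Extension of injections and isometries between projection bundles. -/

section Isometry
variable {ι : Type*} [Fintype ι] [DecidableEq ι]

/-- An orthonormal basis of the range of a projection. -/
theorem IsStarProjection.exists_frame {p : Matrix ι ι ℂ} (hp : IsStarProjection p) :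
    ∃ r, r = p.rank ∧ ∃ W : Matrix ι (Fin r) ℂ, Wᴴ * W = 1 ∧ W * Wᴴ = p := by
  have hH : p.IsHermitian := hp.isSelfAdjoint
  have hc : Fintype.card (Fin p.rank) = Fintype.card {i // hH.eigenvalues i ≠ 0} := by
    rw [Fintype.card_fin, hH.rank_eq_card_non_zero_eigs]
  let σ := Fintype.equivOfCardEq hc
  have hU := Unitary.coe_star_mul_self hH.eigenvectorUnitary
  set U : Matrix ι ι ℂ := (hH.eigenvectorUnitary).1 with hUdef
  have h01 : ∀ i, hH.eigenvalues i ≠ 0 → hH.eigenvalues i = 1 := fun i hi =>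
    (hp.spectrum_subset (hH.eigenvalues_mem_spectrum_real i)).resolve_left hi
  refine ⟨p.rank, rfl, Matrix.of fun i a => U i (σ a), ?_, ?_⟩
  · ext a b
    have h1 := congrFun (congrFun hU (σ a)) (σ b)
    simp only [Matrix.mul_apply, Matrix.star_apply, Matrix.conjTranspose_apply, Matrix.of_apply] at h1 ⊢
    rw [h1]
    simp [Matrix.one_apply, Subtype.val_inj]
  · have h2 := hH.spectral_theorem
    rw [Unitary.conjStarAlgAut_apply, ← hUdef] at h2
    conv_rhs => rw [h2]
    ext i j
    rw [Matrix.mul_apply, Matrix.mul_apply]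
    simp only [Matrix.conjTranspose_apply, Matrix.of_apply, Matrix.mul_diagonal,
      Matrix.star_apply, Function.comp_apply]
    rw [σ.sum_comp (fun a : {i // hH.eigenvalues i ≠ 0} => U i a * star (U j a))]
    have h3 := Finset.sum_subtype (F := inferInstance) (p := fun a => hH.eigenvalues a ≠ 0)
      (Finset.univ.filter fun a => hH.eigenvalues a ≠ 0) (fun x => by simp)
      (fun a => U i a * star (U j a))
    rw [← h3, Finset.sum_filter]
    refine Finset.sum_congr rfl fun a _ => ?_
    by_cases h : hH.eigenvalues a = 0
    · simp [h]
    · simp [h01 a h]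

/-- An element intertwining two projections, invertible if they are close. -/
def intertwiner (p q : Matrix ι ι ℂ) : Matrix ι ι ℂ := p * q + (1 - p) * (1 - q)

theorem intertwiner_mul {p q : Matrix ι ι ℂ} (hp : IsIdempotentElem p) (hq : IsIdempotentElem q) :
    p * intertwiner p q = intertwiner p q * q := by
  have hp := hp.eq
  have hq := hq.eq
  simp only [intertwiner, mul_add, add_mul, mul_sub, sub_mul, mul_one, one_mul, ← mul_assoc, hp]
  simp only [mul_assoc, hq]
  abel

theorem eventually_isUnit_intertwiner {X : Type*} [TopologicalSpace X] {K : Set X}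
    {P : X → Matrix ι ι ℂ} (hP : ContinuousOn P K) {x₀ : X} (hx₀ : x₀ ∈ K)
    (hp : IsIdempotentElem (P x₀)) :
    ∀ᶠ x in nhdsWithin x₀ K, IsUnit (intertwiner (P x) (P x₀)) := by
  have h1 : ContinuousWithinAt (fun x => intertwiner (P x) (P x₀)) K x₀ := by
    have := hP x₀ hx₀
    unfold intertwiner
    fun_prop
  have h2 : IsUnit (intertwiner (P x₀) (P x₀)) := by
    have : intertwiner (P x₀) (P x₀) = 1 := by
      simp only [intertwiner, mul_sub, sub_mul, mul_one, one_mul, hp.eq]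
      abel
    rw [this]; exact isUnit_one
  exact h1.eventually (Units.isOpen.mem_nhds h2)

/-- Expanding `(Bq - B)ᴴ (Bq - B)` with `Bᴴ B = q` gives `0`. -/
theorem Matrix.mul_eq_self_of_conjTranspose_mul_self {m κ : Type*} [Fintype m] [Fintype κ]
    {B : Matrix m κ ℂ} {q : Matrix κ κ ℂ} (hq : IsStarProjection q) (h : Bᴴ * B = q) :
    B * q = B := by
  have hqH : qᴴ = q := hq.isSelfAdjoint
  rw [← sub_eq_zero, ← Matrix.conjTranspose_mul_self_eq_zero, Matrix.conjTranspose_sub,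
    Matrix.conjTranspose_mul, hqH]
  calc (q * Bᴴ - Bᴴ) * (B * q - B) = q * (Bᴴ * B) * q - q * (Bᴴ * B) - Bᴴ * B * q + Bᴴ * B := by
        simp only [Matrix.sub_mul, Matrix.mul_sub, Matrix.mul_assoc]; abel
    _ = 0 := by simp only [h, hq.isIdempotentElem.eq]; abel

theorem ContinuousOn.matrix_mul {X α β γ : Type*} [TopologicalSpace X] [Fintype β] {K : Set X}
    {f : X → Matrix α β ℂ} {g : X → Matrix β γ ℂ} (hf : ContinuousOn f K) (hg : ContinuousOn g K) :
    ContinuousOn (fun x => f x * g x) K :=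
  (continuous_fst.matrix_mul continuous_snd).comp_continuousOn (hf.prodMk hg)

theorem ContinuousOn.matrix_inv {X : Type*} [TopologicalSpace X] {K : Set X}
    {z : X → Matrix ι ι ℂ} (hz : ContinuousOn z K) (hu : ∀ x ∈ K, IsUnit (z x)) :
    ContinuousOn (fun x => (z x)⁻¹) K := by
  intro x hx
  obtain ⟨u, hu⟩ := hu x hx
  have h := NormedRing.inverse_continuousAt u
  rw [hu] at h
  have h2 := h.comp_continuousWithinAt (hz x hx)
  refine h2.congr (fun y _ => ?_) ?_ <;> simp [Matrix.nonsing_inv_eq_ringInverse]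

/-- Injective bundle maps between projection bundles extend from closed sets, if the rank of the
target exceeds that of the source. -/
theorem HasPlaneCover.exists_bundle_injection_extension {κ : Type*} [Fintype κ] [DecidableEq κ]
    {X : Type*} [TopologicalSpace X] [CompactSpace X] [T2Space X] (hX : HasPlaneCover X)
    {K : Set X} (hK : IsClosed K) {P : X → Matrix ι ι ℂ} {R : X → Matrix κ κ ℂ}
    (hPc : ContinuousOn P K) (hRc : ContinuousOn R K) (hP : ∀ x ∈ K, IsStarProjection (P x))
    (hR : ∀ x ∈ K, IsStarProjection (R x)) (hrank : ∀ x ∈ K, (R x).rank < (P x).rank)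
    {A : Set X} (hA : IsClosed A) (hAK : A ⊆ K) {B : X → Matrix ι κ ℂ} (hB : ContinuousOn B A)
    (hBS : ∀ x ∈ A, P x * B x = B x ∧ B x * R x = B x ∧ ∃ L : Matrix κ ι ℂ, L * B x = R x) :
    ∃ B' : X → Matrix ι κ ℂ, ContinuousOn B' K ∧ Set.EqOn B' B A ∧ ∀ x ∈ K,
      P x * B' x = B' x ∧ B' x * R x = B' x ∧ ∃ L : Matrix κ ι ℂ, L * B' x = R x := by
  refine exists_selection_of_locally hK (S := fun x => {B : Matrix ι κ ℂ | P x * B = B ∧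
    B * R x = B ∧ ∃ L : Matrix κ ι ℂ, L * B = R x}) ?_ hA hAK hB hBS
  intro x₀ hx₀
  obtain ⟨U, hU, hUz⟩ := (mem_nhdsWithin_iff_exists_mem_nhds_inter).1
    ((eventually_isUnit_intertwiner hPc hx₀ (hP x₀ hx₀).isIdempotentElem).and
      (eventually_isUnit_intertwiner hRc hx₀ (hR x₀ hx₀).isIdempotentElem))
  obtain ⟨N, hN, hNc, hNU⟩ := exists_mem_nhds_isClosed_subset hU
  have hu : ∀ x ∈ K ∩ N, IsUnit (intertwiner (P x) (P x₀)) ∧ IsUnit (intertwiner (R x) (R x₀)) :=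
    fun x hx => hUz ⟨hNU hx.2, hx.1⟩
  refine ⟨N, hN, hNc, fun D hD hDc f hf hfS => ?_⟩
  -- Near `x₀` the intertwiners `y, z` identify the bundles with their fibres at `x₀`, and the
  -- frames `V, W` identify those fibres with `ℂ^m` and `ℂ^l`. A bundle map `f` becomes the matrix
  -- `Vᴴ y⁻¹ f z W`, and injectivity on the range of `R` becomes injectivity of this matrix.
  obtain ⟨m, hm, V, hV1, hV2⟩ := (hP x₀ hx₀).exists_frame
  obtain ⟨l, hl, W, hW1, hW2⟩ := (hR x₀ hx₀).exists_frame
  set y : X → Matrix ι ι ℂ := fun x => intertwiner (P x) (P x₀) with hy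
  set z : X → Matrix κ κ ℂ := fun x => intertwiner (R x) (R x₀) with hz
  have hyc : ContinuousOn y (K ∩ N) := by
    have := hPc.mono (Set.inter_subset_left (t := N))
    simp only [hy, intertwiner]; fun_prop
  have hzc : ContinuousOn z (K ∩ N) := by
    have := hRc.mono (Set.inter_subset_left (t := N))
    simp only [hz, intertwiner]; fun_prop
  have hyi := hyc.matrix_inv fun x hx => (hu x hx).1
  have hzi := hzc.matrix_inv fun x hx => (hu x hx).2
  have hy1 : ∀ x ∈ K ∩ N, y x * (y x)⁻¹ = 1 ∧ (y x)⁻¹ * y x = 1 := fun x hx => by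
    have := (Matrix.isUnit_iff_isUnit_det _).1 (hu x hx).1
    exact ⟨Matrix.mul_nonsing_inv _ this, Matrix.nonsing_inv_mul _ this⟩
  have hz1 : ∀ x ∈ K ∩ N, z x * (z x)⁻¹ = 1 ∧ (z x)⁻¹ * z x = 1 := fun x hx => by
    have := (Matrix.isUnit_iff_isUnit_det _).1 (hu x hx).2
    exact ⟨Matrix.mul_nonsing_inv _ this, Matrix.nonsing_inv_mul _ this⟩
  have hyP : ∀ x ∈ K ∩ N, P x * y x = y x * P x₀ := fun x hx =>
    intertwiner_mul (hP x hx.1).isIdempotentElem (hP x₀ hx₀).isIdempotentElem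
  have hzR : ∀ x ∈ K ∩ N, R x * z x = z x * R x₀ := fun x hx =>
    intertwiner_mul (hR x hx.1).isIdempotentElem (hR x₀ hx₀).isIdempotentElem
  have hzR' : ∀ x ∈ K ∩ N, (z x)⁻¹ * R x = R x₀ * (z x)⁻¹ := fun x hx => by
    calc (z x)⁻¹ * R x = (z x)⁻¹ * (R x * z x) * (z x)⁻¹ := by
          simp only [Matrix.mul_assoc, (hz1 x hx).1, Matrix.mul_one]
      _ = R x₀ * (z x)⁻¹ := by
          rw [hzR x hx, ← Matrix.mul_assoc, (hz1 x hx).2, Matrix.one_mul]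
  have hVP : P x₀ * V = V := by rw [← hV2, Matrix.mul_assoc, hV1, Matrix.mul_one]
  have hWR : Wᴴ * R x₀ = Wᴴ := by rw [← hW2, ← Matrix.mul_assoc, hW1, Matrix.one_mul]
  have hRW : R x₀ * W = W := by rw [← hW2, Matrix.mul_assoc, hW1, Matrix.mul_one]
  obtain ⟨C, hC, hCe, hCL⟩ := hX.exists_injective_extension
    (C := fun x => Vᴴ * (y x)⁻¹ * f x * z x * W) (by simpa [hm, hl] using hrank x₀ hx₀) hDc (by
      exact ((((continuousOn_const.matrix_mul (hyi.mono hD)).matrix_mul hf).matrix_mul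
        (hzc.mono hD)).matrix_mul continuousOn_const)) (by
      intro x hx
      obtain ⟨h1, h2, L, hL⟩ := hfS x hx
      have hxN := hD hx
      refine ⟨Wᴴ * (z x)⁻¹ * L * y x * V, ?_⟩
      have e1 : y x * V * (Vᴴ * (y x)⁻¹) = P x := by
        calc y x * V * (Vᴴ * (y x)⁻¹) = y x * (V * Vᴴ) * (y x)⁻¹ := by
              simp only [Matrix.mul_assoc]
          _ = P x := by
              rw [hV2, ← hyP x hxN, Matrix.mul_assoc, (hy1 x hxN).1, Matrix.mul_one]
      calc Wᴴ * (z x)⁻¹ * L * y x * V * (Vᴴ * (y x)⁻¹ * f x * z x * W)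
          = Wᴴ * (z x)⁻¹ * L * (y x * V * (Vᴴ * (y x)⁻¹)) * f x * z x * W := by
            simp only [Matrix.mul_assoc]
        _ = Wᴴ * ((z x)⁻¹ * (L * (P x * f x)) * z x) * W := by
            rw [e1]; simp only [Matrix.mul_assoc]
        _ = Wᴴ * (R x₀ * ((z x)⁻¹ * z x)) * W := by
            rw [h1, hL, hzR' x hxN]; simp only [Matrix.mul_assoc]
        _ = 1 := by rw [(hz1 x hxN).2, Matrix.mul_one, hWR, hW1])
  refine ⟨fun x => y x * V * C x * Wᴴ * (z x)⁻¹, ?_, ?_, ?_⟩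
  · exact ((((hyc.matrix_mul continuousOn_const).matrix_mul hC.continuousOn).matrix_mul
      continuousOn_const).matrix_mul hzi)
  · intro x hx
    have hxN := hD hx
    obtain ⟨h1, h2, -⟩ := hfS x hx
    calc y x * V * C x * Wᴴ * (z x)⁻¹
        = y x * (V * Vᴴ) * (y x)⁻¹ * f x * (z x * (W * Wᴴ)) * (z x)⁻¹ := by
          rw [hCe hx]; simp only [Matrix.mul_assoc]
      _ = P x * (y x * (y x)⁻¹) * (f x * R x) * (z x * (z x)⁻¹) := by
          rw [hV2, hW2, ← hyP x hxN, ← hzR x hxN]; simp only [Matrix.mul_assoc]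
      _ = f x := by
          rw [(hy1 x hxN).1, (hz1 x hxN).1, Matrix.mul_one, Matrix.mul_one, h2, h1]
  · intro x hx
    obtain ⟨L, hL⟩ := hCL x
    refine ⟨?_, ?_, z x * W * L * Vᴴ * (y x)⁻¹, ?_⟩
    · calc P x * (y x * V * C x * Wᴴ * (z x)⁻¹)
          = (P x * y x) * V * C x * Wᴴ * (z x)⁻¹ := by simp only [Matrix.mul_assoc]
        _ = y x * (P x₀ * V) * C x * Wᴴ * (z x)⁻¹ := by
            rw [hyP x hx]; simp only [Matrix.mul_assoc]
        _ = _ := by rw [hVP]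
    · rw [Matrix.mul_assoc, hzR' x hx, ← Matrix.mul_assoc, Matrix.mul_assoc _ Wᴴ, hWR]
    · calc z x * W * L * Vᴴ * (y x)⁻¹ * (y x * V * C x * Wᴴ * (z x)⁻¹)
          = z x * W * L * Vᴴ * ((y x)⁻¹ * y x) * V * C x * Wᴴ * (z x)⁻¹ := by
            simp only [Matrix.mul_assoc]
        _ = z x * W * (L * (Vᴴ * V * C x)) * Wᴴ * (z x)⁻¹ := by
            rw [(hy1 x hx).2, Matrix.mul_one]; simp only [Matrix.mul_assoc]
        _ = z x * (W * Wᴴ) * (z x)⁻¹ := by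
            rw [hV1, Matrix.one_mul, hL, Matrix.mul_one]; simp only [Matrix.mul_assoc]
        _ = R x := by
            rw [hW2, ← hzR x hx, Matrix.mul_assoc, (hz1 x hx).1, Matrix.mul_one]

/-- Isometric bundle maps between projection bundles extend from closed sets, if the rank of the
target exceeds that of the source. -/
theorem HasPlaneCover.exists_bundle_isometry_extension {κ : Type*} [Fintype κ] [DecidableEq κ]
    {X : Type*} [TopologicalSpace X] [CompactSpace X] [T2Space X] (hX : HasPlaneCover X)
    {K : Set X} (hK : IsClosed K) {P : X → Matrix ι ι ℂ} {R : X → Matrix κ κ ℂ}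
    (hPc : ContinuousOn P K) (hRc : ContinuousOn R K) (hP : ∀ x ∈ K, IsStarProjection (P x))
    (hR : ∀ x ∈ K, IsStarProjection (R x)) (hrank : ∀ x ∈ K, (R x).rank < (P x).rank)
    {A : Set X} (hA : IsClosed A) (hAK : A ⊆ K) {B : X → Matrix ι κ ℂ} (hB : ContinuousOn B A)
    (hBP : ∀ x ∈ A, P x * B x = B x) (hBR : ∀ x ∈ A, (B x)ᴴ * B x = R x) :
    ∃ B' : X → Matrix ι κ ℂ, ContinuousOn B' K ∧ Set.EqOn B' B A ∧
      ∀ x ∈ K, P x * B' x = B' x ∧ (B' x)ᴴ * B' x = R x := by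
  have hRH : ∀ x ∈ K, (R x)ᴴ = R x := fun x hx => (hR x hx).isSelfAdjoint
  obtain ⟨C, hC, hCe, hCS⟩ := hX.exists_bundle_injection_extension hK hPc hRc hP hR hrank hA hAK hB
    (by
      intro x hx
      exact ⟨hBP x hx, Matrix.mul_eq_self_of_conjTranspose_mul_self (hR x (hAK hx)) (hBR x hx), _,
        hBR x hx⟩)
  -- Polar decomposition inside the bundle: adding `1 - R` makes `Cᴴ C` invertible on all of `ℂ^κ`,
  -- so `G^(-1/2)` exists; it commutes with `R`, and `C G^(-1/2)` is isometric on `R`.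
  let G : X → Matrix κ κ ℂ := fun x => (C x)ᴴ * C x + (1 - R x)
  have hGc : ContinuousOn G K := by
    have h1 : ContinuousOn (fun x => (C x)ᴴ) K := continuous_id.matrix_conjTranspose.comp_continuousOn hC
    exact (h1.matrix_mul hC).add (continuousOn_const.sub hRc)
  have hCR : ∀ x ∈ K, (C x)ᴴ * C x = G x * R x := by
    intro x hx
    have h2 := (hR x hx).isIdempotentElem.eq
    simp only [G, Matrix.add_mul, Matrix.sub_mul, Matrix.one_mul, h2, sub_self, add_zero]
    rw [Matrix.mul_assoc, (hCS x hx).2.1]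
  have hGsa : ∀ x ∈ K, IsSelfAdjoint (G x) := by
    intro x hx
    change (G x)ᴴ = G x
    simp [G, hRH x hx]
  have hGR : ∀ x ∈ K, Commute (G x) (R x) := by
    intro x hx
    change G x * R x = R x * G x
    have h1 : R x * (C x)ᴴ = (C x)ᴴ := by
      rw [← hRH x hx, ← Matrix.conjTranspose_mul, (hCS x hx).2.1]
    rw [← hCR x hx]
    simp only [G, Matrix.mul_add, ← Matrix.mul_assoc, h1, Matrix.mul_sub, Matrix.mul_one,
      (hR x hx).isIdempotentElem.eq, sub_self, add_zero]
  -- If `G v = 0` then `Cᴴ C v = R G v = 0`, so `C v = 0` and `R v = L C v = 0`. But then `G v = v`,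
  -- so `v = 0`.
  have hGpos : ∀ x ∈ K, ∀ t ∈ spectrum ℝ (G x), 0 < t := by
    intro x hx
    have hpsd : (1 - R x).PosSemidef := by
      have h := Matrix.posSemidef_conjTranspose_mul_self (1 - R x)
      have h3 := (hR x hx).one_sub
      rwa [← Matrix.star_eq_conjTranspose, h3.isSelfAdjoint.star_eq, h3.isIdempotentElem.eq] at h
    have hG : (G x).PosSemidef := (Matrix.posSemidef_conjTranspose_mul_self (C x)).add hpsd
    intro t ht
    rw [hG.1.spectrum_real_eq_range_eigenvalues] at ht
    obtain ⟨i, rfl⟩ := ht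
    refine lt_of_le_of_ne (hG.eigenvalues_nonneg i) fun h0 => ?_
    have h1 := hG.1.mulVec_eigenvectorBasis i
    rw [← h0, zero_smul] at h1
    obtain ⟨v, hv⟩ : ∃ v : κ → ℂ, v = hG.1.eigenvectorBasis i := ⟨_, rfl⟩
    have hv0 : v ≠ 0 := by
      intro h2
      apply (hG.1.eigenvectorBasis.orthonormal.ne_zero i)
      ext a
      have h3 := congrFun h2 a
      rw [hv] at h3
      exact h3
    rw [← hv] at h1
    obtain ⟨-, -, L, hL⟩ := hCS x hx
    have h3 : (C x)ᴴ *ᵥ (C x *ᵥ v) = R x *ᵥ (G x *ᵥ v) := by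
      rw [Matrix.mulVec_mulVec, Matrix.mulVec_mulVec, hCR x hx, (hGR x hx).eq]
    rw [h1, Matrix.mulVec_zero, Matrix.mulVec_mulVec,
      Matrix.conjTranspose_mul_self_mulVec_eq_zero] at h3
    have h4 : R x *ᵥ v = 0 := by rw [← hL, ← Matrix.mulVec_mulVec, h3, Matrix.mulVec_zero]
    apply hv0
    have h5 : G x *ᵥ v = (C x)ᴴ *ᵥ (C x *ᵥ v) + (v - R x *ᵥ v) := by
      simp only [G, Matrix.add_mulVec, Matrix.sub_mulVec, Matrix.one_mulVec, Matrix.mulVec_mulVec]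
    rw [h1, h3, h4, Matrix.mulVec_zero, sub_zero, zero_add] at h5
    exact h5.symm
  let g : ℝ → ℝ := fun t => (√t)⁻¹
  have hgc : ContinuousOn g (Set.Ioi 0) :=
    Real.continuous_sqrt.continuousOn.inv₀ fun t ht => (Real.sqrt_pos.2 ht).ne'
  let H : X → Matrix κ κ ℂ := fun x => cfc g (G x)
  have hHc : ContinuousOn H K := by
    refine ContinuousOn.cfc_of_mem_nhdsSet (s := Set.Ioi 0) g ?_ hGc hGsa hgc
    exact isOpen_Ioi.mem_nhdsSet.2 (Set.iUnion₂_subset fun x hx t ht => hGpos x hx t ht)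
  have hHsa : ∀ x, (H x)ᴴ = H x := fun x => cfc_predicate g (G x)
  have hHGH : ∀ x ∈ K, H x * G x * H x = 1 := by
    intro x hx
    have h1 : H x * G x * H x = cfc (fun t => g t * t * g t) (G x) := by
      rw [cfc_mul _ _ (G x) ((G x).continuousOn_spectrum _) ((G x).continuousOn_spectrum _),
        cfc_mul _ _ (G x) ((G x).continuousOn_spectrum _) ((G x).continuousOn_spectrum _),
        cfc_id' ℝ (G x) (hGsa x hx)]
    rw [h1, ← cfc_one ℝ (G x) (hGsa x hx)]
    refine cfc_congr fun t ht => ?_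
    have h0 := hGpos x hx t ht
    have h2 := Real.mul_self_sqrt h0.le
    have h3 := (Real.sqrt_pos.2 h0).ne'
    simp only [g, Pi.one_apply]
    field_simp
    linarith
  have hHR : ∀ x ∈ K, H x * R x = R x * H x := fun x hx => (Commute.cfc_real (hGR x hx) g).eq
  refine ⟨fun x => C x * H x, hC.matrix_mul hHc, ?_, ?_⟩
  · intro x hx
    have h1 : G x = 1 := by simp only [G, hCe hx, hBR x hx]; abel
    have h2 : H x = 1 := by
      simp only [H, h1, cfc_apply_one, g]
      simp
    simp only [h2, Matrix.mul_one, hCe hx]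
  · intro x hx
    refine ⟨by rw [← Matrix.mul_assoc, (hCS x hx).1], ?_⟩
    calc (C x * H x)ᴴ * (C x * H x) = H x * ((C x)ᴴ * C x) * H x := by
          rw [Matrix.conjTranspose_mul, hHsa]; simp only [Matrix.mul_assoc]
      _ = H x * G x * H x * R x := by
          rw [hCR x hx]; simp only [Matrix.mul_assoc, hHR x hx]
      _ = R x := by rw [hHGH x hx, Matrix.one_mul]

end Isometry

/-! ### Matrix units under a projection and their extension. -/

section MatrixUnits
variable {ι α : Type*} [Fintype ι] [DecidableEq α]

/-- A system of matrix units under the projection `p`. -/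
structure IsMatrixUnits (p : Matrix ι ι ℂ) (e : α → α → Matrix ι ι ℂ) : Prop where
  mul : ∀ a b c d, e a b * e c d = if b = c then e a d else 0
  star : ∀ a b, (e a b)ᴴ = e b a
  le : ∀ a b, p * e a b = e a b

namespace IsMatrixUnits
variable {p : Matrix ι ι ℂ} {e : α → α → Matrix ι ι ℂ}

theorem le_right (h : IsMatrixUnits p e) (hp : IsStarProjection p) (a b : α) :
    e a b * p = e a b := by
  have hpH : pᴴ = p := hp.isSelfAdjoint
  rw [← h.star b a, ← hpH, ← Matrix.conjTranspose_mul, h.le]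

theorem isStarProjection_sum [Fintype α] (h : IsMatrixUnits p e) : IsStarProjection (∑ a, e a a) := by
  refine ⟨?_, ?_⟩
  · change _ * _ = _
    simp [Finset.sum_mul_sum, h.mul]
  · change (∑ a, e a a)ᴴ = _
    rw [Matrix.conjTranspose_sum]
    exact Finset.sum_congr rfl fun a _ => h.star a a

theorem isStarProjection_diag (h : IsMatrixUnits p e) (a : α) : IsStarProjection (e a a) :=
  ⟨by change _ * _ = _; simp [h.mul], h.star a a⟩

theorem isStarProjection_compl [Fintype α] (h : IsMatrixUnits p e) (hp : IsStarProjection p) :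
    IsStarProjection (p - ∑ a, e a a) := by
  have h1 : p * ∑ a, e a a = ∑ a, e a a := by
    rw [Finset.mul_sum]; exact Finset.sum_congr rfl fun a _ => h.le a a
  have h2 : (∑ a, e a a) * p = ∑ a, e a a := by
    rw [Finset.sum_mul]; exact Finset.sum_congr rfl fun a _ => h.le_right hp a a
  refine ⟨?_, hp.isSelfAdjoint.sub h.isStarProjection_sum.isSelfAdjoint⟩
  change _ * _ = _
  rw [sub_mul, mul_sub, mul_sub, h1, h2, hp.isIdempotentElem.eq,
    h.isStarProjection_sum.isIdempotentElem.eq]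
  abel

/-- The diagonal units are mutually equivalent, so they share one trace, and for projections trace
is rank. -/
theorem rank_eq [Fintype α] [DecidableEq ι] (h : IsMatrixUnits p e) (hp : IsStarProjection p) (a₀ : α) :
    p.rank = (p - ∑ a, e a a).rank + Fintype.card α * (e a₀ a₀).rank := by
  have h1 : ∀ a, (e a a).trace = (e a₀ a₀).trace := by
    intro a
    have h2 : e a a = e a a₀ * e a₀ a := by simp [h.mul]
    rw [h2, Matrix.trace_mul_comm]
    simp [h.mul]
  have h3 : p.trace = (p - ∑ a, e a a).trace + Fintype.card α * (e a₀ a₀).trace := by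
    rw [Matrix.trace_sub, Matrix.trace_sum, Finset.sum_congr rfl fun a _ => h1 a]
    simp
  rw [Matrix.trace_eq_rank hp.isIdempotentElem,
    Matrix.trace_eq_rank (h.isStarProjection_compl hp).isIdempotentElem,
    Matrix.trace_eq_rank (h.isStarProjection_diag a₀).isIdempotentElem] at h3
  exact_mod_cast h3

end IsMatrixUnits

theorem eventually_rank_eq [DecidableEq ι] {X : Type*} [TopologicalSpace X] {K : Set X}
    {P : X → Matrix ι ι ℂ} (hP : ∀ x ∈ K, IsStarProjection (P x)) (hPc : ContinuousOn P K) {x₀ : X}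
    (hx₀ : x₀ ∈ K) : ∀ᶠ x in nhdsWithin x₀ K, (P x).rank = (P x₀).rank := by
  have h1 : ContinuousWithinAt (fun x => (P x).trace) K x₀ :=
    (Continuous.matrix_trace continuous_id).continuousAt.comp_continuousWithinAt (hPc x₀ hx₀)
  filter_upwards [Metric.continuousWithinAt_iff'.1 h1 1 one_pos, self_mem_nhdsWithin] with x hx hxK
  rw [Matrix.trace_eq_rank (hP x hxK).isIdempotentElem,
    Matrix.trace_eq_rank (hP x₀ hx₀).isIdempotentElem] at hx
  rw [dist_eq_norm, ← Int.cast_natCast, ← Int.cast_natCast (R := ℂ) (P x₀).rank,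
    ← Int.cast_sub, Complex.norm_intCast] at hx
  have h3 : |((P x).rank : ℤ) - (P x₀).rank| < 1 := by exact_mod_cast hx
  rw [Int.abs_lt_one_iff] at h3
  omega

/-- Projections extend from closed sets, with locally constant rank prescribed by a bundle. -/
theorem HasPlaneCover.exists_projection_extension_of_rank [DecidableEq ι] {X : Type*}
    [TopologicalSpace X] [CompactSpace X] [T2Space X] (hX : HasPlaneCover X) {K : Set X}
    (hK : IsClosed K) {P : X → Matrix ι ι ℂ} (hPc : ContinuousOn P K)
    (hP : ∀ x ∈ K, IsStarProjection (P x)) (J : ℕ → ℕ) (hJ : ∀ m, J m ≤ m)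
    {A : Set X} (hA : IsClosed A) (hAK : A ⊆ K) {q : X → Matrix ι ι ℂ} (hq : ContinuousOn q A)
    (hqp : ∀ x ∈ A, IsStarProjection (q x)) (hqJ : ∀ x ∈ A, (q x).rank = J (P x).rank) :
    ∃ q' : X → Matrix ι ι ℂ, ContinuousOn q' K ∧ Set.EqOn q' q A ∧
      ∀ x ∈ K, IsStarProjection (q' x) ∧ (q' x).rank = J (P x).rank := by
  have hrk : ∀ M : Matrix ι ι ℂ, M.rank ≤ Fintype.card ι := fun M => M.rank_le_card_width
  have hKm : ∀ m : ℕ, IsClosed (K ∩ {x | (P x).trace = (m : ℂ)}) := by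
    intro m
    exact ContinuousOn.preimage_isClosed_of_isClosed
      ((Continuous.matrix_trace continuous_id).comp_continuousOn hPc) hK isClosed_singleton
  have hmem : ∀ x ∈ K, ∀ m : ℕ, (P x).trace = (m : ℂ) ↔ (P x).rank = m := by
    intro x hx m
    rw [Matrix.trace_eq_rank (hP x hx).isIdempotentElem, Nat.cast_inj]
  -- For each possible rank `m` of `P`, the part of `q` over that stratum is extended to all of `X`.
  -- Since the rank of `P` is locally constant on `K`, selecting the extension by the rank stays
  -- continuous.
  have hext : ∀ m : ℕ, ∃ q' : X → Matrix ι ι ℂ, m ≤ Fintype.card ι →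
      Continuous q' ∧ Set.EqOn q' q (A ∩ (K ∩ {x | (P x).trace = (m : ℂ)})) ∧
      ∀ x, IsStarProjection (q' x) ∧ (q' x).trace = J m := by
    intro m
    by_cases hm : m ≤ Fintype.card ι
    · obtain ⟨q', h⟩ := hX.exists_projection_extension ((hJ m).trans hm) (hA.inter (hKm m))
        (hq.mono Set.inter_subset_left) (fun x hx => hqp x hx.1) (fun x hx => by
          rw [Matrix.trace_eq_rank (hqp x hx.1).isIdempotentElem, hqJ x hx.1,
            (hmem x hx.2.1 m).1 hx.2.2])
      exact ⟨q', fun _ => h⟩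
    · exact ⟨0, fun h => absurd h hm⟩
  choose q' hq' using hext
  refine ⟨fun x => q' (P x).rank x, ?_, ?_, ?_⟩
  · intro x₀ hx₀
    refine ((hq' _ (hrk (P x₀))).1.continuousWithinAt).congr_of_eventuallyEq ?_ rfl
    filter_upwards [eventually_rank_eq hP hPc hx₀] with x hx
    rw [hx]
  · intro x hx
    exact (hq' _ (hrk (P x))).2.1 ⟨hx, hAK hx, (hmem x (hAK hx) _).2 rfl⟩
  · intro x hx
    obtain ⟨h1, h2⟩ := (hq' _ (hrk (P x))).2.2 x
    refine ⟨h1, ?_⟩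
    rw [Matrix.trace_eq_rank h1.isIdempotentElem] at h2
    exact_mod_cast h2

open scoped Kronecker

theorem IsStarProjection.kronecker_one [Fintype α] {q : Matrix ι ι ℂ} (hq : IsStarProjection q) :
    IsStarProjection (q ⊗ₖ (1 : Matrix α α ℂ)) := by
  refine ⟨?_, ?_⟩
  · change _ * _ = _
    rw [← Matrix.mul_kronecker_mul, hq.isIdempotentElem.eq, mul_one]
  · change _ᴴ = _
    rw [Matrix.conjTranspose_kronecker, Matrix.conjTranspose_one]
    exact congrArg (· ⊗ₖ _) hq.isSelfAdjoint

/-- Matrix units under a bundle of projections extend from closed subsets, if the rank of the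
complement is kept in the range `1, …, card α`. -/
theorem HasPlaneCover.exists_matrixUnits_extension [DecidableEq ι] [Fintype α] [Nonempty α] {X : Type*}
    [TopologicalSpace X] [CompactSpace X] [T2Space X] (hX : HasPlaneCover X) {K : Set X}
    (hK : IsClosed K) {P : X → Matrix ι ι ℂ} (hPc : ContinuousOn P K)
    (hP : ∀ x ∈ K, IsStarProjection (P x)) (hP0 : ∀ x ∈ K, P x ≠ 0)
    {A : Set X} (hA : IsClosed A) (hAK : A ⊆ K) {e : X → α → α → Matrix ι ι ℂ}
    (he : ContinuousOn e A) (heu : ∀ x ∈ A, IsMatrixUnits (P x) (e x))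
    (her : ∀ x ∈ A, 1 ≤ (P x - ∑ a, e x a a).rank ∧ (P x - ∑ a, e x a a).rank ≤ Fintype.card α) :
    ∃ e' : X → α → α → Matrix ι ι ℂ, ContinuousOn e' K ∧ Set.EqOn e' e A ∧
      ∀ x ∈ K, IsMatrixUnits (P x) (e' x) ∧
        1 ≤ (P x - ∑ a, e' x a a).rank ∧ (P x - ∑ a, e' x a a).rank ≤ Fintype.card α := by
  obtain ⟨a₀⟩ := ‹Nonempty α›
  have hk : 0 < Fintype.card α := Fintype.card_pos_iff.2 ⟨a₀⟩
  have hec : ∀ a b, ContinuousOn (fun x => e x a b) A := fun a b =>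
    (continuous_apply_apply a b).comp_continuousOn he
  -- From `rank P = r + |α| · rank q` and `1 ≤ r ≤ |α|` the rank of `q` must be `⌊(rank P - 1) /
  -- |α|⌋`.
  obtain ⟨q, hqc, hqe, hqp⟩ := hX.exists_projection_extension_of_rank hK hPc hP
    (fun m => (m - 1) / Fintype.card α) (fun m => (Nat.div_le_self _ _).trans (Nat.sub_le _ _))
    hA hAK (hec a₀ a₀) (fun x hx => (heu x hx).isStarProjection_diag a₀) (by
      intro x hx
      have h1 := (heu x hx).rank_eq (hP x (hAK hx)) a₀
      obtain ⟨h2, h3⟩ := her x hx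
      symm
      rw [Nat.div_eq_iff hk]
      constructor
      · rw [h1, mul_comm]; omega
      · rw [h1, mul_comm]; omega)
  have hPr : ∀ x ∈ K, 1 ≤ (P x).rank := by
    intro x hx
    by_contra h
    apply hP0 x hx
    refine (hP x hx).eq_zero_of_trace ?_
    rw [Matrix.trace_eq_rank (hP x hx).isIdempotentElem]
    have : (P x).rank = 0 := by omega
    simp [this]
  have hRp : ∀ x ∈ K, IsStarProjection (q x ⊗ₖ (1 : Matrix α α ℂ)) := fun x hx =>
    (hqp x hx).1.kronecker_one
  have hblock : ∀ x ∈ A, ∀ a b, (e x a a₀)ᴴ * e x b a₀ = if a = b then e x a₀ a₀ else 0 := by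
    intro x hx a b
    rw [(heu x hx).star, (heu x hx).mul]
  -- The blocks of `B` are the partial isometries `e a a₀` with initial projection `q`; the units
  -- are recovered as `b a * (b c)ᴴ`. The `- 1` in the rank of `q` makes the source strictly smaller
  -- than the target.
  obtain ⟨B, hBc, hBe, hB⟩ := hX.exists_bundle_isometry_extension hK hPc
    (R := fun x => q x ⊗ₖ (1 : Matrix α α ℂ))
    (continuousOn_pi.2 fun i => continuousOn_pi.2 fun j => by
      simp only [Matrix.kroneckerMap_apply]
      exact ((continuous_apply_apply i.1 j.1).comp_continuousOn hqc).mul continuousOn_const)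
    hP hRp (by
      intro x hx
      have h1 : (q x ⊗ₖ (1 : Matrix α α ℂ)).rank = (q x).rank * Fintype.card α := by
        have h2 := Matrix.trace_kronecker (q x) (1 : Matrix α α ℂ)
        rw [Matrix.trace_eq_rank (hRp x hx).isIdempotentElem,
          Matrix.trace_eq_rank (hqp x hx).1.isIdempotentElem, Matrix.trace_one] at h2
        exact_mod_cast h2
      rw [h1, (hqp x hx).2]
      have := Nat.div_mul_le_self ((P x).rank - 1) (Fintype.card α)
      have := hPr x hx
      omega) hA hAK
    (B := fun x => Matrix.of fun i (ja : ι × α) => e x ja.2 a₀ i ja.1)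
    (continuousOn_pi.2 fun i => continuousOn_pi.2 fun j =>
      (continuous_apply_apply i j.1).comp_continuousOn (hec j.2 a₀))
    (by
      intro x hx
      ext i ⟨j, a⟩
      exact congrFun (congrFun ((heu x hx).le a a₀) i) j)
    (by
      intro x hx
      ext ⟨i, a⟩ ⟨j, b⟩
      refine (congrFun (congrFun (hblock x hx a b) i) j).trans ?_
      rw [Matrix.kroneckerMap_apply, hqe hx, Matrix.one_apply]
      split_ifs <;> simp)
  let b : X → α → Matrix ι ι ℂ := fun x a => Matrix.of fun i j => B x i (j, a)
  have hbc : ∀ a, ContinuousOn (fun x => b x a) K := fun a =>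
    continuousOn_pi.2 fun i => continuousOn_pi.2 fun j =>
      (continuous_apply_apply i (j, a)).comp_continuousOn hBc
  have hbb : ∀ x ∈ K, ∀ a c, (b x a)ᴴ * b x c = if a = c then q x else 0 := by
    intro x hx a c
    ext i j
    refine (congrFun (congrFun (hB x hx).2 (i, a)) (j, c)).trans ?_
    rw [Matrix.kroneckerMap_apply, Matrix.one_apply]
    split_ifs <;> simp
  have hPb : ∀ x ∈ K, ∀ a, P x * b x a = b x a := by
    intro x hx a
    ext i j
    exact congrFun (congrFun (hB x hx).1 i) (j, a)
  have hbq : ∀ x ∈ K, ∀ a, b x a * q x = b x a := fun x hx a =>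
    Matrix.mul_eq_self_of_conjTranspose_mul_self (hqp x hx).1 (by simpa using hbb x hx a a)
  have hu : ∀ x ∈ K, IsMatrixUnits (P x) fun a c => b x a * (b x c)ᴴ := by
    intro x hx
    refine ⟨fun a c a' c' => ?_, fun a c => ?_, fun a c => ?_⟩
    · calc b x a * (b x c)ᴴ * (b x a' * (b x c')ᴴ)
          = b x a * ((b x c)ᴴ * b x a') * (b x c')ᴴ := by simp only [Matrix.mul_assoc]
        _ = _ := by
          rw [hbb x hx]
          split_ifs
          · rw [hbq x hx]
          · simp
    · rw [Matrix.conjTranspose_mul, Matrix.conjTranspose_conjTranspose]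
    · rw [← Matrix.mul_assoc, hPb x hx]
  refine ⟨fun x a c => b x a * (b x c)ᴴ, ?_, ?_, fun x hx => ⟨hu x hx, ?_⟩⟩
  · refine continuousOn_pi.2 fun a => continuousOn_pi.2 fun c => (hbc a).matrix_mul ?_
    exact continuous_id.matrix_conjTranspose.comp_continuousOn (hbc c)
  · intro x hx
    have h1 : ∀ a, b x a = e x a a₀ := by
      intro a; ext i j
      exact congrFun (congrFun (hBe hx) i) (j, a)
    funext a c
    change b x a * (b x c)ᴴ = _
    rw [h1, h1, (heu x hx).star, (heu x hx).mul, if_pos rfl]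
  · have h1 := (hu x hx).rank_eq (hP x hx) a₀
    have h2 : (b x a₀ * (b x a₀)ᴴ).rank = (q x).rank := by
      have h3 := Matrix.trace_mul_comm (b x a₀) (b x a₀)ᴴ
      rw [hbb x hx, if_pos rfl, Matrix.trace_eq_rank (hqp x hx).1.isIdempotentElem,
        Matrix.trace_eq_rank ((hu x hx).isStarProjection_diag a₀).isIdempotentElem] at h3
      exact_mod_cast h3
    rw [h2, (hqp x hx).2] at h1
    have h4 := Nat.div_add_mod ((P x).rank - 1) (Fintype.card α)
    have h5 := Nat.mod_lt ((P x).rank - 1) hk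
    have h6 := hPr x hx
    beta_reduce at h1 ⊢
    generalize Fintype.card α * (((P x).rank - 1) / Fintype.card α) = s at h1 h4
    omega

end MatrixUnits

/-- This enlarges units under an earlier cutoff by the canonical units on the orthogonal difference
of two cutoffs. -/
theorem IsMatrixUnits.add {ι α : Type*} [Fintype ι] [DecidableEq α] {p r : Matrix ι ι ℂ}
    {e w : α → α → Matrix ι ι ℂ}
    (h : IsMatrixUnits p e) (hp : IsStarProjection p) (h' : IsMatrixUnits r w)
    (hr : IsStarProjection r) (hpr : p * r = 0) : IsMatrixUnits (p + r) (e + w) := by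
  have hrp : r * p = 0 := by
    have := congrArg (Star.star : Matrix ι ι ℂ → Matrix ι ι ℂ) hpr
    rwa [star_mul, hp.isSelfAdjoint.star_eq, hr.isSelfAdjoint.star_eq, star_zero] at this
  have h1 : ∀ a b c d, e a b * w c d = 0 := fun a b c d => by
    rw [← h.le_right hp, ← h'.le c d, mul_assoc, ← mul_assoc p, hpr, zero_mul, mul_zero]
  have h2 : ∀ a b c d, w a b * e c d = 0 := fun a b c d => by
    rw [← h'.le_right hr, ← h.le c d, mul_assoc, ← mul_assoc r, hrp, zero_mul, mul_zero]
  refine ⟨fun a b c d => ?_, fun a b => ?_, fun a b => ?_⟩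
  · simp only [Pi.add_apply, add_mul, mul_add, h1, h2, h.mul, h'.mul, add_zero, zero_add]
    split_ifs <;> simp
  · simp only [Pi.add_apply, Matrix.conjTranspose_add, h.star, h'.star]
  · have h3 : p * w a b = 0 := by rw [← h'.le a b, ← mul_assoc, hpr, zero_mul]
    have h4 : r * e a b = 0 := by rw [← h.le a b, ← mul_assoc, hrp, zero_mul]
    simp only [Pi.add_apply, add_mul, mul_add, h.le, h'.le, h3, h4, add_zero, zero_add]

/-! ### The homomorphism defined by matrix units. -/

section MatrixUnitsMap
variable {ι α : Type*} [Fintype α]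

/-- The linear extension of a system of matrix units. -/
def unitsMap (e : α → α → Matrix ι ι ℂ) (m : Matrix α α ℂ) : Matrix ι ι ℂ :=
  ∑ a, ∑ b, m a b • e a b

variable {e : α → α → Matrix ι ι ℂ}

theorem unitsMap_add (m m' : Matrix α α ℂ) :
    unitsMap e (m + m') = unitsMap e m + unitsMap e m' := by
  simp only [unitsMap, Matrix.add_apply, add_smul, Finset.sum_add_distrib]

variable [DecidableEq α]

theorem unitsMap_smul_one (c : ℂ) : unitsMap e (c • 1) = c • ∑ a, e a a := by
  simp only [unitsMap, Matrix.smul_apply, Matrix.one_apply, smul_eq_mul, mul_ite, mul_one, mul_zero,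
    ite_smul, zero_smul, Finset.sum_ite_eq, Finset.mem_univ, if_true, Finset.smul_sum]

theorem unitsMap_one : unitsMap e 1 = ∑ a, e a a := by
  simpa using unitsMap_smul_one (e := e) 1

variable [Fintype ι] {p : Matrix ι ι ℂ}

theorem IsMatrixUnits.map_mul (h : IsMatrixUnits p e) (m m' : Matrix α α ℂ) :
    unitsMap e m * unitsMap e m' = unitsMap e (m * m') := by
  calc unitsMap e m * unitsMap e m'
      = ∑ a, ∑ b, ∑ c, ∑ d, (m a b * m' c d) • (e a b * e c d) := by
        simp only [unitsMap]
        rw [Finset.sum_mul]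
        refine Finset.sum_congr rfl fun a _ => ?_
        rw [Finset.sum_mul]
        refine Finset.sum_congr rfl fun b _ => ?_
        simp only [Finset.mul_sum, smul_mul_smul_comm]
    _ = ∑ a, ∑ b, ∑ d, (m a b * m' b d) • e a d := by
        refine Finset.sum_congr rfl fun a _ => Finset.sum_congr rfl fun b _ => ?_
        rw [Finset.sum_eq_single b]
        · simp only [h.mul, if_true]
        · intro c _ hc
          simp [h.mul, Ne.symm hc]
        · simp
    _ = unitsMap e (m * m') := by
        simp only [unitsMap, Matrix.mul_apply, Finset.sum_smul]
        exact Finset.sum_congr rfl fun a _ => Finset.sum_comm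

theorem IsMatrixUnits.map_star (h : IsMatrixUnits p e) (m : Matrix α α ℂ) :
    (unitsMap e m)ᴴ = unitsMap e mᴴ := by
  simp only [unitsMap, Matrix.conjTranspose_sum, Matrix.conjTranspose_smul, h.star,
    Matrix.conjTranspose_apply]
  exact Finset.sum_comm

theorem IsMatrixUnits.le_map (h : IsMatrixUnits p e) (m : Matrix α α ℂ) :
    p * unitsMap e m = unitsMap e m := by
  simp only [unitsMap, Finset.mul_sum, mul_smul_comm, h.le]

theorem IsMatrixUnits.map_le (h : IsMatrixUnits p e) (hp : IsStarProjection p)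
    (m : Matrix α α ℂ) : unitsMap e m * p = unitsMap e m := by
  simp only [unitsMap, Finset.sum_mul, smul_mul_assoc, h.le_right hp]

end MatrixUnitsMap

/-! ### Functional calculus in the dimension drop algebra. -/

section DimDrop
variable {k : ℕ}

/-- The element `t ↦ g(t) F(t)` of the dimension drop algebra, for `g` vanishing at `0` and `1`. -/
noncomputable def dimDrop.smulFun (g : C(unitInterval, ℂ)) (hg : g 0 = 0 ∧ g 1 = 0)
    (F : C(unitInterval, Matrix (Fin k) (Fin k) ℂ)) : dimDrop k :=
  ⟨⟨fun t => g t • F t, by fun_prop⟩, ⟨0, by simp [hg.1]⟩, ⟨0, by simp [hg.2]⟩⟩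

@[simp]
theorem dimDrop.smulFun_apply (g : C(unitInterval, ℂ)) (hg : g 0 = 0 ∧ g 1 = 0)
    (F : C(unitInterval, Matrix (Fin k) (Fin k) ℂ)) (t : unitInterval) :
    (dimDrop.smulFun g hg F : C(unitInterval, Matrix (Fin k) (Fin k) ℂ)) t = g t • F t := rfl

@[simp]
theorem dimDrop.incl_apply (g : C(unitInterval, ℂ)) (t : unitInterval) :
    (dimDrop.incl k g : C(unitInterval, Matrix (Fin k) (Fin k) ℂ)) t = g t • 1 := rfl

theorem dimDrop.ext {f g : dimDrop k}
    (h : ∀ t, (f : C(unitInterval, Matrix (Fin k) (Fin k) ℂ)) t =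
      (g : C(unitInterval, Matrix (Fin k) (Fin k) ℂ)) t) : f = g :=
  Subtype.ext (ContinuousMap.ext h)

@[simp]
theorem dimDrop.coe_mul_apply (f g : dimDrop k) (t : unitInterval) :
    ((f * g : dimDrop k) : C(unitInterval, Matrix (Fin k) (Fin k) ℂ)) t =
      (f : C(unitInterval, Matrix (Fin k) (Fin k) ℂ)) t *
      (g : C(unitInterval, Matrix (Fin k) (Fin k) ℂ)) t := rfl

@[simp]
theorem dimDrop.coe_add_apply (f g : dimDrop k) (t : unitInterval) :
    ((f + g : dimDrop k) : C(unitInterval, Matrix (Fin k) (Fin k) ℂ)) t =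
      (f : C(unitInterval, Matrix (Fin k) (Fin k) ℂ)) t +
      (g : C(unitInterval, Matrix (Fin k) (Fin k) ℂ)) t := rfl

@[simp]
theorem dimDrop.coe_sub_apply (f g : dimDrop k) (t : unitInterval) :
    ((f - g : dimDrop k) : C(unitInterval, Matrix (Fin k) (Fin k) ℂ)) t =
      (f : C(unitInterval, Matrix (Fin k) (Fin k) ℂ)) t -
      (g : C(unitInterval, Matrix (Fin k) (Fin k) ℂ)) t := rfl

@[simp]
theorem dimDrop.coe_star_apply (f : dimDrop k) (t : unitInterval) :
    ((star f : dimDrop k) : C(unitInterval, Matrix (Fin k) (Fin k) ℂ)) t =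
      star ((f : C(unitInterval, Matrix (Fin k) (Fin k) ℂ)) t) := rfl

@[simp]
theorem dimDrop.coe_smul_apply (c : ℂ) (f : dimDrop k) (t : unitInterval) :
    ((c • f : dimDrop k) : C(unitInterval, Matrix (Fin k) (Fin k) ℂ)) t =
      c • (f : C(unitInterval, Matrix (Fin k) (Fin k) ℂ)) t := rfl

theorem ContinuousMap.apply_eq_of_star {g : C(unitInterval, ℂ)} (h : star g = g)
    (t : unitInterval) : starRingEnd ℂ (g t) = g t := DFunLike.congr_fun h t

variable {n : ℕ} (π : dimDrop k →⋆ₙₐ[ℂ] Matrix (Fin n) (Fin n) ℂ)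

/-- The function `F` itself need not lie in `I_k`, so `g F` cannot be factored there. Its square `(g
F)* (g F) = g · (g F* F)` can, and the C*-identity finishes. -/
theorem dimDrop.map_smulFun_eq_zero {g : C(unitInterval, ℂ)} (hg : g 0 = 0 ∧ g 1 = 0)
    (hs : star g = g) (h0 : π (dimDrop.incl k g) = 0)
    (F : C(unitInterval, Matrix (Fin k) (Fin k) ℂ)) : π (dimDrop.smulFun g hg F) = 0 := by
  rw [← Matrix.conjTranspose_mul_self_eq_zero, ← Matrix.star_eq_conjTranspose, ← map_star, ← map_mul]
  have : star (dimDrop.smulFun g hg F) * dimDrop.smulFun g hg F =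
      dimDrop.incl k g * dimDrop.smulFun g hg (star F * F) := by
    refine dimDrop.ext fun t => ?_
    simp [ContinuousMap.apply_eq_of_star hs]
  rw [this, map_mul, h0, zero_mul]

theorem dimDrop.isStarProjection_map_incl {g : C(unitInterval, ℂ)} (hs : star g = g)
    (h : IsIdempotentElem (π (dimDrop.incl k g))) : IsStarProjection (π (dimDrop.incl k g)) :=
  ⟨h, by change star _ = _; rw [← map_star, ← map_star, hs]⟩

/-- On an element `g` which becomes idempotent, `F ↦ π (g F)` is multiplicative. -/
theorem dimDrop.map_smulFun_mul {g : C(unitInterval, ℂ)} (hg : g 0 = 0 ∧ g 1 = 0)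
    (hs : star g = g) (h : IsIdempotentElem (π (dimDrop.incl k g)))
    (F G : C(unitInterval, Matrix (Fin k) (Fin k) ℂ)) :
    π (dimDrop.smulFun g hg F) * π (dimDrop.smulFun g hg G) = π (dimDrop.smulFun g hg (F * G)) := by
  have hg' : (g * g - g) 0 = 0 ∧ (g * g - g) 1 = 0 := by simp [hg.1, hg.2]
  have h0 : π (dimDrop.incl k (g * g - g)) = 0 := by
    rw [map_sub, map_sub, map_mul, map_mul, h.eq, sub_self]
  rw [← sub_eq_zero, ← map_mul, ← map_sub]
  rw [← dimDrop.map_smulFun_eq_zero π hg' (by simp [hs]) h0 (F * G)]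
  congr 1
  refine dimDrop.ext fun t => ?_
  simp [smul_smul, sub_smul]

theorem dimDrop.map_smulFun_star {g : C(unitInterval, ℂ)} (hg : g 0 = 0 ∧ g 1 = 0)
    (hs : star g = g) (F : C(unitInterval, Matrix (Fin k) (Fin k) ℂ)) :
    star (π (dimDrop.smulFun g hg F)) = π (dimDrop.smulFun g hg (star F)) := by
  rw [← map_star]
  congr 1
  refine dimDrop.ext fun t => ?_
  simp [ContinuousMap.apply_eq_of_star hs]

theorem dimDrop.smulFun_one {g : C(unitInterval, ℂ)} (hg : g 0 = 0 ∧ g 1 = 0) :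
    dimDrop.smulFun g hg 1 = dimDrop.incl k g := rfl

theorem dimDrop.sum_smulFun_single {g : C(unitInterval, ℂ)} (hg : g 0 = 0 ∧ g 1 = 0)
    (m : Matrix (Fin k) (Fin k) ℂ) :
    ∑ a, ∑ b, m a b • dimDrop.smulFun g hg (.const _ (Matrix.single a b 1)) =
      dimDrop.smulFun g hg (.const _ m) := by
  refine dimDrop.ext fun t => ?_
  have h1 : ((∑ a, ∑ b, m a b • dimDrop.smulFun g hg (.const _ (Matrix.single a b 1)) : dimDrop k) :
      C(unitInterval, Matrix (Fin k) (Fin k) ℂ)) t =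
      ∑ a, ∑ b, m a b • (g t • Matrix.single a b (1 : ℂ)) := by
    simp [ContinuousMap.sum_apply]
  rw [h1]
  conv_rhs => rw [dimDrop.smulFun_apply, ContinuousMap.const_apply, Matrix.matrix_eq_sum_single m]
  simp only [Finset.smul_sum, Matrix.smul_single, smul_eq_mul, one_mul, mul_comm (g t)]

/-- Although constant matrix units are in general not in `I_k`, multiplying them by a function
vanishing at both ends puts them there. These are the canonical units between two cutoffs. -/
theorem dimDrop.isMatrixUnits_map {g : C(unitInterval, ℂ)} (hg : g 0 = 0 ∧ g 1 = 0)
    (hs : star g = g) (h : IsIdempotentElem (π (dimDrop.incl k g))) :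
    IsMatrixUnits (π (dimDrop.incl k g))
      fun a b => π (dimDrop.smulFun g hg (.const _ (Matrix.single a b 1))) := by
  refine ⟨fun a b c d => ?_, fun a b => ?_, fun a b => ?_⟩
  · rw [dimDrop.map_smulFun_mul π hg hs h]
    split_ifs with hbc
    · subst hbc
      congr 2
      ext1 t
      simp
    · rw [← map_zero π]
      congr 1
      refine dimDrop.ext fun t => ?_
      simp [Matrix.single_mul_single_of_ne _ _ _ _ hbc]
  · rw [← Matrix.star_eq_conjTranspose, dimDrop.map_smulFun_star π hg hs]
    congr 2
    ext1 t
    simp [Matrix.star_eq_conjTranspose]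
  · rw [← dimDrop.smulFun_one hg, dimDrop.map_smulFun_mul π hg hs h, one_mul]

theorem dimDrop.sum_map_smulFun_single {g : C(unitInterval, ℂ)} (hg : g 0 = 0 ∧ g 1 = 0) :
    ∑ a, π (dimDrop.smulFun g hg (.const _ (Matrix.single a a 1))) = π (dimDrop.incl k g) := by
  rw [← dimDrop.smulFun_one hg, ← map_sum]
  congr 1
  have h1 := dimDrop.sum_smulFun_single (k := k) hg 1
  simp only [Matrix.one_apply, ite_smul, one_smul, zero_smul, Finset.sum_ite_eq, Finset.mem_univ,
    if_true] at h1
  rw [h1]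
  rfl

end DimDrop

/-! ### Matrix units near one end of the interval. -/

section EndUnits
variable {X : Type*} [TopologicalSpace X] {k n : ℕ}

/-- Evaluation at `x` of a homomorphism of the dimension drop algebra into `M_n(C(X))`. -/
noncomputable def dimDrop.evalHom (Φ : dimDrop k →⋆ₙₐ[ℂ] C(X, Matrix (Fin n) (Fin n) ℂ)) (x : X) :
    dimDrop k →⋆ₙₐ[ℂ] Matrix (Fin n) (Fin n) ℂ := (evalAt n x).comp Φ

theorem dimDrop.continuous_evalHom (Φ : dimDrop k →⋆ₙₐ[ℂ] C(X, Matrix (Fin n) (Fin n) ℂ))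
    (f : dimDrop k) : Continuous fun x => dimDrop.evalHom Φ x f := (Φ f).continuous

/-- Let `l 0, l 1, …` be an increasing sequence of cutoff functions, near one end of the interval,
such that at each point of `X` some `l j` becomes a projection under `Φ`. Then there are continuous
families `d a b` of matrices which are given, at each point, by matrix units under `Φ (l j)` with
complement of rank between `1` and `k`, and by `Φ` off `l j`. -/
theorem HasPlaneCover.exists_end_units [CompactSpace X] [T2Space X] (hX : HasPlaneCover X)
    (hk : 1 ≤ k) (Φ : dimDrop k →⋆ₙₐ[ℂ] C(X, Matrix (Fin n) (Fin n) ℂ)) (N : ℕ)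
    (u : C(unitInterval, ℂ)) (l : ℕ → C(unitInterval, ℂ)) (hl : ∀ j, star (l j) = l j)
    (hu : ∀ j, (u - l j) 0 = 0 ∧ (u - l j) 1 = 0)
    (hll : ∀ i j, i < j → l i * l j = l i)
    (hcover : ∀ x, ∃ j < N, IsIdempotentElem (dimDrop.evalHom Φ x (dimDrop.incl k (l j))))
    (hne : ∀ x j, dimDrop.evalHom Φ x (dimDrop.incl k (l j)) ≠ 0) :
    ∃ d : Fin k → Fin k → C(X, Matrix (Fin n) (Fin n) ℂ), ∀ x, ∃ j < N,
      IsIdempotentElem (dimDrop.evalHom Φ x (dimDrop.incl k (l j))) ∧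
      ∃ e : Fin k → Fin k → Matrix (Fin n) (Fin n) ℂ,
        IsMatrixUnits (dimDrop.evalHom Φ x (dimDrop.incl k (l j))) e ∧
        (dimDrop.evalHom Φ x (dimDrop.incl k (l j)) - ∑ a, e a a).rank ≤ k ∧
        ∀ a b, d a b x = e a b + dimDrop.evalHom Φ x
          (dimDrop.smulFun (u - l j) (hu j) (.const _ (Matrix.single a b 1))) := by
  have : Nonempty (Fin k) := ⟨⟨0, hk⟩⟩
  let p : ℕ → X → Matrix (Fin n) (Fin n) ℂ := fun j x =>
    dimDrop.evalHom Φ x (dimDrop.incl k (l j))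
  let v : ℕ → X → Fin k → Fin k → Matrix (Fin n) (Fin n) ℂ := fun j x a b =>
    dimDrop.evalHom Φ x (dimDrop.smulFun (u - l j) (hu j) (.const _ (Matrix.single a b 1)))
  have hpc : ∀ j, Continuous (p j) := fun j => dimDrop.continuous_evalHom Φ _
  have hvc : ∀ j, Continuous (v j) := fun j => continuous_pi fun a => continuous_pi fun b =>
    dimDrop.continuous_evalHom Φ _
  let K : ℕ → Set X := fun j => {x | IsIdempotentElem (p j x)}
  have hK : ∀ j, IsClosed (K j) := fun j => isClosed_eq ((hpc j).mul (hpc j)) (hpc j)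
  have hp : ∀ j, ∀ x ∈ K j, IsStarProjection (p j x) := fun j x hx =>
    dimDrop.isStarProjection_map_incl _ (hl j) hx
  -- The glued quantity is `d = e + v j` rather than the units `e`: enlarging the units from one
  -- cutoff to the next leaves `d` unchanged.
  let S : ℕ → X → Set (Fin k → Fin k → Matrix (Fin n) (Fin n) ℂ) := fun j x =>
    {d | IsMatrixUnits (p j x) (d - v j x) ∧ 1 ≤ (p j x - ∑ a, (d - v j x) a a).rank ∧
      (p j x - ∑ a, (d - v j x) a a).rank ≤ Fintype.card (Fin k)}
  obtain ⟨f, hf, hfS⟩ := exists_selection (K := K) (S := S) N hK (by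
      -- Here `d - v j` is `d - v i` together with the canonical units under `p j - p i`. Those sum
      -- to `p j - p i`, so the complement is the same projection.
      rintro i j hij - x ⟨hxi, hxj⟩ d ⟨hd, hd1, hd2⟩
      have hij0 : (l j - l i) 0 = 0 ∧ (l j - l i) 1 = 0 := by
        have h1 := hu i
        have h2 := hu j
        simp only [ContinuousMap.sub_apply, sub_eq_zero] at h1 h2 ⊢
        exact ⟨h2.1.symm.trans h1.1, h2.2.symm.trans h1.2⟩
      have hijs : star (l j - l i) = l j - l i := by rw [star_sub, hl, hl]
      have hpij : p i x * p j x = p i x := by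
        simp only [p]; rw [← map_mul, ← map_mul, hll i j hij]
      have hpji : p j x * p i x = p i x := by
        simp only [p]; rw [← map_mul, ← map_mul, mul_comm, hll i j hij]
      have hr : dimDrop.evalHom Φ x (dimDrop.incl k (l j - l i)) = p j x - p i x := by
        rw [map_sub, map_sub]
      have hrid : IsIdempotentElem (dimDrop.evalHom Φ x (dimDrop.incl k (l j - l i))) := by
        rw [hr]
        change _ * _ = _
        rw [sub_mul, mul_sub, mul_sub, hpij, hpji, (hp j x hxj).isIdempotentElem.eq,
          (hp i x hxi).isIdempotentElem.eq]
        abel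
      have hadd := hd.add (hp i x hxi) (dimDrop.isMatrixUnits_map _ hij0 hijs hrid)
        (dimDrop.isStarProjection_map_incl _ hijs hrid)
        (by rw [hr, mul_sub, hpij, (hp i x hxi).isIdempotentElem.eq, sub_self])
      have hw : (d - v i x + fun a b => dimDrop.evalHom Φ x (dimDrop.smulFun (l j - l i) hij0
          (.const _ (Matrix.single a b 1)))) = d - v j x := by
        funext a b
        simp only [Pi.add_apply, Pi.sub_apply, v]
        rw [sub_add_eq_add_sub, sub_eq_sub_iff_add_eq_add, add_assoc, add_right_inj, ← map_add]
        congr 1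
        refine dimDrop.ext fun t => ?_
        simp only [dimDrop.coe_add_apply, dimDrop.smulFun_apply, ContinuousMap.sub_apply, ← add_smul]
        congr 1
        ring
      have hsum : p j x - ∑ a, (d - v j x) a a = p i x - ∑ a, (d - v i x) a a := by
        rw [← hw]
        simp only [Pi.add_apply, Finset.sum_add_distrib]
        rw [dimDrop.sum_map_smulFun_single, hr]
        abel
      refine ⟨?_, ?_⟩
      · rw [hw, hr, add_sub_cancel] at hadd
        exact hadd
      · rw [hsum]
        exact ⟨hd1, hd2⟩) (by
      intro j hj A hA hAc g hg hgS
      obtain ⟨e, he, hee, heS⟩ := hX.exists_matrixUnits_extension (hK j) (hpc j).continuousOn (hp j)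
        (fun x _ => hne x j) hAc hA (e := fun x => g x - v j x) (hg.sub (hvc j).continuousOn)
        (fun x hx => (hgS x hx).1) (fun x hx => (hgS x hx).2)
      refine ⟨fun x => e x + v j x, he.add (hvc j).continuousOn, fun x hx => ?_, fun x hx => ?_⟩
      · simp only [hee hx, sub_add_cancel]
      · have h1 : e x + v j x - v j x = e x := add_sub_cancel_right _ _
        simp only [S, Set.mem_ofPred_eq, h1]
        exact heS x hx)
  have hU : (⋃ i < N, K i) = Set.univ := by
    refine Set.eq_univ_of_forall fun x => ?_
    obtain ⟨j, hj, h⟩ := hcover x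
    exact Set.mem_biUnion hj h
  rw [hU] at hf hfS
  have hfc := continuousOn_univ.1 hf
  refine ⟨fun a b => ⟨fun x => f x a b, (continuous_apply_apply a b).comp hfc⟩, fun x => ?_⟩
  obtain ⟨j, hj, hxj, -, h1, h2, h3⟩ := hfS x (Set.mem_univ x)
  refine ⟨j, hj, hxj, f x - v j x, h1, by simpa using h3, fun a b => ?_⟩
  simp [v]

end EndUnits

/-! ### Finite spectra and cutoffs. -/

section Spectrum
variable {n : ℕ}

theorem IsSpectrumOf.map_ne_zero {π : C(unitInterval, ℂ) →⋆ₙₐ[ℂ] Matrix (Fin n) (Fin n) ℂ}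
    {S : Multiset unitInterval} (h : IsSpectrumOf π S) {t : unitInterval} (ht : t ∈ S)
    {g : C(unitInterval, ℂ)} (hg : g t ≠ 0) : π g ≠ 0 := by
  obtain ⟨m, s, p, hp, hpp, -, hπ, rfl⟩ := h
  obtain ⟨i, -, rfl⟩ := Multiset.mem_map.1 ht
  intro h0
  have h1 : p i * π g = g (s i) • p i := by
    rw [hπ, Finset.mul_sum, Finset.sum_eq_single i]
    · rw [mul_smul_comm, (hp i).1.isIdempotentElem.eq]
    · intro j _ hj
      rw [mul_smul_comm, hpp i j hj.symm, smul_zero]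
    · simp
  rw [h0, mul_zero] at h1
  have h2 : p i = 0 := (smul_eq_zero.1 h1.symm).resolve_left hg
  have h3 := (hp i).2
  rw [h2, Matrix.rank_zero] at h3
  exact zero_ne_one h3

/-- Each spectral point spoils at most one of the functions, and at most `n` points face `n + 1`
functions. -/
theorem IsSpectrumOf.exists_isIdempotentElem
    {π : C(unitInterval, ℂ) →⋆ₙₐ[ℂ] Matrix (Fin n) (Fin n) ℂ} {S : Multiset unitInterval}
    (h : IsSpectrumOf π S) (g : ℕ → C(unitInterval, ℂ))
    (hg : ∀ i j t, i ≠ j → g i t * g i t = g i t ∨ g j t * g j t = g j t) :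
    ∃ j < n + 1, IsIdempotentElem (π (g j)) := by
  obtain ⟨m, s, p, hp, hpp, h1, hπ, -⟩ := h
  have hmn : m ≤ n := by
    have h2 : IsIdempotentElem (π 1) := by change _ * _ = _; rw [← map_mul, one_mul]
    have h3 := Matrix.trace_eq_rank h2
    have h4 : (π 1).trace = m := by
      rw [← h1, Matrix.trace_sum, Finset.sum_congr rfl fun i _ =>
        Matrix.trace_eq_rank (hp i).1.isIdempotentElem]
      simp [(hp _).2]
    rw [h4] at h3
    have h5 : m = (π 1).rank := by exact_mod_cast h3
    rw [h5]
    simpa using (π 1).rank_le_card_width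
  by_contra! hcon
  have hbad : ∀ j : Fin (n + 1), ∃ i, g j (s i) * g j (s i) ≠ g j (s i) := by
    intro j
    by_contra! hall
    refine hcon j j.2 ?_
    change _ * _ = _
    rw [← map_mul, hπ, hπ]
    exact Finset.sum_congr rfl fun i _ => by rw [ContinuousMap.mul_apply, hall]
  choose i hi using hbad
  have hinj : Function.Injective i := by
    intro a b hab
    by_contra hne
    rcases hg a b (s (i a)) (fun h => hne (Fin.ext h)) with h | h
    · exact hi a h
    · rw [hab] at h; exact hi b h
  have := Fintype.card_le_of_injective i hinj
  simp only [Fintype.card_fin] at this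
  omega

end Spectrum

/-! ### Representations of `C([0,1], M_k)` built from end units. -/

section EndsHom
variable {k n : ℕ} {π : dimDrop k →⋆ₙₐ[ℂ] Matrix (Fin n) (Fin n) ℂ} {l₀ l₁ : C(unitInterval, ℂ)}
  {e₀ e₁ : Fin k → Fin k → Matrix (Fin n) (Fin n) ℂ}

/-- The product involves `l c = l - l²`, which `π` kills because `π(l)` is idempotent. -/
theorem dimDrop.map_incl_mul_map_smulFun_eq_zero {l c : C(unitInterval, ℂ)} (hl : star l = l)
    (hid : IsIdempotentElem (π (dimDrop.incl k l))) (hc : c 0 = 0 ∧ c 1 = 0)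
    (hlc : l * c = l - l * l) (F : C(unitInterval, Matrix (Fin k) (Fin k) ℂ)) :
    π (dimDrop.incl k l) * π (dimDrop.smulFun c hc F) = 0 := by
  have h0 : (l * c) 0 = 0 ∧ (l * c) 1 = 0 := by simp [hc.1, hc.2]
  have h1 : dimDrop.incl k l * dimDrop.smulFun c hc F = dimDrop.smulFun (l * c) h0 F := by
    refine dimDrop.ext fun t => ?_
    simp [smul_smul, mul_comm]
  rw [← map_mul, h1]
  refine dimDrop.map_smulFun_eq_zero π h0 ?_ ?_ F
  · rw [hlc, star_sub, star_mul, hl]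
  · rw [hlc, map_sub, map_sub, map_mul, map_mul, hid.eq, sub_self]

/-- Matrix units under two orthogonal projections `π (l₀)` and `π (l₁)`, together with `π` off
these, define a representation of `C([0,1], M_k)`. -/
theorem dimDrop.exists_starAlgHom_of_units (hl₀ : star l₀ = l₀) (hl₁ : star l₁ = l₁)
    (hl : l₀ * l₁ = 0) (hc : (1 - l₀ - l₁) 0 = 0 ∧ (1 - l₀ - l₁) 1 = 0)
    (h₀ : IsIdempotentElem (π (dimDrop.incl k l₀))) (h₁ : IsIdempotentElem (π (dimDrop.incl k l₁)))
    (he₀ : IsMatrixUnits (π (dimDrop.incl k l₀)) e₀)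
    (he₁ : IsMatrixUnits (π (dimDrop.incl k l₁)) e₁) :
    ∃ ρ : C(unitInterval, Matrix (Fin k) (Fin k) ℂ) →⋆ₙₐ[ℂ] Matrix (Fin n) (Fin n) ℂ,
      (∀ F, ρ F = unitsMap e₀ (F 0) + unitsMap e₁ (F 1) +
        π (dimDrop.smulFun (1 - l₀ - l₁) hc F)) ∧
      (π (dimDrop.incl k l₀) - ∑ a, e₀ a a) * (π (dimDrop.incl k l₁) - ∑ a, e₁ a a) = 0 ∧
      (∀ F, (π (dimDrop.incl k l₀) - ∑ a, e₀ a a) * ρ F = 0) ∧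
      ∀ F, (π (dimDrop.incl k l₁) - ∑ a, e₁ a a) * ρ F = 0 := by
  set c := 1 - l₀ - l₁ with hcdef
  have hcs : star c = c := by rw [hcdef, star_sub, star_sub, star_one, hl₀, hl₁]
  have hp₀ := dimDrop.isStarProjection_map_incl π hl₀ h₀
  have hp₁ := dimDrop.isStarProjection_map_incl π hl₁ h₁
  have hp : π (dimDrop.incl k l₀) * π (dimDrop.incl k l₁) = 0 := by
    rw [← map_mul, ← map_mul, hl, map_zero, map_zero]
  have hp' : π (dimDrop.incl k l₁) * π (dimDrop.incl k l₀) = 0 := by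
    rw [← map_mul, ← map_mul, mul_comm, hl, map_zero, map_zero]
  have hcid : IsIdempotentElem (π (dimDrop.incl k c)) := by
    have h2 : c * c = c - (l₀ - l₀ * l₀) - (l₁ - l₁ * l₁) := by
      rw [hcdef]; linear_combination 2 * hl
    change _ * _ = _
    rw [← map_mul, ← map_mul, h2]
    simp only [map_sub, map_mul, h₀.eq, h₁.eq, sub_self, sub_zero]
  have h0c : ∀ F, π (dimDrop.incl k l₀) * π (dimDrop.smulFun c hc F) = 0 :=
    dimDrop.map_incl_mul_map_smulFun_eq_zero hl₀ h₀ hc (by rw [hcdef]; linear_combination -hl)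
  have h1c : ∀ F, π (dimDrop.incl k l₁) * π (dimDrop.smulFun c hc F) = 0 :=
    dimDrop.map_incl_mul_map_smulFun_eq_zero hl₁ h₁ hc (by rw [hcdef]; linear_combination -hl)
  generalize π (dimDrop.incl k l₀) = p₀ at *
  generalize π (dimDrop.incl k l₁) = p₁ at *
  have hc0 : ∀ F, π (dimDrop.smulFun c hc F) * p₀ = 0 := fun F => by
    have := congrArg (Star.star : Matrix (Fin n) (Fin n) ℂ → _) (h0c (star F))
    rwa [star_mul, hp₀.isSelfAdjoint.star_eq, dimDrop.map_smulFun_star π hc hcs, star_star,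
      star_zero] at this
  have hc1 : ∀ F, π (dimDrop.smulFun c hc F) * p₁ = 0 := fun F => by
    have := congrArg (Star.star : Matrix (Fin n) (Fin n) ℂ → _) (h1c (star F))
    rwa [star_mul, hp₁.isSelfAdjoint.star_eq, dimDrop.map_smulFun_star π hc hcs, star_star,
      star_zero] at this
  have a01 : ∀ m m', unitsMap e₀ m * unitsMap e₁ m' = 0 := fun m m' => by
    rw [← he₀.map_le hp₀, ← he₁.le_map m', mul_assoc, ← mul_assoc p₀, hp, zero_mul, mul_zero]
  have a10 : ∀ m m', unitsMap e₁ m * unitsMap e₀ m' = 0 := fun m m' => by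
    rw [← he₁.map_le hp₁, ← he₀.le_map m', mul_assoc, ← mul_assoc p₁, hp', zero_mul, mul_zero]
  have a0c : ∀ m F, unitsMap e₀ m * π (dimDrop.smulFun c hc F) = 0 := fun m F => by
    rw [← he₀.map_le hp₀, mul_assoc, h0c, mul_zero]
  have a1c : ∀ m F, unitsMap e₁ m * π (dimDrop.smulFun c hc F) = 0 := fun m F => by
    rw [← he₁.map_le hp₁, mul_assoc, h1c, mul_zero]
  have ac0 : ∀ m F, π (dimDrop.smulFun c hc F) * unitsMap e₀ m = 0 := fun m F => by
    rw [← he₀.le_map, ← mul_assoc, hc0, zero_mul]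
  have ac1 : ∀ m F, π (dimDrop.smulFun c hc F) * unitsMap e₁ m = 0 := fun m F => by
    rw [← he₁.le_map, ← mul_assoc, hc1, zero_mul]
  have b0 : ∀ m, p₀ * unitsMap e₁ m = 0 := fun m => by
    rw [← he₁.le_map, ← mul_assoc, hp, zero_mul]
  have b1 : ∀ m, p₁ * unitsMap e₀ m = 0 := fun m => by
    rw [← he₀.le_map, ← mul_assoc, hp', zero_mul]
  refine ⟨{
    toFun F := unitsMap e₀ (F 0) + unitsMap e₁ (F 1) + π (dimDrop.smulFun c hc F)
    map_smul' := fun z F => ?_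
    map_zero' := ?_
    map_add' := fun F G => ?_
    map_mul' := fun F G => ?_
    map_star' := fun F => ?_ }, fun F => rfl, ?_, fun F => ?_, fun F => ?_⟩
  · have h2 : dimDrop.smulFun c hc (z • F) = z • dimDrop.smulFun c hc F :=
      dimDrop.ext fun t => smul_comm (c t) z (F t)
    have h3 : ∀ (e : Fin k → Fin k → Matrix (Fin n) (Fin n) ℂ) m,
        unitsMap e (z • m) = z • unitsMap e m := fun e m => by
      simp only [unitsMap, Matrix.smul_apply, Finset.smul_sum, smul_smul, smul_eq_mul]
    rw [h2, map_smul, ContinuousMap.smul_apply, ContinuousMap.smul_apply, h3, h3, smul_add, smul_add]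
    rfl
  · have h2 : dimDrop.smulFun c hc (0 : C(unitInterval, Matrix (Fin k) (Fin k) ℂ)) = 0 :=
      dimDrop.ext fun t => by simp
    rw [h2, map_zero π]
    simp [unitsMap]
  · have h2 : dimDrop.smulFun c hc (F + G) = dimDrop.smulFun c hc F + dimDrop.smulFun c hc G :=
      dimDrop.ext fun t => by simp
    rw [h2, map_add, ContinuousMap.add_apply, ContinuousMap.add_apply, unitsMap_add, unitsMap_add]
    abel
  · simp only [mul_add, add_mul, a01, a10, a0c, a1c, ac0, ac1, he₀.map_mul, he₁.map_mul,
      dimDrop.map_smulFun_mul π hc hcs hcid, ContinuousMap.mul_apply, add_zero, zero_add]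
  · simp only [star_add, dimDrop.map_smulFun_star π hc hcs, Matrix.star_eq_conjTranspose,
      he₀.map_star, he₁.map_star, ContinuousMap.star_apply]
  · rw [← unitsMap_one, ← unitsMap_one, sub_mul, mul_sub, mul_sub, hp, b0, a01,
      ← he₀.map_le hp₀, mul_assoc, hp]
    simp
  · change _ * (unitsMap e₀ (F 0) + unitsMap e₁ (F 1) + π (dimDrop.smulFun c hc F)) = 0
    rw [← unitsMap_one, sub_mul]
    simp only [mul_add, he₀.le_map, b0, h0c, he₀.map_mul, a01, a0c, one_mul, sub_self]
  · change _ * (unitsMap e₀ (F 0) + unitsMap e₁ (F 1) + π (dimDrop.smulFun c hc F)) = 0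
    rw [← unitsMap_one, sub_mul]
    simp only [mul_add, he₁.le_map, b1, h1c, he₁.map_mul, a10, a1c, one_mul, sub_self]

end EndsHom

/-- The algebraic identities hold pointwise, so the homomorphisms `ρ` may be chosen separately at
each point; continuity is already contained in `T`. -/
theorem ContinuousMap.exists_starAlgHom_of_forall {X A B : Type*} [TopologicalSpace X]
    [NonUnitalSemiring A] [Module ℂ A] [Star A] [TopologicalSpace B] [NonUnitalSemiring B]
    [IsTopologicalSemiring B] [Module ℂ B] [ContinuousConstSMul ℂ B] [StarRing B] [ContinuousStar B]
    (T : A → C(X, B)) (h : ∀ x, ∃ ρ : A →⋆ₙₐ[ℂ] B, ∀ a, T a x = ρ a) :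
    ∃ Ψ : A →⋆ₙₐ[ℂ] C(X, B), ∀ a, Ψ a = T a := by
  choose ρ hρ using h
  refine ⟨{
    toFun := T
    map_smul' := fun c a => ?_
    map_zero' := ?_
    map_add' := fun a b => ?_
    map_mul' := fun a b => ?_
    map_star' := fun a => ?_ }, fun a => rfl⟩ <;> ext1 x <;> simp [hρ, map_star]

/-! ### Piecewise linear cutoffs. -/

section Cutoff

/-- The piecewise linear function on `[0,1]` which is `1` before `a` and `0` after `b`. -/
noncomputable def ramp (a b : ℝ) : C(unitInterval, ℂ) :=
  ⟨fun t => ((max 0 (min 1 ((b - t) / (b - a))) : ℝ) : ℂ), by fun_prop⟩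

variable {a b : ℝ}

theorem star_ramp (a b : ℝ) : star (ramp a b) = ramp a b := by
  ext1 t
  simp only [ramp, ContinuousMap.star_apply, ContinuousMap.coe_mk, RCLike.star_def,
    Complex.conj_ofReal]

theorem ramp_of_le (hab : a < b) {t : unitInterval} (ht : (t : ℝ) ≤ a) : ramp a b t = 1 := by
  have : 1 ≤ (b - t) / (b - a) := (one_le_div (sub_pos.2 hab)).2 (by linarith)
  simp [ramp, min_eq_left this]

theorem ramp_of_ge (hab : a < b) {t : unitInterval} (ht : b ≤ (t : ℝ)) : ramp a b t = 0 := by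
  have : (b - t) / (b - a) ≤ 0 := div_nonpos_of_nonpos_of_nonneg (by linarith) (by linarith)
  simp [ramp, max_eq_left ((min_le_right _ _).trans this)]

variable {s : ℕ → ℝ}

theorem ramp_mul_ramp (hs : StrictMono s) {i j : ℕ} (hij : i < j) :
    ramp (s i) (s (i + 1)) * ramp (s j) (s (j + 1)) = ramp (s i) (s (i + 1)) := by
  ext1 t
  rw [ContinuousMap.mul_apply]
  rcases le_total (t : ℝ) (s (i + 1)) with h | h
  · rw [ramp_of_le (hs j.lt_succ_self) (h.trans (hs.monotone hij)), mul_one]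
  · rw [ramp_of_ge (hs i.lt_succ_self) h, zero_mul]

/-- The transition intervals meet at most at an endpoint, so at any `t` one of the two ramps is `0`
or `1`. -/
theorem ramp_idempotent_or (hs : StrictMono s) {i j : ℕ} (hij : i ≠ j) (t : unitInterval) :
    ramp (s i) (s (i + 1)) t * ramp (s i) (s (i + 1)) t = ramp (s i) (s (i + 1)) t ∨
      ramp (s j) (s (j + 1)) t * ramp (s j) (s (j + 1)) t = ramp (s j) (s (j + 1)) t := by
  wlog h : i < j generalizing i j
  · exact (this hij.symm (by omega)).symm
  rcases le_total (t : ℝ) (s (i + 1)) with h' | h'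
  · right
    rw [ramp_of_le (hs j.lt_succ_self) (h'.trans (hs.monotone h)), mul_one]
  · left
    rw [ramp_of_ge (hs i.lt_succ_self) h', zero_mul]

end Cutoff

/-! ### The global decomposition. -/

section Decomposition
variable {X : Type*} [TopologicalSpace X] {k n : ℕ}

/-- `F ∘ h` minus the interpolation, along `u₀` and `u₁`, of the values of `F` at `0` and `1`. -/
noncomputable def dimDrop.remainder (h : C(unitInterval, unitInterval)) (hh : h 0 = 0 ∧ h 1 = 1)
    (u₀ u₁ : C(unitInterval, ℂ)) (hu₀ : u₀ 0 = 1 ∧ u₀ 1 = 0) (hu₁ : u₁ 0 = 0 ∧ u₁ 1 = 1)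
    (F : C(unitInterval, Matrix (Fin k) (Fin k) ℂ)) : dimDrop k :=
  ⟨⟨fun t => F (h t) - u₀ t • F 0 - u₁ t • F 1, by fun_prop⟩,
    ⟨0, by simp [hh.1, hu₀.1, hu₁.1]⟩, ⟨0, by simp [hh.2, hu₀.2, hu₁.2]⟩⟩

/-- The cutoff index varies with `x` without continuity, so the maps are defined through the fixed
functions `u₀, u₁` and the glued families `d₀, d₁`. At each `x` the dependence on the index cancels,
and the maps become those of `dimDrop.exists_starAlgHom_of_units`. -/
theorem dimDrop.exists_decomposition
    (Φ : dimDrop k →⋆ₙₐ[ℂ] C(X, Matrix (Fin n) (Fin n) ℂ))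
    (h : C(unitInterval, unitInterval)) (hh : h 0 = 0 ∧ h 1 = 1)
    (u₀ u₁ : C(unitInterval, ℂ)) (hu₀ : u₀ 0 = 1 ∧ u₀ 1 = 0) (hu₁ : u₁ 0 = 0 ∧ u₁ 1 = 1)
    (l₀ l₁ : ℕ → C(unitInterval, ℂ)) (hl₀ : ∀ j, star (l₀ j) = l₀ j) (hl₁ : ∀ j, star (l₁ j) = l₁ j)
    (hul₀ : ∀ j, (u₀ - l₀ j) 0 = 0 ∧ (u₀ - l₀ j) 1 = 0)
    (hul₁ : ∀ j, (u₁ - l₁ j) 0 = 0 ∧ (u₁ - l₁ j) 1 = 0)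
    (hl : ∀ i j, l₀ i * l₁ j = 0)
    (hh₀ : ∀ j t, l₀ j t = 0 ∨ h t = 0) (hh₁ : ∀ j t, l₁ j t = 0 ∨ h t = 1)
    (d₀ d₁ : Fin k → Fin k → C(X, Matrix (Fin n) (Fin n) ℂ))
    (hd₀ : ∀ x, ∃ j, IsIdempotentElem (dimDrop.evalHom Φ x (dimDrop.incl k (l₀ j))) ∧
      ∃ e : Fin k → Fin k → Matrix (Fin n) (Fin n) ℂ,
        IsMatrixUnits (dimDrop.evalHom Φ x (dimDrop.incl k (l₀ j))) e ∧
        (dimDrop.evalHom Φ x (dimDrop.incl k (l₀ j)) - ∑ a, e a a).rank ≤ k ∧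
        ∀ a b, d₀ a b x = e a b + dimDrop.evalHom Φ x
          (dimDrop.smulFun (u₀ - l₀ j) (hul₀ j) (.const _ (Matrix.single a b 1))))
    (hd₁ : ∀ x, ∃ j, IsIdempotentElem (dimDrop.evalHom Φ x (dimDrop.incl k (l₁ j))) ∧
      ∃ e : Fin k → Fin k → Matrix (Fin n) (Fin n) ℂ,
        IsMatrixUnits (dimDrop.evalHom Φ x (dimDrop.incl k (l₁ j))) e ∧
        (dimDrop.evalHom Φ x (dimDrop.incl k (l₁ j)) - ∑ a, e a a).rank ≤ k ∧
        ∀ a b, d₁ a b x = e a b + dimDrop.evalHom Φ x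
          (dimDrop.smulFun (u₁ - l₁ j) (hul₁ j) (.const _ (Matrix.single a b 1)))) :
    ∃ (Q₀ Q₁ : C(X, Matrix (Fin n) (Fin n) ℂ))
      (ψ : C(unitInterval, Matrix (Fin k) (Fin k) ℂ) →⋆ₙₐ[ℂ] C(X, Matrix (Fin n) (Fin n) ℂ)),
      IsStarProjection Q₀ ∧ IsStarProjection Q₁ ∧ Q₀ * Q₁ = 0 ∧ Q₀ * ψ 1 = 0 ∧ Q₁ * ψ 1 = 0 ∧
      (∀ x, (Q₀ x).rank ≤ k ∧ (Q₁ x).rank ≤ k) ∧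
      ∀ f f' : dimDrop k, (∀ t, (f' : C(unitInterval, Matrix (Fin k) (Fin k) ℂ)) t =
        (f : C(unitInterval, Matrix (Fin k) (Fin k) ℂ)) (h t)) →
        dimDrop.val₀ f • Q₀ + dimDrop.val₁ f • Q₁ +
          ψ (f : C(unitInterval, Matrix (Fin k) (Fin k) ℂ)) = Φ f' := by
  have hsum : ∀ (x : X) (u l : C(unitInterval, ℂ)) (hul : (u - l) 0 = 0 ∧ (u - l) 1 = 0)
      (d : Fin k → Fin k → C(X, Matrix (Fin n) (Fin n) ℂ))
      (e : Fin k → Fin k → Matrix (Fin n) (Fin n) ℂ) (_ : ∀ a b, d a b x = e a b +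
        dimDrop.evalHom Φ x (dimDrop.smulFun (u - l) hul (.const _ (Matrix.single a b 1))))
      (m : Matrix (Fin k) (Fin k) ℂ), unitsMap (fun a b => d a b x) m = unitsMap e m +
        dimDrop.evalHom Φ x (dimDrop.smulFun (u - l) hul (.const _ m)) := by
    intro x u l hul d e hd m
    rw [← dimDrop.sum_smulFun_single]
    simp only [unitsMap, hd, smul_add, Finset.sum_add_distrib, map_sum, map_smul]
  let T : C(unitInterval, Matrix (Fin k) (Fin k) ℂ) → C(X, Matrix (Fin n) (Fin n) ℂ) := fun F =>
    Φ (dimDrop.remainder h hh u₀ u₁ hu₀ hu₁ F) + ∑ a, ∑ b, F 0 a b • d₀ a b +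
      ∑ a, ∑ b, F 1 a b • d₁ a b
  let Q₀ : C(X, Matrix (Fin n) (Fin n) ℂ) := Φ (dimDrop.incl k u₀) - ∑ a, d₀ a a
  let Q₁ : C(X, Matrix (Fin n) (Fin n) ℂ) := Φ (dimDrop.incl k u₁) - ∑ a, d₁ a a
  have hQ : ∀ (x : X) (u l : C(unitInterval, ℂ)) (hul : (u - l) 0 = 0 ∧ (u - l) 1 = 0)
      (d : Fin k → Fin k → C(X, Matrix (Fin n) (Fin n) ℂ))
      (e : Fin k → Fin k → Matrix (Fin n) (Fin n) ℂ) (_ : ∀ a b, d a b x = e a b +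
        dimDrop.evalHom Φ x (dimDrop.smulFun (u - l) hul (.const _ (Matrix.single a b 1)))),
      (Φ (dimDrop.incl k u) - ∑ a, d a a) x =
        dimDrop.evalHom Φ x (dimDrop.incl k l) - ∑ a, e a a := by
    intro x u l hul d e hd
    have h1 := hsum x u l hul d e hd 1
    rw [unitsMap_one, unitsMap_one] at h1
    have h2 : dimDrop.smulFun (u - l) hul (.const _ (1 : Matrix (Fin k) (Fin k) ℂ)) =
        dimDrop.incl k (u - l) := rfl
    rw [h2, map_sub, map_sub] at h1
    rw [ContinuousMap.sub_apply, ContinuousMap.sum_apply, h1]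
    change dimDrop.evalHom Φ x (dimDrop.incl k u) - _ = _
    abel
  have key : ∀ x, ∃ ρ : C(unitInterval, Matrix (Fin k) (Fin k) ℂ) →⋆ₙₐ[ℂ] Matrix (Fin n) (Fin n) ℂ,
      (∀ F, T F x = ρ F) ∧ IsStarProjection (Q₀ x) ∧ IsStarProjection (Q₁ x) ∧ Q₀ x * Q₁ x = 0 ∧
      (∀ F, Q₀ x * ρ F = 0) ∧ (∀ F, Q₁ x * ρ F = 0) ∧ (Q₀ x).rank ≤ k ∧ (Q₁ x).rank ≤ k := by
    intro x
    obtain ⟨i, hi, e₀, he₀, hr₀, hde₀⟩ := hd₀ x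
    obtain ⟨j, hj, e₁, he₁, hr₁, hde₁⟩ := hd₁ x
    have hq₀ : Q₀ x = _ := hQ x u₀ (l₀ i) (hul₀ i) d₀ e₀ hde₀
    have hq₁ : Q₁ x = _ := hQ x u₁ (l₁ j) (hul₁ j) d₁ e₁ hde₁
    have hc : (1 - l₀ i - l₁ j) 0 = 0 ∧ (1 - l₀ i - l₁ j) 1 = 0 := by
      have h1 := hul₀ i
      have h2 := hul₁ j
      simp only [ContinuousMap.sub_apply, hu₀.1, hu₀.2, hu₁.1, hu₁.2, sub_eq_zero] at h1 h2
      simp [← h1.1, ← h1.2, ← h2.1, ← h2.2]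
    obtain ⟨ρ, hρ, hρ01, hρ0, hρ1⟩ := dimDrop.exists_starAlgHom_of_units (hl₀ i) (hl₁ j) (hl i j) hc
      hi hj he₀ he₁
    refine ⟨ρ.comp (ContinuousMap.compStarAlgHom' ℂ (Matrix (Fin k) (Fin k) ℂ) h :
      C(unitInterval, Matrix (Fin k) (Fin k) ℂ) →⋆ₙₐ[ℂ] C(unitInterval, Matrix (Fin k) (Fin k) ℂ)),
      fun F => ?_, ?_, ?_, ?_, fun F => ?_, fun F => ?_, ?_, ?_⟩
    · change _ = ρ (F.comp h)
      rw [hρ]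
      have hT : T F x = dimDrop.evalHom Φ x (dimDrop.remainder h hh u₀ u₁ hu₀ hu₁ F) +
          unitsMap (fun a b => d₀ a b x) (F 0) + unitsMap (fun a b => d₁ a b x) (F 1) := by
        simp only [T, unitsMap, ContinuousMap.add_apply, ContinuousMap.sum_apply,
          ContinuousMap.smul_apply]
        rfl
      -- On the supports of the cutoffs `F ∘ h` is the constant `F 0` or `F 1`, so removing them
      -- from `F ∘ h` differs from the remainder only by terms in these values.
      have hF : dimDrop.smulFun (1 - l₀ i - l₁ j) hc (F.comp h) =
          dimDrop.remainder h hh u₀ u₁ hu₀ hu₁ F + dimDrop.smulFun (u₀ - l₀ i) (hul₀ i) (.const _ (F 0))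
          + dimDrop.smulFun (u₁ - l₁ j) (hul₁ j) (.const _ (F 1)) := by
        refine dimDrop.ext fun t => ?_
        have h0 : l₀ i t • F (h t) = l₀ i t • F 0 := by
          rcases hh₀ i t with h | h <;> simp [h]
        have h1 : l₁ j t • F (h t) = l₁ j t • F 1 := by
          rcases hh₁ j t with h | h <;> simp [h]
        simp only [dimDrop.coe_add_apply, dimDrop.smulFun_apply, ContinuousMap.sub_apply,
          ContinuousMap.one_apply, ContinuousMap.comp_apply, ContinuousMap.const_apply, sub_smul,
          one_smul, h0, h1]
        change _ = F (h t) - u₀ t • F 0 - u₁ t • F 1 + _ + _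
        abel
      rw [hT, hsum x u₀ (l₀ i) (hul₀ i) d₀ e₀ hde₀, hsum x u₁ (l₁ j) (hul₁ j) d₁ e₁ hde₁, hF, map_add,
        map_add, ContinuousMap.comp_apply, ContinuousMap.comp_apply, hh.1, hh.2]
      abel
    · rw [hq₀]; exact he₀.isStarProjection_compl (dimDrop.isStarProjection_map_incl _ (hl₀ i) hi)
    · rw [hq₁]; exact he₁.isStarProjection_compl (dimDrop.isStarProjection_map_incl _ (hl₁ j) hj)
    · rw [hq₀, hq₁]; exact hρ01
    · rw [hq₀]; exact hρ0 _
    · rw [hq₁]; exact hρ1 _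
    · rw [hq₀]; exact hr₀
    · rw [hq₁]; exact hr₁
  obtain ⟨ψ, hψ⟩ := ContinuousMap.exists_starAlgHom_of_forall T fun x =>
    (key x).imp fun ρ hρ => hρ.1
  choose ρ hρ hQ₀ hQ₁ hQQ hQ₀ρ hQ₁ρ hr₀ hr₁ using key
  have hproj : ∀ Q : C(X, Matrix (Fin n) (Fin n) ℂ), (∀ x, IsStarProjection (Q x)) →
      IsStarProjection Q := fun Q hQ =>
    ⟨ContinuousMap.ext fun x => (hQ x).isIdempotentElem, ContinuousMap.ext fun x => (hQ x).isSelfAdjoint⟩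
  refine ⟨Q₀, Q₁, ψ, hproj _ hQ₀, hproj _ hQ₁, ContinuousMap.ext hQQ,
    ContinuousMap.ext fun x => ?_, ContinuousMap.ext fun x => ?_, fun x => ⟨hr₀ x, hr₁ x⟩,
    fun f f' hf => ?_⟩
  · rw [ContinuousMap.mul_apply, hψ, hρ, hQ₀ρ]; rfl
  · rw [ContinuousMap.mul_apply, hψ, hρ, hQ₁ρ]; rfl
  · have hF : f' = dimDrop.remainder h hh u₀ u₁ hu₀ hu₁
        (f : C(unitInterval, Matrix (Fin k) (Fin k) ℂ)) +
        dimDrop.val₀ f • dimDrop.incl k u₀ + dimDrop.val₁ f • dimDrop.incl k u₁ := by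
      refine dimDrop.ext fun t => ?_
      simp only [dimDrop.coe_add_apply, dimDrop.coe_smul_apply, dimDrop.incl_apply]
      change _ = (f : C(unitInterval, Matrix (Fin k) (Fin k) ℂ)) (h t) -
        u₀ t • (f : C(unitInterval, Matrix (Fin k) (Fin k) ℂ)) 0 -
        u₁ t • (f : C(unitInterval, Matrix (Fin k) (Fin k) ℂ)) 1 + _ + _
      rw [hf, dimDrop.val₀_spec, dimDrop.val₁_spec, smul_comm (u₀ t), smul_comm (u₁ t)]
      abel
    have hone : ∀ (c : ℂ) (d : Fin k → Fin k → C(X, Matrix (Fin n) (Fin n) ℂ)),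
        ∑ a, ∑ b, (c • (1 : Matrix (Fin k) (Fin k) ℂ)) a b • d a b = c • ∑ a, d a a := fun c d => by
      ext1 x
      simp only [ContinuousMap.sum_apply, ContinuousMap.smul_apply]
      exact unitsMap_smul_one (e := fun a b => d a b x) c
    rw [hψ, hF]
    simp only [T, Q₀, Q₁, dimDrop.val₀_spec, dimDrop.val₁_spec, hone, map_add, map_smul, smul_sub]
    abel

end Decomposition


/-! ### Norm bounds and the collapse of the interval. -/

theorem dimDrop.isClosed (k : ℕ) :
    IsClosed (dimDrop k : Set C(unitInterval, Matrix (Fin k) (Fin k) ℂ)) := by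
  have h : IsClosed {m : Matrix (Fin k) (Fin k) ℂ | ∃ c : ℂ, m = c • 1} := by
    have h1 := Submodule.closed_of_finiteDimensional
      (Submodule.span ℂ {(1 : Matrix (Fin k) (Fin k) ℂ)})
    convert h1 using 1
    ext m
    simp [Submodule.mem_span_singleton, eq_comm]
  exact (h.preimage (continuous_eval_const 0)).inter (h.preimage (continuous_eval_const 1))

/-- Closedness makes `I_k` a C*-algebra, and *-homomorphisms between C*-algebras are contractive. -/
theorem dimDrop.norm_map_le {k : ℕ} {X : Type*} [TopologicalSpace X] [CompactSpace X] {n : ℕ}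
    (Φ : dimDrop k →⋆ₙₐ[ℂ] C(X, Matrix (Fin n) (Fin n) ℂ)) (f : dimDrop k) :
    ‖Φ f‖ ≤ ‖(f : C(unitInterval, Matrix (Fin k) (Fin k) ℂ))‖ := by
  let _ : CStarAlgebra (dimDrop k) := StarSubalgebra.cstarAlgebra _ (h_closed := dimDrop.isClosed k)
  exact NonUnitalStarAlgHom.norm_apply_le Φ f

theorem IsFiniteSimplicialOfDimLE.t2Space {X : Type*} [TopologicalSpace X] {d : ℕ}
    (h : IsFiniteSimplicialOfDimLE X d) : T2Space X := by
  obtain ⟨N, K, -, -, ⟨e⟩⟩ := h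
  exact e.symm.t2Space

/-- The bound `η ≤ 1/4` keeps the two end intervals apart and `1 - 2η` positive. -/
theorem dimDrop.exists_modulus {k : ℕ} (F : Finset (dimDrop k)) {ε : ℝ} (hε : 0 < ε) :
    ∃ η, 0 < η ∧ η ≤ 1 / 4 ∧ ∀ f ∈ F, ∀ s t : unitInterval, |(s : ℝ) - t| ≤ η →
      ‖(f : C(unitInterval, Matrix (Fin k) (Fin k) ℂ)) s -
        (f : C(unitInterval, Matrix (Fin k) (Fin k) ℂ)) t‖ ≤ ε := by
  classical
  induction F using Finset.induction_on with
  | empty => exact ⟨1 / 4, by norm_num, le_rfl, by simp⟩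
  | insert f F _ ih =>
    obtain ⟨η, h0, h1, h2⟩ := ih
    obtain ⟨δ, hδ, h3⟩ := Metric.uniformContinuous_iff.1 (CompactSpace.uniformContinuous_of_continuous
      (f : C(unitInterval, Matrix (Fin k) (Fin k) ℂ)).continuous) ε hε
    refine ⟨min η (δ / 2), lt_min h0 (half_pos hδ), (min_le_left _ _).trans h1, ?_⟩
    intro g hg s t hst
    rcases Finset.mem_insert.1 hg with rfl | hg
    · rw [← dist_eq_norm]
      refine (h3 ?_).le
      rw [Subtype.dist_eq, Real.dist_eq]
      exact (hst.trans (min_le_right _ _)).trans_lt (half_lt_self hδ)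
    · exact h2 g hg s t (hst.trans (min_le_left _ _))

/-- The piecewise linear map of `[0,1]` to itself collapsing `[0, η]` to `0` and `[1 - η, 1]`
to `1`. -/
noncomputable def collapse (η : ℝ) : C(unitInterval, unitInterval) :=
  ⟨fun t => Set.projIcc 0 1 zero_le_one ((t - η) / (1 - 2 * η)), by
    refine continuous_projIcc.comp ?_
    fun_prop⟩

section Collapse
variable {η : ℝ}

theorem collapse_of_le (hη : η ≤ 1 / 4) {t : unitInterval} (ht : (t : ℝ) ≤ η) :
    collapse η t = 0 :=
  Set.projIcc_of_le_left zero_le_one (div_nonpos_of_nonpos_of_nonneg (by linarith) (by linarith))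

theorem collapse_of_ge (hη : η ≤ 1 / 4) {t : unitInterval} (ht : 1 - η ≤ (t : ℝ)) :
    collapse η t = 1 :=
  Set.projIcc_of_right_le zero_le_one ((one_le_div (by linarith)).2 (by linarith))

theorem abs_sub_collapse_le (h0 : 0 < η) (hη : η ≤ 1 / 4) (t : unitInterval) :
    |(t : ℝ) - collapse η t| ≤ η := by
  have ht0 := t.2.1
  have ht1 := t.2.2
  rcases le_total (t : ℝ) η with h | h
  · rw [collapse_of_le hη h, abs_le]
    constructor <;> simp <;> linarith
  rcases le_total (1 - η) (t : ℝ) with h' | h'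
  · rw [collapse_of_ge hη h', abs_le]
    constructor <;> simp <;> linarith
  have hpos : 0 < 1 - 2 * η := by linarith
  have hmem : ((t : ℝ) - η) / (1 - 2 * η) ∈ Set.Icc (0 : ℝ) 1 :=
    ⟨div_nonneg (by linarith) hpos.le, (div_le_one hpos).2 (by linarith)⟩
  have : (collapse η t : ℝ) = ((t : ℝ) - η) / (1 - 2 * η) := by
    change ((Set.projIcc 0 1 zero_le_one (((t : ℝ) - η) / (1 - 2 * η)) : unitInterval) : ℝ) = _
    rw [Set.projIcc_of_mem _ hmem]
  have h3 : (t : ℝ) - ((t : ℝ) - η) / (1 - 2 * η) = η * (1 - 2 * t) / (1 - 2 * η) := by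
    rw [eq_div_iff hpos.ne', sub_mul, div_mul_cancel₀ _ hpos.ne']
    ring
  rw [this, h3, abs_le, le_div_iff₀ hpos, div_le_iff₀ hpos]
  constructor <;> nlinarith

end Collapse

theorem corner_mem_of_add {X : Type*} [TopologicalSpace X] {n : ℕ}
    {P : C(X, Matrix (Fin n) (Fin n) ℂ)} (hP : IsStarProjection P)
    {Q R : C(X, Matrix (Fin n) (Fin n) ℂ)} (hQ : IsStarProjection Q) (hR : IsStarProjection R)
    (hQR : Q * R = 0) (h : Q + R = P) : Q ∈ corner P hP ∧ R ∈ corner P hP := by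
  have hRQ : R * Q = 0 := by
    have := congrArg Star.star hQR
    rwa [star_mul, hQ.isSelfAdjoint.star_eq, hR.isSelfAdjoint.star_eq, star_zero] at this
  constructor
  · change P * Q * P = Q
    simp only [← h, add_mul, mul_add, hQR, hRQ, hQ.isIdempotentElem.eq, add_zero]
  · change P * R * P = R
    simp only [← h, add_mul, mul_add, hQR, hRQ, hR.isIdempotentElem.eq, zero_add]

/-- An increasing sequence of levels between `η / 2` and `η`. -/
noncomputable def level (η : ℝ) (j : ℕ) : ℝ := η * (1 - (1 / 2) ^ (j + 1))

section Level
variable {η : ℝ}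

theorem level_strictMono (hη : 0 < η) : StrictMono (level η) := fun i j hij => by
  have : (1 / 2 : ℝ) ^ (j + 1) < (1 / 2) ^ (i + 1) :=
    pow_lt_pow_right_of_lt_one₀ (by norm_num) (by norm_num) (by omega)
  exact mul_lt_mul_of_pos_left (by linarith) hη

theorem level_le (hη : 0 < η) (j : ℕ) : level η j ≤ η := by
  have : (0 : ℝ) < (1 / 2) ^ (j + 1) := by positivity
  exact mul_le_of_le_one_right hη.le (by linarith)

theorem half_le_level (hη : 0 < η) (j : ℕ) : η / 2 ≤ level η j := by
  refine le_trans (le_of_eq ?_) ((level_strictMono hη).monotone j.zero_le)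
  simp [level]
  ring

end Level

/-- The cutoff functions near `0`. -/
noncomputable def cutoff (η : ℝ) (j : ℕ) : C(unitInterval, ℂ) :=
  ramp (level η j) (level η (j + 1))

section CutoffSequence
variable {η : ℝ}

theorem star_cutoff (η : ℝ) (j : ℕ) : star (cutoff η j) = cutoff η j := star_ramp _ _

theorem cutoff_of_le (hη : 0 < η) (j : ℕ) {t : unitInterval} (ht : (t : ℝ) ≤ η / 2) :
    cutoff η j t = 1 :=
  ramp_of_le (level_strictMono hη j.lt_succ_self) (ht.trans (half_le_level hη j))

theorem cutoff_of_ge (hη : 0 < η) (j : ℕ) {t : unitInterval} (ht : η ≤ (t : ℝ)) :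
    cutoff η j t = 0 :=
  ramp_of_ge (level_strictMono hη j.lt_succ_self) ((level_le hη (j + 1)).trans ht)

theorem cutoff_mul_cutoff (hη : 0 < η) {i j : ℕ} (hij : i < j) :
    cutoff η i * cutoff η j = cutoff η i := ramp_mul_ramp (level_strictMono hη) hij

theorem cutoff_idempotent_or (hη : 0 < η) {i j : ℕ} (hij : i ≠ j) (t : unitInterval) :
    cutoff η i t * cutoff η i t = cutoff η i t ∨ cutoff η j t * cutoff η j t = cutoff η j t :=
  ramp_idempotent_or (level_strictMono hη) hij t

end CutoffSequence

/-! ### Assembly of the splitting and the theorem. -/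

/-- The decomposition of a homomorphism whose spectrum meets both `[0, η/4]` and `[1 - η/4, 1]`
everywhere: up to the perturbation `f ↦ f ∘ collapse η`, it splits into two point evaluations of
multiplicity at most `k` and a homomorphism which extends to `C([0,1], M_k)`. -/
theorem dimDrop.exists_splitting {X : Type*} [TopologicalSpace X] [CompactSpace X] [T2Space X]
    (hX : HasPlaneCover X) {k n : ℕ} (hk : 1 ≤ k)
    (Φ : dimDrop k →⋆ₙₐ[ℂ] C(X, Matrix (Fin n) (Fin n) ℂ)) {η : ℝ} (h0 : 0 < η) (hη : η ≤ 1 / 4)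
    (hS : ∀ x, ∃ S, IsSpectrumOf ((dimDrop.evalHom Φ x).comp (dimDrop.incl k)) S ∧
      (∃ t ∈ S, (t : ℝ) ≤ η / 4) ∧ ∃ t ∈ S, 1 - η / 4 ≤ (t : ℝ)) :
    ∃ (Q₀ Q₁ : C(X, Matrix (Fin n) (Fin n) ℂ))
      (ψ : C(unitInterval, Matrix (Fin k) (Fin k) ℂ) →⋆ₙₐ[ℂ] C(X, Matrix (Fin n) (Fin n) ℂ)),
      IsStarProjection Q₀ ∧ IsStarProjection Q₁ ∧ Q₀ * Q₁ = 0 ∧ Q₀ * ψ 1 = 0 ∧ Q₁ * ψ 1 = 0 ∧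
      (∀ x, (Q₀ x).rank ≤ k ∧ (Q₁ x).rank ≤ k) ∧
      ∀ f f' : dimDrop k, (∀ t, (f' : C(unitInterval, Matrix (Fin k) (Fin k) ℂ)) t =
        (f : C(unitInterval, Matrix (Fin k) (Fin k) ℂ)) (collapse η t)) →
        dimDrop.val₀ f • Q₀ + dimDrop.val₁ f • Q₁ +
          ψ (f : C(unitInterval, Matrix (Fin k) (Fin k) ℂ)) = Φ f' := by
  let σ : C(unitInterval, unitInterval) := ⟨unitInterval.symm, unitInterval.continuous_symm⟩
  have hσ : ∀ t, (σ t : ℝ) = 1 - t := fun t => unitInterval.coe_symm_eq t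
  let l₀ : ℕ → C(unitInterval, ℂ) := cutoff η
  let l₁ : ℕ → C(unitInterval, ℂ) := fun j => (cutoff η j).comp σ
  -- Only the values of `u₀` and `u₁` at the ends matter: they agree there with every cutoff, so the
  -- differences `u - l j` vanish at `0` and `1`.
  let u₁ : C(unitInterval, ℂ) := ⟨fun t => ((t : ℝ) : ℂ), by fun_prop⟩
  let u₀ : C(unitInterval, ℂ) := 1 - u₁
  have hu₀ : u₀ 0 = 1 ∧ u₀ 1 = 0 := by simp [u₀, u₁]
  have hu₁ : u₁ 0 = 0 ∧ u₁ 1 = 1 := by simp [u₁]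
  clear_value u₀ u₁
  have hl₀ : ∀ j, star (l₀ j) = l₀ j := star_cutoff η
  have hl₁ : ∀ j, star (l₁ j) = l₁ j := fun j => ContinuousMap.ext fun t =>
    DFunLike.congr_fun (star_cutoff η j) (σ t)
  have hl₀1 : ∀ j (t : unitInterval), (t : ℝ) ≤ η / 2 → l₀ j t = 1 := fun j t => cutoff_of_le h0 j
  have hl₀0 : ∀ j (t : unitInterval), η ≤ (t : ℝ) → l₀ j t = 0 := fun j t => cutoff_of_ge h0 j
  have hl₁1 : ∀ j (t : unitInterval), 1 - η / 2 ≤ (t : ℝ) → l₁ j t = 1 := fun j t ht =>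
    cutoff_of_le h0 j (by rw [hσ]; linarith)
  have hl₁0 : ∀ j (t : unitInterval), (t : ℝ) ≤ 1 - η → l₁ j t = 0 := fun j t ht =>
    cutoff_of_ge h0 j (by rw [hσ]; linarith)
  have hul₀ : ∀ j, (u₀ - l₀ j) 0 = 0 ∧ (u₀ - l₀ j) 1 = 0 := fun j => by
    rw [ContinuousMap.sub_apply, ContinuousMap.sub_apply, hu₀.1, hu₀.2, hl₀1 j 0 (by simp; linarith),
      hl₀0 j 1 (by simp; linarith)]
    simp
  have hul₁ : ∀ j, (u₁ - l₁ j) 0 = 0 ∧ (u₁ - l₁ j) 1 = 0 := fun j => by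
    rw [ContinuousMap.sub_apply, ContinuousMap.sub_apply, hu₁.1, hu₁.2, hl₁1 j 1 (by simp; linarith),
      hl₁0 j 0 (by simp; linarith)]
    simp
  have hl : ∀ i j, l₀ i * l₁ j = 0 := fun i j => by
    ext1 t
    rw [ContinuousMap.mul_apply]
    rcases le_total (t : ℝ) η with h | h
    · rw [hl₁0 j t (by linarith), mul_zero]; rfl
    · rw [hl₀0 i t h, zero_mul]; rfl
  obtain ⟨d₀, hd₀⟩ := hX.exists_end_units hk Φ (n + 1) u₀ l₀ hl₀ hul₀
    (fun i j hij => cutoff_mul_cutoff h0 hij)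
    (fun x => by
      obtain ⟨S, hS, -⟩ := hS x
      exact hS.exists_isIdempotentElem l₀ fun i j t hij => cutoff_idempotent_or h0 hij t)
    (fun x j => by
      obtain ⟨S, hS, ⟨t, ht, htη⟩, -⟩ := hS x
      exact hS.map_ne_zero ht (by rw [hl₀1 j t (by linarith)]; exact one_ne_zero))
  obtain ⟨d₁, hd₁⟩ := hX.exists_end_units hk Φ (n + 1) u₁ l₁ hl₁ hul₁
    (fun i j hij => ContinuousMap.ext fun t => DFunLike.congr_fun (cutoff_mul_cutoff h0 hij) (σ t))
    (fun x => by
      obtain ⟨S, hS, -⟩ := hS x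
      exact hS.exists_isIdempotentElem l₁ fun i j t hij => cutoff_idempotent_or h0 hij (σ t))
    (fun x j => by
      obtain ⟨S, hS, -, t, ht, htη⟩ := hS x
      exact hS.map_ne_zero ht (by rw [hl₁1 j t (by linarith)]; exact one_ne_zero))
  refine dimDrop.exists_decomposition Φ (collapse η)
    ⟨collapse_of_le hη (by simpa using h0.le), collapse_of_ge hη (by simpa using h0.le)⟩
    u₀ u₁ hu₀ hu₁ l₀ l₁ hl₀ hl₁ hul₀ hul₁ hl ?_ ?_ d₀ d₁
    (fun x => (hd₀ x).imp fun j h => h.2) (fun x => (hd₁ x).imp fun j h => h.2)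
  · intro j t
    rcases le_total (t : ℝ) η with h | h
    · exact .inr (collapse_of_le hη h)
    · exact .inl (hl₀0 j t h)
  · intro j t
    rcases le_total (t : ℝ) (1 - η) with h | h
    · exact .inl (hl₁0 j t h)
    · exact .inr (collapse_of_ge hη h)

end

theorem theorem5p1 (k : ℕ) (hk : 1 ≤ k) (F : Finset (dimDrop k)) (ε : ℝ) (hε : 0 < ε) :
    ∃ η : ℝ, 0 < η ∧
      ∀ (X : Type*) [TopologicalSpace X] [CompactSpace X], IsFiniteSimplicialOfDimLE X 2 →
      ∀ (n : ℕ) (P : C(X, Matrix (Fin n) (Fin n) ℂ)) (hP : IsStarProjection P)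
        (φ : dimDrop k →⋆ₙₐ[ℂ] corner P hP),
        (φ 1 : C(X, Matrix (Fin n) (Fin n) ℂ)) = P →
        (∀ x : X, k ≤ ((homSpectrum (centralAt φ x)).filter fun t : unitInterval => (t : ℝ) ≤ η / 4).card ∧
          k ≤ ((homSpectrum (centralAt φ x)).filter fun t : unitInterval => 1 - η / 4 ≤ (t : ℝ)).card) →
        ∃ Q₀ ∈ corner P hP, ∃ Q₁ ∈ corner P hP, ∃ P₁ ∈ corner P hP,
          IsStarProjection Q₀ ∧ IsStarProjection Q₁ ∧
          Q₀ * Q₁ = 0 ∧ Q₀ * P₁ = 0 ∧ Q₁ * P₁ = 0 ∧ Q₀ + Q₁ + P₁ = P ∧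
          ∃ (hP₁ : IsStarProjection P₁)
            (ψ₁ : C(unitInterval, Matrix (Fin k) (Fin k) ℂ) →⋆ₙₐ[ℂ] corner P₁ hP₁),
            (ψ₁ 1 : C(X, Matrix (Fin n) (Fin n) ℂ)) = P₁ ∧
            (∀ f ∈ F, ‖(φ f : C(X, Matrix (Fin n) (Fin n) ℂ)) -
              (dimDrop.val₀ f • Q₀ + dimDrop.val₁ f • Q₁ +
                (ψ₁ (f : C(unitInterval, Matrix (Fin k) (Fin k) ℂ)) : C(X, Matrix (Fin n) (Fin n) ℂ)))‖ < ε) ∧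
            ∀ x : X, (Q₀ x).rank ≤ k ∧ (Q₁ x).rank ≤ k := by
  obtain ⟨η, h0, hη, hF⟩ := dimDrop.exists_modulus F (half_pos hε)
  refine ⟨η, h0, ?_⟩
  intro X _ _ hX n P hP φ hφ hS
  have := hX.t2Space
  have : Nonempty (Fin k) := ⟨⟨0, hk⟩⟩
  let Φ : dimDrop k →⋆ₙₐ[ℂ] C(X, Matrix (Fin n) (Fin n) ℂ) :=
    (NonUnitalStarSubalgebraClass.subtype (corner P hP)).comp φ
  have hmem : ∀ (S : Multiset unitInterval) (p : unitInterval → Prop) [DecidablePred p],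
      k ≤ (S.filter p).card → ∃ t ∈ S, p t := fun S p _ h => by
    obtain ⟨t, ht⟩ := Multiset.card_pos_iff_exists_mem.1 (hk.trans h)
    exact ⟨t, (Multiset.mem_filter.1 ht).1, (Multiset.mem_filter.1 ht).2⟩
  obtain ⟨Q₀, Q₁, ψ, hQ₀, hQ₁, hQQ, hQ₀ψ, hQ₁ψ, hr, hψ⟩ :=
    dimDrop.exists_splitting hX.hasPlaneCover hk Φ h0 hη fun x =>
      ⟨_, isSpectrumOf_homSpectrum (centralAt φ x), hmem _ _ (hS x).1, hmem _ _ (hS x).2⟩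
  have hP₁ : IsStarProjection (ψ 1) :=
    ⟨by change _ * _ = _; rw [← map_mul, one_mul], by change star _ = _; rw [← map_star, star_one]⟩
  have hval : dimDrop.val₀ (1 : dimDrop k) = 1 ∧ dimDrop.val₁ (1 : dimDrop k) = 1 := by
    have h1 := dimDrop.val₀_spec (1 : dimDrop k)
    have h2 := dimDrop.val₁_spec (1 : dimDrop k)
    obtain ⟨a⟩ := ‹Nonempty (Fin k)›
    have h3 := congrFun (congrFun h1 a) a
    have h4 := congrFun (congrFun h2 a) a
    simp only [OneMemClass.coe_one, ContinuousMap.one_apply, Matrix.smul_apply, Matrix.one_apply_eq,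
      smul_eq_mul, mul_one] at h3 h4
    exact ⟨h3.symm, h4.symm⟩
  -- The constant `1` is fixed by the collapse, so this is the splitting identity at `1`.
  have hsum : Q₀ + Q₁ + ψ 1 = P := by
    have h1 := hψ 1 1 fun t => rfl
    rw [hval.1, hval.2, one_smul, one_smul, OneMemClass.coe_one] at h1
    exact h1.trans hφ
  have hQ : IsStarProjection (Q₀ + Q₁) := hQ₀.add hQ₁ hQQ
  have hQ₁Q₀ : Q₁ * Q₀ = 0 := by
    have := congrArg Star.star hQQ
    rwa [star_mul, hQ₀.isSelfAdjoint.star_eq, hQ₁.isSelfAdjoint.star_eq, star_zero] at this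
  have hmem₀ := (corner_mem_of_add hP hQ₀ (hQ₁.add hP₁ hQ₁ψ) (by rw [mul_add, hQQ, hQ₀ψ, add_zero])
    (by rw [← add_assoc, hsum])).1
  have hmem₁ := (corner_mem_of_add hP hQ₁ (hQ₀.add hP₁ hQ₀ψ) (by rw [mul_add, hQ₁Q₀, hQ₁ψ, add_zero])
    (by rw [← add_assoc, add_comm Q₁, hsum])).1
  have hmem₂ := (corner_mem_of_add hP hQ hP₁ (by rw [add_mul, hQ₀ψ, hQ₁ψ, add_zero]) hsum).2
  refine ⟨Q₀, hmem₀, Q₁, hmem₁, ψ 1, hmem₂, hQ₀, hQ₁, hQQ, hQ₀ψ, hQ₁ψ, hsum, hP₁,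
    NonUnitalStarAlgHom.codRestrict ψ (corner (ψ 1) hP₁) (fun f => by
      change ψ 1 * ψ f * ψ 1 = ψ f
      rw [← map_mul, ← map_mul, one_mul, mul_one]), rfl, fun f hf => ?_, hr⟩
  let f' : dimDrop k := ⟨(f : C(unitInterval, Matrix (Fin k) (Fin k) ℂ)).comp (collapse η),
    ⟨dimDrop.val₀ f, by
      rw [ContinuousMap.comp_apply, collapse_of_le hη (by simpa using h0.le), dimDrop.val₀_spec]⟩,
    ⟨dimDrop.val₁ f, by
      rw [ContinuousMap.comp_apply, collapse_of_ge hη (by simpa using h0.le), dimDrop.val₁_spec]⟩⟩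
  change ‖Φ f - (_ + ψ (f : C(unitInterval, Matrix (Fin k) (Fin k) ℂ)))‖ < ε
  -- The error is `Φ(f - f ∘ collapse η)`, and the collapse moves points by at most `η`. The bound
  -- obtained is `ε/2`, non-strict, which leaves room for the strict inequality.
  rw [hψ f f' fun t => rfl, ← map_sub]
  refine (dimDrop.norm_map_le Φ _).trans_lt (lt_of_le_of_lt ?_ (half_lt_self hε))
  refine (ContinuousMap.norm_le _ (half_pos hε).le).2 fun t => ?_
  exact hF f hf t (collapse η t) (abs_sub_collapse_le h0 hη t)
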